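/- Let $\mathbb{T}=(\mathcal S,\Sigma,\mathit{ar},\mathit{coar},E)$ be a monoidal theory: a set $\mathcal S$ of sorts, a set $\Sigma$ of generators with arities and coarities in $\mathcal S^*$, and a set $E$ of pairs of parallel string diagrams over $\Sigma$. Let $\mathrm{Diag}_{\mathbb T}$ be the strict symmetric monoidal category presented by it: objects (monomials $U,V,\dots$) are words in $\mathcal S^*$, the monoidal product $\otimes$ on objects is concatenation with unit $1$ the empty word, and arrows are string diagrams modulo the congruence generated by $E$. *Tapes.* $\mathbf T(\mathrm{Diag}_{\mathbb T})$ has as objects words $P=\bigoplus_{i}U_i$ of monomials ($0$ is the empty word). Its arrows are the terms built with $;$, $\oplus$, identities and symmetries $\sigma^{\oplus}_{U,V}$ from $\triangleleft^p_U\colon U\to U\oplus U$ ($p\in(0,1)$), $!_U\colon U\to 0$, $?_U\colon 0\to U$, $\triangleright_U\colon U\oplus U\to U$ and $\underline{c}\colon U\to V$ for $c\in \mathrm{Diag}_{\mathbb T}[U,V]$, modulo: the axioms of strict symmetric monoidal categories; those making $(\triangleright,?)$ natural and coherent commutative monoids; those making $(\triangleleft^p,!)$ natural and coherent co-pointed-convex-algebras,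 namely $\triangleleft^p;(\triangleleft^q\oplus \mathrm{id})=\triangleleft^{\tilde p};(\mathrm{id}\oplus\triangleleft^{\tilde q})$ with $\tilde p=pq$, $\tilde q=\frac{p(1-q)}{1-pq}$, $\triangleleft^p;\triangleright=\mathrm{id}$, $\triangleleft^p;\sigma^\oplus=\triangleleft^{1-p}$, with naturality and coherence; and $\underline{\mathrm{id}}=\mathrm{id}$, $\underline{c;d}=\underline c;\underline d$. On objects $(\bigoplus_i U_i)\otimes(\bigoplus_j V_j)=\bigoplus_i\bigoplus_j U_iV_j$. The left distributors $\delta^l_{P,Q,R}\colon P\otimes(Q\oplus R)\to (P\otimes Q)\oplus(P\otimes R)$ are defined by $\delta^l_{0,Q,R}=\mathrm{id}_0$ and $\delta^l_{U\oplus P',Q,R}=(\mathrm{id}\oplus\delta^l_{P',Q,R});(\mathrm{id}_{U\otimes Q}\oplus\sigma^\oplus_{U\otimes R,P'\otimes Q}\oplus\mathrm{id}_{P'\otimes R})$, and the symmetries of $\otimes$ by $\sigma^\otimes_{P,0}=\mathrm{id}_0$, $\sigma^\otimes_{P,V\oplus Q'}=\delta^l_{P,V,Q'};(\bigoplus_i\underline{\sigma_{U_i,V}}\oplus\sigma^\otimes_{P,Q'})$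 for $P=\bigoplus_iU_i$. Whiskering $L_U$ (resp. $R_U$) by a monomial replaces each $\underline{c}$ in a term by $\underline{\mathrm{id}_U\otimes c}$ (resp. $\underline{c\otimes\mathrm{id}_U}$) and each object $V$ by $UV$ (resp. $VU$). For $t\colon P\to Q$ put $L_0(t)=R_0(t)=\mathrm{id}_0$, $L_{W\oplus S'}(t)=L_W(t)\oplus L_{S'}(t)$ and $R_{W\oplus S'}(t)=\delta^l_{P,W,S'};(R_W(t)\oplus R_{S'}(t));(\delta^l_{Q,W,S'})^{-1}$. The product of $t_1\colon P\to Q$ and $t_2\colon R\to S$ is $t_1\otimes t_2=L_P(t_2);R_S(t_1)$. *Matrices.* For monomials $U,V$ let $\mathrm{Diag}_{\mathbb T}^+[U,V]$ be the set of finitely supported probability subdistributions on $\mathrm{Diag}_{\mathbb T}[U,V]$, with composition $(d;e)(h)=\sum_{f;g=h}d(f)e(g)$. $\mathrm{StMat}(\mathrm{Diag}_{\mathbb T}^+)$ has the same objects as $\mathbf T(\mathrm{Diag}_{\mathbb T})$. An arrow $M\colon\bigoplus_{i=1}^nU_i\to\bigoplus_{j=1}^mV_j$ is an $m\times n$ matrix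 with entries $M_{ji}=p_{ji}\cdot d_{ji}$, where $d_{ji}\in \mathrm{Diag}^+_{\mathbb T}[U_i,V_j]$, $p_{ji}\in[0,1]$ and $\sum_jp_{ji}\le1$ for all $i$ (matrices with the same products $p_{ji}\cdot d_{ji}$ being identified). Composition is matrix multiplication and $\oplus$ is the block diagonal sum. For $d_1\in\mathrm{Diag}^+_{\mathbb T}[U_1,V_1]$ and $d_2\in\mathrm{Diag}^+_{\mathbb T}[U_2,V_2]$ put $(d_1\otimes^+d_2)(c)=\sum_{c_1\otimes c_2=c}d_1(c_1)\,d_2(c_2)$. The product $M\otimes N$ of matrices with entries $p_{i'i}\cdot d_{i'i}$ and $q_{j'j}\cdot e_{j'j}$ is the Kronecker product $(M\otimes N)_{(i',j'),(i,j)}=(p_{i'i}q_{j'j})\cdot(d_{i'i}\otimes^+e_{j'j})$. The symmetries of $\oplus$ and the left distributors are the evident permutation matrices, and the symmetry $P\otimes Q\to Q\otimes P$ of $\otimes$ has entry $1\cdot\sigma_{U_i,V_j}$ at row $(j,i)$ and column $(i,j)$ and zero elsewhere. **Claim.** With this structure, in which the right distributors, the annihilators and the associators and unitors of both products are identities, both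 $\mathbf T(\mathrm{Diag}_{\mathbb T})$ and $\mathrm{StMat}(\mathrm{Diag}_{\mathbb T}^+)$ are right strict rig categories, and they are isomorphic as rig categories: there is an isomorphism of categories $\mathbf T(\mathrm{Diag}_{\mathbb T})\to\mathrm{StMat}(\mathrm{Diag}_{\mathbb T}^+)$ that strictly preserves $\oplus,0,\otimes,1$, the symmetries, the distributors and all other structural isomorphisms. It is the identity on objects and maps $\underline c$ to the $1\times1$ matrix $(1\cdot c)$, $\triangleleft^p_U$ to $\begin{pmatrix}p\cdot\mathrm{id}_U\\(1-p)\cdot\mathrm{id}_U\end{pmatrix}$, $\triangleright_U$ to $\begin{pmatrix}1\cdot\mathrm{id}_U&1\cdot\mathrm{id}_U\end{pmatrix}$, and $!_U$ and $?_U$ to the empty matrices $U\to0$ and $0\to U$. -/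

import Mathlib

open CategoryTheory

universe u v w u' v' w'

namespace TapeDiagrams

/-! ### Freely generated strict symmetric monoidal categories -/

/-- Typed terms over sorts `S` and typed generators `G`. The objects are words over `S`. -/
inductive Term {S : Type u} (G : List S → List S → Type w) : List S → List S → Type (max u w)
  | idZero : Term G [] []
  | id (A : S) : Term G [A] [A]
  | symm (A B : S) : Term G ([A] ++ [B]) ([B] ++ [A])
  | gen {P Q : List S} (s : G P Q) : Term G P Q
  | comp {P Q R : List S} (f : Term G P Q) (g : Term G Q R) : Term G P R
  | tensor {P₁ Q₁ P₂ Q₂ : List S} (f : Term G P₁ Q₁) (g : Term G P₂ Q₂) :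
      Term G (P₁ ++ P₂) (Q₁ ++ Q₂)

namespace Term

variable {S : Type u} {G : List S → List S → Type w}

/-- A term read along equalities of its source and target words (e.g. associativity of `++`). -/
def castT {P Q P' Q' : List S} (hP : P = P') (hQ : Q = Q') (t : Term G P Q) : Term G P' Q' :=
  hP ▸ hQ ▸ t

/-- The identity of an arbitrary word. -/
def idW : (P : List S) → Term G P P
  | [] => idZero
  | A :: P => tensor (id A) (idW P)

/-- The symmetry of a letter with a word. -/
def symmL (A : S) : (Q : List S) → Term G ([A] ++ Q) (Q ++ [A])
  | [] => id A
  | B :: Q =>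
      comp (Q := [B] ++ ([A] ++ Q)) (tensor (symm A B) (idW Q) : Term G (([A] ++ [B]) ++ Q) _)
        (tensor (id B) (symmL A Q) : Term G _ ([B] ++ (Q ++ [A])))

/-- The symmetry of two arbitrary words. -/
def symmW : (P Q : List S) → Term G (P ++ Q) (Q ++ P)
  | [], Q => castT rfl (List.append_nil Q).symm (idW Q)
  | A :: P, Q =>
      comp (Q := [A] ++ (Q ++ P)) (tensor (id A) (symmW P Q) : Term G ([A] ++ (P ++ Q)) _)
        (castT rfl (by simp) (tensor (symmL A Q) (idW P) : Term G (([A] ++ Q) ++ P) _))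

/-- The congruence (for `;` and the monoidal product) generated by the axioms of strict symmetric
monoidal categories and by the pairs in `E`. It is stated between terms whose types need not be
syntactically the same, since the strictness axioms relate e.g. the types `(P ++ Q) ++ R` and
`P ++ (Q ++ R)`; related terms always have equal sources and equal targets. -/
inductive Eqv (E : ∀ {P Q : List S}, Term G P Q → Term G P Q → Prop) :
    ∀ {P Q P' Q' : List S}, Term G P Q → Term G P' Q' → Prop
  | ax {P Q : List S} {f g : Term G P Q} : E f g → Eqv E f g
  | refl {P Q : List S} (f : Term G P Q) : Eqv E f f
  | symm {P Q P' Q' : List S} {f : Term G P Q} {g : Term G P' Q'} : Eqv E f g → Eqv E g f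
  | trans {P Q P' Q' P'' Q'' : List S} {f : Term G P Q} {g : Term G P' Q'} {h : Term G P'' Q''} :
      Eqv E f g → Eqv E g h → Eqv E f h
  | comp {P Q R P' Q' R' : List S} {f : Term G P Q} {g : Term G Q R} {f' : Term G P' Q'}
      {g' : Term G Q' R'} : Eqv E f f' → Eqv E g g' → Eqv E (f.comp g) (f'.comp g')
  | tensor {P₁ Q₁ P₂ Q₂ P₁' Q₁' P₂' Q₂' : List S} {f : Term G P₁ Q₁} {g : Term G P₂ Q₂}
      {f' : Term G P₁' Q₁'} {g' : Term G P₂' Q₂'} :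
      Eqv E f f' → Eqv E g g' → Eqv E (f.tensor g) (f'.tensor g')
  | comp_assoc {P Q R T : List S} (f : Term G P Q) (g : Term G Q R) (h : Term G R T) :
      Eqv E ((f.comp g).comp h) (f.comp (g.comp h))
  | id_comp {P Q : List S} (f : Term G P Q) : Eqv E ((idW P).comp f) f
  | comp_id {P Q : List S} (f : Term G P Q) : Eqv E (f.comp (idW Q)) f
  | interchange {P₁ Q₁ R₁ P₂ Q₂ R₂ : List S} (f₁ : Term G P₁ Q₁) (g₁ : Term G Q₁ R₁)
      (f₂ : Term G P₂ Q₂) (g₂ : Term G Q₂ R₂) :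
      Eqv E ((f₁.tensor f₂).comp (g₁.tensor g₂)) ((f₁.comp g₁).tensor (f₂.comp g₂))
  | idZero_tensor {P Q : List S} (f : Term G P Q) : Eqv E (idZero.tensor f) f
  | tensor_idZero {P Q : List S} (f : Term G P Q) : Eqv E (f.tensor idZero) f
  | tensor_assoc {P₁ Q₁ P₂ Q₂ P₃ Q₃ : List S} (f : Term G P₁ Q₁) (g : Term G P₂ Q₂)
      (h : Term G P₃ Q₃) : Eqv E ((f.tensor g).tensor h) (f.tensor (g.tensor h))
  | symm_symm (P Q : List S) : Eqv E ((symmW P Q).comp (symmW Q P)) (idW (P ++ Q))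
  | symm_nat {P Q : List S} (s : Term G P Q) (R : List S) :
      Eqv E ((s.tensor (idW R)).comp (symmW Q R)) ((symmW P R).comp ((idW R).tensor s))

section Eqv

variable {E : ∀ {P Q : List S}, Term G P Q → Term G P Q → Prop}

theorem Eqv.type_eq {P Q P' Q' : List S} {f : Term G P Q} {g : Term G P' Q'}
    (h : Eqv E f g) : P = P' ∧ Q = Q' := by
  induction h <;> simp_all

theorem eqv_castT {P Q P' Q' : List S} (hP : P = P') (hQ : Q = Q') (t : Term G P Q) :
    Eqv E (castT hP hQ t) t := by
  subst hP hQ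
  exact Eqv.refl _

end Eqv

/-- The extension to terms of an assignment on sorts and generators. -/
def ext {S' : Type u'} {G' : List S' → List S' → Type w'} (φ : S → S')
    (γ : ∀ {P Q : List S}, G P Q → Term G' (P.map φ) (Q.map φ)) :
    ∀ {P Q : List S}, Term G P Q → Term G' (P.map φ) (Q.map φ)
  | _, _, idZero => idZero
  | _, _, id A => id (φ A)
  | _, _, symm A B => symm (φ A) (φ B)
  | _, _, gen s => γ s
  | _, _, comp f g => comp (ext φ γ f) (ext φ γ g)
  | _, _, tensor f g =>
      castT List.map_append.symm List.map_append.symm (tensor (ext φ γ f) (ext φ γ g))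

section ext

variable {S' : Type u'} {G' : List S' → List S' → Type w'} (φ : S → S')
  (γ : ∀ {P Q : List S}, G P Q → Term G' (P.map φ) (Q.map φ))
  {E' : ∀ {P Q : List S'}, Term G' P Q → Term G' P Q → Prop}

theorem ext_tensor {P₁ Q₁ P₂ Q₂ : List S} (f : Term G P₁ Q₁) (g : Term G P₂ Q₂) :
    Eqv E' (ext φ γ (f.tensor g)) ((ext φ γ f).tensor (ext φ γ g)) := by
  rw [ext]; exact eqv_castT _ _ _

theorem ext_castT {P Q P' Q' : List S} (hP : P = P') (hQ : Q = Q') (t : Term G P Q) :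
    Eqv E' (ext φ γ (castT hP hQ t)) (ext φ γ t) := by
  subst hP hQ
  exact Eqv.refl _

theorem ext_idW (P : List S) : Eqv E' (ext φ γ (idW P)) (idW (P.map φ)) := by
  induction P with
  | nil => exact Eqv.refl _
  | cons A P ih => exact (ext_tensor φ γ _ _).trans (Eqv.tensor (Eqv.refl _) ih)

theorem ext_symmL (A : S) (Q : List S) :
    Eqv E' (ext φ γ (symmL A Q)) (symmL (φ A) (Q.map φ)) := by
  induction Q with
  | nil => exact Eqv.refl _
  | cons B Q ih =>
    exact Eqv.comp ((ext_tensor φ γ _ _).trans (Eqv.tensor (Eqv.refl _) (ext_idW φ γ Q)))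
      ((ext_tensor φ γ _ _).trans (Eqv.tensor (Eqv.refl _) ih))

theorem ext_symmW (P Q : List S) :
    Eqv E' (ext φ γ (symmW P Q)) (symmW (P.map φ) (Q.map φ)) := by
  induction P with
  | nil =>
    exact (ext_castT φ γ _ _ _).trans ((ext_idW φ γ Q).trans (eqv_castT _ _ _).symm)
  | cons A P ih =>
    refine Eqv.comp ((ext_tensor φ γ _ _).trans (Eqv.tensor (Eqv.refl _) ih)) ?_
    refine (ext_castT φ γ _ _ _).trans (Eqv.trans ?_ (eqv_castT _ _ _).symm)
    exact (ext_tensor φ γ _ _).trans (Eqv.tensor (ext_symmL φ γ A Q) (ext_idW φ γ P))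

theorem ext_eqv {E : ∀ {P Q : List S}, Term G P Q → Term G P Q → Prop}
    (hE : ∀ {P Q : List S} {f g : Term G P Q}, E f g → Eqv E' (ext φ γ f) (ext φ γ g))
    {P Q P' Q' : List S} {f : Term G P Q} {g : Term G P' Q'} (h : Eqv E f g) :
    Eqv E' (ext φ γ f) (ext φ γ g) := by
  have T : ∀ {P₁ Q₁ P₂ Q₂ : List S} (f : Term G P₁ Q₁) (g : Term G P₂ Q₂),
    Eqv E' (ext φ γ (f.tensor g)) ((ext φ γ f).tensor (ext φ γ g)) := ext_tensor φ γ
  induction h with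
  | ax h => exact hE h
  | refl f => exact Eqv.refl _
  | symm _ ih => exact ih.symm
  | trans _ _ ih₁ ih₂ => exact ih₁.trans ih₂
  | comp _ _ ih₁ ih₂ => exact Eqv.comp ih₁ ih₂
  | tensor _ _ ih₁ ih₂ => exact (T _ _).trans ((Eqv.tensor ih₁ ih₂).trans (T _ _).symm)
  | comp_assoc f g h => exact Eqv.comp_assoc _ _ _
  | id_comp f => exact (Eqv.comp (ext_idW φ γ _) (Eqv.refl _)).trans (Eqv.id_comp _)
  | comp_id f => exact (Eqv.comp (Eqv.refl _) (ext_idW φ γ _)).trans (Eqv.comp_id _)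
  | interchange f₁ g₁ f₂ g₂ =>
    exact (Eqv.comp (T _ _) (T _ _)).trans
      ((Eqv.interchange _ _ _ _).trans (T (f₁.comp g₁) (f₂.comp g₂)).symm)
  | idZero_tensor f => exact (T _ _).trans (Eqv.idZero_tensor _)
  | tensor_idZero f => exact (T _ _).trans (Eqv.tensor_idZero _)
  | tensor_assoc f g h =>
    exact ((T _ _).trans (Eqv.tensor (T _ _) (Eqv.refl _))).trans ((Eqv.tensor_assoc _ _ _).trans
      ((T _ _).trans (Eqv.tensor (Eqv.refl _) (T _ _))).symm)
  | symm_symm P Q =>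
    refine (Eqv.comp (ext_symmW φ γ P Q) (ext_symmW φ γ Q P)).trans
      ((Eqv.symm_symm _ _).trans ?_)
    rw [← List.map_append]
    exact (ext_idW φ γ _).symm
  | symm_nat s R =>
    exact (Eqv.comp ((T _ _).trans (Eqv.tensor (Eqv.refl _) (ext_idW φ γ R)))
      (ext_symmW φ γ _ _)).trans ((Eqv.symm_nat _ _).trans
      (Eqv.comp (ext_symmW φ γ _ _)
        ((T _ _).trans (Eqv.tensor (ext_idW φ γ R) (Eqv.refl _)))).symm)

end ext

end Term

/-- The arrows of the strict symmetric monoidal category presented by the generators `G` and the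
equations `E`. -/
def FreeHom {S : Type u} {G : List S → List S → Type w}
    (E : ∀ {P Q : List S}, Term G P Q → Term G P Q → Prop) (P Q : List S) : Type (max u w) :=
  Quot fun f g : Term G P Q => Term.Eqv E f g

namespace FreeHom

variable {S : Type u} {G : List S → List S → Type w}
  {E : ∀ {P Q : List S}, Term G P Q → Term G P Q → Prop}

/-- The class of a term. -/
def mk {P Q : List S} (t : Term G P Q) : FreeHom E P Q := Quot.mk _ t

theorem sound {P Q : List S} {f g : Term G P Q} (h : Term.Eqv E f g) :
    (mk f : FreeHom E P Q) = mk g := Quot.sound h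

/-- Composition of classes of terms. -/
def comp {P Q R : List S} (f : FreeHom E P Q) (g : FreeHom E Q R) : FreeHom E P R :=
  Quot.map₂ Term.comp (fun f _ _ h => .comp (.refl f) h) (fun _ _ g h => .comp h (.refl g)) f g

/-- Monoidal product of classes of terms. -/
def tensor {P₁ Q₁ P₂ Q₂ : List S} (f : FreeHom E P₁ Q₁) (g : FreeHom E P₂ Q₂) :
    FreeHom E (P₁ ++ P₂) (Q₁ ++ Q₂) :=
  Quot.map₂ Term.tensor (fun f _ _ h => .tensor (.refl f) h)
    (fun _ _ g h => .tensor h (.refl g)) f g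

theorem comp_assoc {P Q R T : List S} (f : FreeHom E P Q) (g : FreeHom E Q R)
    (h : FreeHom E R T) : (f.comp g).comp h = f.comp (g.comp h) := by
  induction f using Quot.ind
  induction g using Quot.ind
  induction h using Quot.ind
  exact sound (.comp_assoc _ _ _)

theorem id_comp {P Q : List S} (f : FreeHom E P Q) : (mk (Term.idW P)).comp f = f := by
  induction f using Quot.ind
  exact sound (.id_comp _)

theorem comp_id {P Q : List S} (f : FreeHom E P Q) : f.comp (mk (Term.idW Q)) = f := by
  induction f using Quot.ind
  exact sound (.comp_id _)

theorem interchange {P₁ Q₁ R₁ P₂ Q₂ R₂ : List S} (f₁ : FreeHom E P₁ Q₁) (g₁ : FreeHom E Q₁ R₁)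
    (f₂ : FreeHom E P₂ Q₂) (g₂ : FreeHom E Q₂ R₂) :
    (f₁.tensor f₂).comp (g₁.tensor g₂) = (f₁.comp g₁).tensor (f₂.comp g₂) := by
  induction f₁ using Quot.ind
  induction g₁ using Quot.ind
  induction f₂ using Quot.ind
  induction g₂ using Quot.ind
  exact sound (.interchange _ _ _ _)

theorem idW_tensor_idW (P Q : List S) :
    (mk (Term.idW P) : FreeHom E P P).tensor (mk (Term.idW Q)) = mk (Term.idW (P ++ Q)) := by
  refine sound ?_
  induction P with
  | nil => exact .idZero_tensor _
  | cons A P ih => exact (Term.Eqv.tensor_assoc _ _ _).trans (.tensor (.refl _) ih)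

end FreeHom

/-! ### Monoidal theories and string diagrams -/

/-- A monoidal signature: sorts, generators, and the arity and coarity of each generator. -/
structure MonoidalSignature where
  /-- the basic sorts -/
  Sorts : Type u
  /-- the generators -/
  Gen : Type v
  /-- the arity -/
  ar : Gen → List Sorts
  /-- the coarity -/
  coar : Gen → List Sorts

/-- The generators of a signature as a family indexed by arity and coarity. -/
inductive MonoidalSignature.TypedGen (Sig : MonoidalSignature.{u, v}) :
    List Sig.Sorts → List Sig.Sorts → Type (max u v)
  | mk (s : Sig.Gen) : TypedGen Sig (Sig.ar s) (Sig.coar s)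

/-- String diagrams over a signature: the arrows of the strict symmetric monoidal category freely
generated by it. -/
abbrev MonoidalSignature.DiagHom (Sig : MonoidalSignature.{u, v}) (U V : List Sig.Sorts) :
    Type (max u v) :=
  FreeHom (G := Sig.TypedGen) (fun _ _ => False) U V

/-- A monoidal theory: a signature and a set of pairs of parallel string diagrams over it. -/
structure MonoidalTheory extends MonoidalSignature.{u, v} where
  /-- the equations -/
  E : ∀ {U V : List toMonoidalSignature.Sorts},
    toMonoidalSignature.DiagHom U V → toMonoidalSignature.DiagHom U V → Prop

/-- Words over the sorts: the objects of the category of string diagrams modulo the theory. -/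
def Diag (T : MonoidalTheory.{u, v}) : Type u := List T.Sorts

namespace Diag

variable {T : MonoidalTheory.{u, v}}

/-- Arrows: string diagrams modulo the congruence generated by the equations of the theory. -/
instance : Category.{max u v} (Diag T) where
  Hom U V := FreeHom (G := T.TypedGen) (fun f g => T.E (FreeHom.mk f) (FreeHom.mk g)) U V
  id U := FreeHom.mk (Term.idW U)
  comp f g := FreeHom.comp f g
  id_comp f := FreeHom.id_comp f
  comp_id f := FreeHom.comp_id f
  assoc f g h := FreeHom.comp_assoc f g h

/-- The monoidal product on objects: concatenation. -/
def mul (U V : Diag T) : Diag T := List.append U V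

/-- The monoidal unit: the empty word. -/
def one : Diag T := ([] : List T.Sorts)

theorem mul_assoc (U V W : Diag T) : mul (mul U V) W = mul U (mul V W) :=
  List.append_assoc (α := T.Sorts) U V W

theorem one_mul (U : Diag T) : mul one U = U := List.nil_append (α := T.Sorts) U

theorem mul_one (U : Diag T) : mul U one = U := List.append_nil (α := T.Sorts) U

/-- The monoidal product of string diagrams. -/
def tensor {U₁ V₁ U₂ V₂ : Diag T} (f : U₁ ⟶ V₁) (g : U₂ ⟶ V₂) : mul U₁ U₂ ⟶ mul V₁ V₂ :=
  FreeHom.tensor f g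

/-- The symmetry of string diagrams. -/
def symm (U V : Diag T) : mul U V ⟶ mul V U :=
  FreeHom.mk (Term.symmW (S := T.Sorts) U V)

theorem tensor_id (U V : Diag T) : tensor (𝟙 U) (𝟙 V) = 𝟙 (mul U V) :=
  FreeHom.idW_tensor_idW U V

theorem tensor_comp {U₁ V₁ W₁ U₂ V₂ W₂ : Diag T} (f₁ : U₁ ⟶ V₁) (g₁ : V₁ ⟶ W₁)
    (f₂ : U₂ ⟶ V₂) (g₂ : V₂ ⟶ W₂) :
    tensor (f₁ ≫ g₁) (f₂ ≫ g₂) = tensor f₁ f₂ ≫ tensor g₁ g₂ :=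
  (FreeHom.interchange f₁ g₁ f₂ g₂).symm

/-- The functor `c ↦ id_U ⊗ c`. -/
def leftFunctor (U : Diag T) : Diag T ⥤ Diag T where
  obj V := mul U V
  map c := tensor (𝟙 U) c
  map_id V := tensor_id U V
  map_comp c d := by rw [← tensor_comp, Category.comp_id]

/-- The functor `c ↦ c ⊗ id_U`. -/
def rightFunctor (U : Diag T) : Diag T ⥤ Diag T where
  obj V := mul V U
  map c := tensor c (𝟙 U)
  map_id V := tensor_id V U
  map_comp c d := by rw [← tensor_comp, Category.comp_id]

end Diag

/-! ### Tapes over a category -/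

/-- `p` lies in the open unit interval. -/
abbrev OpenUnit : Type := Set.Ioo (0 : ℝ) 1

namespace OpenUnit

/-- `1 - p`. -/
def compl (p : OpenUnit) : OpenUnit := ⟨1 - p.1, by linarith [p.2.2], by linarith [p.2.1]⟩

/-- `p̃ = p q`. -/
def assocFst (p q : OpenUnit) : OpenUnit :=
  ⟨p.1 * q.1, mul_pos p.2.1 q.2.1, mul_lt_one_of_nonneg_of_lt_one_left p.2.1.le p.2.2 q.2.2.le⟩

/-- `q̃ = p (1 - q) / (1 - p q)`. -/
noncomputable def assocSnd (p q : OpenUnit) : OpenUnit :=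
  ⟨p.1 * (1 - q.1) / (1 - p.1 * q.1), by
    obtain ⟨p, hp, hp'⟩ := p
    obtain ⟨q, hq, hq'⟩ := q
    have h : 0 < 1 - p * q := by nlinarith
    refine ⟨div_pos (mul_pos hp (by linarith)) h, ?_⟩
    rw [div_lt_one h]
    nlinarith⟩

end OpenUnit

/-- The generators of tapes over `C`. -/
inductive TapeGen (C : Type u) [Category.{v} C] : List C → List C → Type (max u v)
  | split (p : OpenUnit) (U : C) : TapeGen C [U] [U, U]
  | bang (U : C) : TapeGen C [U] []
  | cobang (U : C) : TapeGen C [] [U]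
  | codiag (U : C) : TapeGen C [U, U] [U]
  | tape {U V : C} (c : U ⟶ V) : TapeGen C [U] [V]

/-- Tapes, as terms typed by words of objects of `C`. -/
abbrev TapeTerm (C : Type u) [Category.{v} C] (P Q : List C) : Type (max u v) :=
  Term (TapeGen C) P Q

namespace TapeTerm

open Term

variable {C : Type u} [Category.{v} C]

/-- The split of a word `P` with parameter `p`. -/
def split (p : OpenUnit) : (P : List C) → TapeTerm C P (P ++ P)
  | [] => idZero
  | U :: P =>
      comp (Q := [U] ++ (([U] ++ P) ++ P))
        (tensor (gen (.split p U)) (split p P) : TapeTerm C ([U] ++ P) ([U, U] ++ (P ++ P)))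
        (castT rfl (by simp) (tensor (id U) (tensor (symmW [U] P) (idW P))))

/-- The discharge of a word. -/
def bang : (P : List C) → TapeTerm C P []
  | [] => idZero
  | U :: P => (tensor (gen (.bang U)) (bang P) : TapeTerm C ([U] ++ P) ([] ++ []))

/-- The unit of the monoid on a word. -/
def cobang : (P : List C) → TapeTerm C [] P
  | [] => idZero
  | U :: P => (tensor (gen (.cobang U)) (cobang P) : TapeTerm C ([] ++ []) ([U] ++ P))

/-- The multiplication of the monoid on a word. -/
def codiag : (P : List C) → TapeTerm C (P ++ P) P
  | [] => idZero
  | U :: P =>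
      comp (Q := [U] ++ (([U] ++ P) ++ P))
        (castT (by simp) rfl (tensor (id U) (tensor (symmW P [U]) (idW P))))
        (tensor (gen (.codiag U)) (codiag P) : TapeTerm C ([U, U] ++ (P ++ P)) ([U] ++ P))

/-- The axioms of tapes besides those of strict symmetric monoidal categories: natural and
coherent commutative monoids, natural and coherent co-pcas, and functoriality of `c ↦ tape c`. -/
inductive TapeAx (C : Type u) [Category.{v} C] :
    ∀ {P Q : List C}, TapeTerm C P Q → TapeTerm C P Q → Prop
  | codiag_assoc (P : List C) : TapeAx C
      (((idW P).tensor (codiag P)).comp (codiag P))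
      (castT (by simp) rfl (((codiag P).tensor (idW P)).comp (codiag P)))
  | codiag_unit (P : List C) : TapeAx C
      (((cobang P).tensor (idW P)).comp (codiag P)) (idW P)
  | codiag_symm (P : List C) : TapeAx C ((symmW P P).comp (codiag P)) (codiag P)
  | cobang_zero : TapeAx C (cobang []) (idW [])
  | codiag_zero : TapeAx C (codiag []) (idW [])
  | cobang_sum (P Q : List C) : TapeAx C (cobang (P ++ Q)) ((cobang P).tensor (cobang Q))
  | codiag_sum (P Q : List C) : TapeAx C
      (codiag (P ++ Q))
      ((castT (by simp) (by simp) ((idW P).tensor ((symmW Q P).tensor (idW Q)))).comp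
        ((codiag P).tensor (codiag Q)))
  | cobang_nat {P Q : List C} (f : TapeTerm C P Q) : TapeAx C ((cobang P).comp f) (cobang Q)
  | codiag_nat {P Q : List C} (f : TapeTerm C P Q) : TapeAx C
      ((codiag P).comp f) ((f.tensor f).comp (codiag Q))
  | split_assoc (p q : OpenUnit) (P : List C) : TapeAx C
      ((split p P).comp ((split q P).tensor (idW P)))
      ((split (p.assocFst q) P).comp
        (castT rfl (by simp) ((idW P).tensor (split (p.assocSnd q) P))))
  | split_idem (p : OpenUnit) (P : List C) : TapeAx C ((split p P).comp (codiag P)) (idW P)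
  | split_symm (p : OpenUnit) (P : List C) : TapeAx C
      ((split p P).comp (symmW P P)) (split p.compl P)
  | split_zero (p : OpenUnit) : TapeAx C (split p []) (idW [])
  | bang_zero : TapeAx C (bang []) (idW [])
  | bang_sum (P Q : List C) : TapeAx C (bang (P ++ Q)) ((bang P).tensor (bang Q))
  | split_sum (p : OpenUnit) (P Q : List C) : TapeAx C
      (split p (P ++ Q))
      (((split p P).tensor (split p Q)).comp
        (castT (by simp) (by simp) ((idW P).tensor ((symmW P Q).tensor (idW Q)))))
  | bang_nat {P Q : List C} (f : TapeTerm C P Q) : TapeAx C (f.comp (bang Q)) (bang P)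
  | split_nat (p : OpenUnit) {P Q : List C} (f : TapeTerm C P Q) : TapeAx C
      (f.comp (split p Q)) ((split p P).comp (f.tensor f))
  | tape_id (U : C) : TapeAx C (gen (.tape (𝟙 U))) (idW [U])
  | tape_comp {U V W : C} (c : U ⟶ V) (d : V ⟶ W) : TapeAx C
      (gen (.tape (c ≫ d))) ((gen (.tape c)).comp (gen (.tape d)))

section map

variable {D : Type u'} [Category.{v'} D] (F : C ⥤ D)

/-- The action of a functor on generators. -/
def mapGen : ∀ {P Q : List C}, TapeGen C P Q → TapeTerm D (P.map F.obj) (Q.map F.obj)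
  | _, _, .split p U => gen (.split p (F.obj U))
  | _, _, .bang U => gen (.bang (F.obj U))
  | _, _, .cobang U => gen (.cobang (F.obj U))
  | _, _, .codiag U => gen (.codiag (F.obj U))
  | _, _, .tape c => gen (.tape (F.map c))

/-- The action of a functor on tapes, by recursion on terms. -/
def map {P Q : List C} (t : TapeTerm C P Q) : TapeTerm D (P.map F.obj) (Q.map F.obj) :=
  ext F.obj (mapGen F) t

theorem map_tensor {P₁ Q₁ P₂ Q₂ : List C} (f : TapeTerm C P₁ Q₁) (g : TapeTerm C P₂ Q₂) :
    Eqv (TapeAx D) (map F (f.tensor g)) ((map F f).tensor (map F g)) := ext_tensor _ _ _ _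

theorem map_castT {P Q P' Q' : List C} (hP : P = P') (hQ : Q = Q') (t : TapeTerm C P Q) :
    Eqv (TapeAx D) (map F (castT hP hQ t)) (map F t) := ext_castT _ _ _ _ _

theorem map_idW (P : List C) : Eqv (TapeAx D) (map F (idW P)) (idW (P.map F.obj)) :=
  ext_idW _ _ _

theorem map_symmW (P Q : List C) :
    Eqv (TapeAx D) (map F (symmW P Q)) (symmW (P.map F.obj) (Q.map F.obj)) :=
  ext_symmW _ _ _ _

theorem map_split (p : OpenUnit) (P : List C) :
    Eqv (TapeAx D) (map F (split p P)) (split p (P.map F.obj)) := by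
  induction P with
  | nil => exact .refl _
  | cons U P ih =>
    refine .comp ((map_tensor F _ _).trans (.tensor (.refl _) ih)) ?_
    refine (map_castT F _ _ _).trans (.trans ?_ (eqv_castT _ _ _).symm)
    exact (map_tensor F _ _).trans (.tensor (.refl _)
      ((map_tensor F _ _).trans (.tensor (map_symmW F _ _) (map_idW F _))))

theorem map_codiag (P : List C) :
    Eqv (TapeAx D) (map F (codiag P)) (codiag (P.map F.obj)) := by
  induction P with
  | nil => exact .refl _
  | cons U P ih =>
    refine .comp ?_ ((map_tensor F _ _).trans (.tensor (.refl _) ih))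
    refine (map_castT F _ _ _).trans (.trans ?_ (eqv_castT _ _ _).symm)
    exact (map_tensor F _ _).trans (.tensor (.refl _)
      ((map_tensor F _ _).trans (.tensor (map_symmW F _ _) (map_idW F _))))

theorem map_bang (P : List C) : Eqv (TapeAx D) (map F (bang P)) (bang (P.map F.obj)) := by
  induction P with
  | nil => exact .refl _
  | cons U P ih => exact (map_tensor F _ _).trans (.tensor (.refl _) ih)

theorem map_cobang (P : List C) :
    Eqv (TapeAx D) (map F (cobang P)) (cobang (P.map F.obj)) := by
  induction P with
  | nil => exact .refl _
  | cons U P ih => exact (map_tensor F _ _).trans (.tensor (.refl _) ih)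

theorem map_ax {P Q : List C} {f g : TapeTerm C P Q} (h : TapeAx C f g) :
    Eqv (TapeAx D) (map F f) (map F g) := by
  have T : ∀ {P₁ Q₁ P₂ Q₂ : List C} (f : TapeTerm C P₁ Q₁) (g : TapeTerm C P₂ Q₂),
    Eqv (TapeAx D) (map F (f.tensor g)) ((map F f).tensor (map F g)) := map_tensor F
  have T' : ∀ {P₁ Q₁ P₂ Q₂ P₁' Q₁' P₂' Q₂'} {f : TapeTerm C P₁ Q₁} {g : TapeTerm C P₂ Q₂}
    {f' : TapeTerm D P₁' Q₁'} {g' : TapeTerm D P₂' Q₂'}, Eqv (TapeAx D) (map F f) f' →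
    Eqv (TapeAx D) (map F g) g' → Eqv (TapeAx D) (map F (f.tensor g)) (f'.tensor g') :=
    fun h₁ h₂ => (T _ _).trans (.tensor h₁ h₂)
  have K : ∀ {P Q P' Q' P'' Q''} {hP : P = P'} {hQ : Q = Q'} {t : TapeTerm C P Q}
    {s : TapeTerm D P'' Q''}, Eqv (TapeAx D) (map F t) s →
    Eqv (TapeAx D) (map F (castT hP hQ t)) s :=
    fun h => (map_castT F _ _ _).trans h
  have K' : ∀ {P Q P' Q' P'' Q''} {hP : P = P'} {hQ : Q = Q'} {t : TapeTerm D P Q}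
    {s : TapeTerm D P'' Q''}, Eqv (TapeAx D) s t →
    Eqv (TapeAx D) s (castT hP hQ t) :=
    fun h => h.trans (eqv_castT _ _ _).symm
  have I := map_idW F
  have Sy := map_symmW F
  have Sp := map_split F
  have Co := map_codiag F
  have Ba := map_bang F
  have Cb := map_cobang F
  have cong : ∀ {P Q : List D} (h : P = Q) (p : OpenUnit),
      Eqv (TapeAx D) (split p P) (split p Q) ∧ Eqv (TapeAx D) (codiag P) (codiag Q) ∧
      Eqv (TapeAx D) (bang P) (bang Q) ∧ Eqv (TapeAx D) (cobang P) (cobang Q) := by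
    rintro P _ rfl p
    exact ⟨.refl _, .refl _, .refl _, .refl _⟩
  induction h with
  | codiag_assoc P =>
    exact (Eqv.comp (T' (I P) (Co P)) (Co P)).trans ((Eqv.ax (.codiag_assoc _)).trans
      ((eqv_castT _ _ _).trans (K (t := ((codiag P).tensor (idW P)).comp (codiag P))
        (Eqv.comp (T' (Co P) (I P)) (Co P))).symm))
  | codiag_unit P =>
    exact (Eqv.comp (T' (Cb P) (I P)) (Co P)).trans
      ((Eqv.ax (.codiag_unit _)).trans (I P).symm)
  | codiag_symm P =>
    exact (Eqv.comp (Sy P P) (Co P)).trans ((Eqv.ax (.codiag_symm _)).trans (Co P).symm)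
  | cobang_zero => exact .refl _
  | codiag_zero => exact .refl _
  | cobang_sum P Q =>
    refine (Cb _).trans ((cong List.map_append ⟨1/2, by norm_num, by norm_num⟩).2.2.2.trans ?_)
    exact (Eqv.ax (.cobang_sum _ _)).trans (T' (Cb P) (Cb Q)).symm
  | codiag_sum P Q =>
    refine (Co _).trans ((cong List.map_append ⟨1/2, by norm_num, by norm_num⟩).2.1.trans ?_)
    refine (Eqv.ax (.codiag_sum _ _)).trans (Eqv.symm ?_)
    exact Eqv.comp (K (K' (T' (I P) (T' (Sy Q P) (I Q))))) (T' (Co P) (Co Q))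
  | cobang_nat f => exact (Eqv.comp (Cb _) (.refl _)).trans ((Eqv.ax (.cobang_nat _)).trans
      (Cb _).symm)
  | codiag_nat f =>
    exact (Eqv.comp (Co _) (.refl _)).trans ((Eqv.ax (.codiag_nat _)).trans
      (Eqv.comp (T _ _) (Co _)).symm)
  | split_assoc p q P =>
    exact (Eqv.comp (Sp p P) (T' (Sp q P) (I P))).trans ((Eqv.ax (.split_assoc p q _)).trans
      (Eqv.comp (Sp _ P) (K (K' (T' (I P) (Sp _ P))))).symm)
  | split_idem p P =>
    exact (Eqv.comp (Sp p P) (Co P)).trans ((Eqv.ax (.split_idem p _)).trans (I P).symm)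
  | split_symm p P =>
    exact (Eqv.comp (Sp p P) (Sy P P)).trans ((Eqv.ax (.split_symm p _)).trans (Sp _ P).symm)
  | split_zero p => exact .refl _
  | bang_zero => exact .refl _
  | bang_sum P Q =>
    refine (Ba _).trans ((cong List.map_append ⟨1/2, by norm_num, by norm_num⟩).2.2.1.trans ?_)
    exact (Eqv.ax (.bang_sum _ _)).trans (T' (Ba P) (Ba Q)).symm
  | split_sum p P Q =>
    refine (Sp p _).trans ((cong List.map_append p).1.trans ?_)
    refine (Eqv.ax (.split_sum p _ _)).trans (Eqv.symm ?_)
    exact Eqv.comp (T' (Sp p P) (Sp p Q)) (K (K' (T' (I P) (T' (Sy P Q) (I Q)))))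
  | bang_nat f => exact (Eqv.comp (.refl _) (Ba _)).trans ((Eqv.ax (.bang_nat _)).trans
      (Ba _).symm)
  | split_nat p f =>
    exact (Eqv.comp (.refl _) (Sp p _)).trans ((Eqv.ax (.split_nat p _)).trans
      (Eqv.comp (Sp p _) (T _ _)).symm)
  | tape_id U =>
    refine Eqv.trans ?_ ((Eqv.ax (.tape_id (F.obj U))).trans (I [U]).symm)
    change Eqv _ (gen (TapeGen.tape (F.map (𝟙 U)))) _
    rw [F.map_id]
    exact .refl _
  | tape_comp c d =>
    refine Eqv.trans ?_ (Eqv.ax (.tape_comp (F.map c) (F.map d)))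
    change Eqv _ (gen (TapeGen.tape (F.map (c ≫ d)))) _
    rw [F.map_comp]
    exact .refl _

end map

end TapeTerm

/-- The objects of the category of tapes over `C`: words of objects of `C`, read as formal sums. -/
def TapeCat (C : Type u) : Type u := List C

namespace TapeCat

section general

variable {C : Type u} [Category.{v} C]

/-- Arrows: tapes modulo the axioms. -/
instance : Category.{max u v} (TapeCat C) where
  Hom P Q := FreeHom (TapeTerm.TapeAx C) P Q
  id P := FreeHom.mk (Term.idW P)
  comp f g := FreeHom.comp f g
  id_comp f := FreeHom.id_comp f
  comp_id f := FreeHom.comp_id f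
  assoc f g h := FreeHom.comp_assoc f g h

/-- Arrows of `TapeCat C` between words. -/
abbrev Arr (P Q : List C) : Type (max u v) := @Quiver.Hom (TapeCat C) _ P Q

/-- The arrow presented by a tape. -/
def ofTerm {P Q : List C} (t : TapeTerm C P Q) : Arr P Q := FreeHom.mk t

/-- The identity, read along an equality of words. -/
def castHom {P Q : List C} (h : P = Q) : Arr P Q := eqToHom (C := TapeCat C) h

/-- The sum of tapes. -/
def sum {P₁ Q₁ P₂ Q₂ : List C} (f : Arr P₁ Q₁) (g : Arr P₂ Q₂) : Arr (P₁ ++ P₂) (Q₁ ++ Q₂) :=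
  FreeHom.tensor f g

/-- The symmetry of the sum. -/
def sumSymm (P Q : List C) : Arr (P ++ Q) (Q ++ P) := ofTerm (Term.symmW P Q)

/-- The arrow `tape c`. -/
def tape {U V : C} (c : U ⟶ V) : Arr [U] [V] := ofTerm (.gen (.tape c))

/-- The action of a functor on arrows of the category of tapes. -/
def map {D : Type u'} [Category.{v'} D] (F : C ⥤ D) {P Q : List C} (t : Arr P Q) :
    Arr (P.map F.obj) (Q.map F.obj) :=
  Quot.map (TapeTerm.map F) (fun _ _ h => Term.ext_eqv _ _ (TapeTerm.map_ax F) h) t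

end general
end TapeCat

/-! ### The product of polynomials, and of tapes over string diagrams -/

namespace RigPoly

variable {T : MonoidalTheory.{u, v}}

/-- `U ⊗ Q` for a monomial `U`. -/
def lmul (U : Diag T) (Q : List (Diag T)) : List (Diag T) := Q.map fun V => Diag.mul U V

/-- `P ⊗ U` for a monomial `U`. -/
def rmul (P : List (Diag T)) (U : Diag T) : List (Diag T) := P.map fun V => Diag.mul V U

/-- The product of polynomials: the sum of all `U_i V_j`, in lexicographic order. -/
def mul : List (Diag T) → List (Diag T) → List (Diag T)
  | [], _ => []
  | U :: P, Q => lmul U Q ++ mul P Q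

theorem lmul_append (U : Diag T) (Q R : List (Diag T)) :
    lmul U (Q ++ R) = lmul U Q ++ lmul U R := List.map_append

theorem zero_mul (P : List (Diag T)) : mul [] P = [] := rfl

theorem mul_zero (P : List (Diag T)) : mul P [] = [] := by
  induction P with
  | nil => rfl
  | cons U P ih => exact ih

theorem mul_single (P : List (Diag T)) (U : Diag T) : mul P [U] = rmul P U := by
  induction P with
  | nil => rfl
  | cons V P ih => exact congrArg (Diag.mul V U :: ·) ih

theorem add_mul (P Q R : List (Diag T)) : mul (P ++ Q) R = mul P R ++ mul Q R := by
  induction P with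
  | nil => rfl
  | cons U P ih => simp [mul, ih]

theorem lmul_mul (U : Diag T) (P Q : List (Diag T)) :
    mul (lmul U P) Q = lmul U (mul P Q) := by
  induction P with
  | nil => rfl
  | cons V P ih =>
    change lmul (Diag.mul U V) Q ++ mul (lmul U P) Q = lmul U (lmul V Q ++ mul P Q)
    rw [ih, lmul_append]
    simp [lmul, Diag.mul_assoc]

theorem mul_assoc (P Q R : List (Diag T)) : mul (mul P Q) R = mul P (mul Q R) := by
  induction P with
  | nil => rfl
  | cons U P ih => rw [mul, add_mul, ih, lmul_mul, mul]

theorem one_mul (P : List (Diag T)) : mul [Diag.one] P = P := by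
  simp [mul, lmul, Diag.one_mul]

theorem mul_one (P : List (Diag T)) : mul P [Diag.one] = P := by
  rw [mul_single]
  simp [rmul, Diag.mul_one]

end RigPoly

open RigPoly

namespace TapeCat

variable {T : MonoidalTheory.{u, v}}

/-- The left distributor `P ⊗ (Q ⊕ R) → (P ⊗ Q) ⊕ (P ⊗ R)`. -/
def dl : (P Q R : List (Diag T)) → Arr (mul P (Q ++ R)) (mul P Q ++ mul P R)
  | [], _, _ => castHom rfl
  | U :: P, Q, R =>
      sum (castHom (lmul_append U Q R)) (dl P Q R) ≫
        castHom (Q := lmul U Q ++ ((lmul U R ++ mul P Q) ++ mul P R)) (by simp) ≫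
        sum (castHom rfl) (sum (sumSymm (lmul U R) (mul P Q)) (castHom rfl)) ≫
        castHom (by simp [mul])

/-- The inverse of the left distributor. -/
def dlInv : (P Q R : List (Diag T)) → Arr (mul P Q ++ mul P R) (mul P (Q ++ R))
  | [], _, _ => castHom rfl
  | U :: P, Q, R =>
      castHom (by simp [mul]) ≫
        sum (castHom (rfl : lmul U Q = _))
          (sum (sumSymm (mul P Q) (lmul U R)) (castHom (rfl : mul P R = _))) ≫
        castHom (Q := (lmul U Q ++ lmul U R) ++ (mul P Q ++ mul P R)) (by simp) ≫
        sum (castHom (lmul_append U Q R).symm) (dlInv P Q R)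

/-- The sum over the monomials `U_i` of `P` of the tapes containing the symmetry of `U_i`
and `V`. -/
def symmMono : (P : List (Diag T)) → (V : Diag T) → Arr (mul P [V]) (lmul V P)
  | [], _ => castHom rfl
  | U :: P, V => sum (tape (Diag.symm U V)) (symmMono P V)

/-- The symmetry of the product. -/
def mulSymm (P : List (Diag T)) : (Q : List (Diag T)) → Arr (mul P Q) (mul Q P)
  | [] => castHom (mul_zero P)
  | V :: Q => (dl P [V] Q : Arr (mul P (V :: Q)) (mul P [V] ++ mul P Q)) ≫
      sum (symmMono P V) (mulSymm P Q)

/-- Left whiskering by a monomial. -/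
def leftMono (U : Diag T) {P Q : List (Diag T)} (t : Arr P Q) : Arr (lmul U P) (lmul U Q) :=
  map (Diag.leftFunctor U) t

/-- Right whiskering by a monomial. -/
def rightMono (U : Diag T) {P Q : List (Diag T)} (t : Arr P Q) : Arr (rmul P U) (rmul Q U) :=
  map (Diag.rightFunctor U) t

/-- Left whiskering by a polynomial. -/
def leftWhisker : (S : List (Diag T)) → {P Q : List (Diag T)} → Arr P Q →
    Arr (mul S P) (mul S Q)
  | [], _, _, _ => castHom rfl
  | W :: S, _, _, t => sum (leftMono W t) (leftWhisker S t)

/-- Right whiskering by a polynomial. -/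
def rightWhisker : (S : List (Diag T)) → {P Q : List (Diag T)} → Arr P Q →
    Arr (mul P S) (mul Q S)
  | [], P, Q, _ => castHom ((mul_zero P).trans (mul_zero Q).symm)
  | W :: S, P, Q, t =>
      (dl P [W] S : Arr (mul P (W :: S)) (mul P [W] ++ mul P S)) ≫
        sum (castHom (mul_single P W) ≫ rightMono W t ≫ castHom (mul_single Q W).symm)
          (rightWhisker S t) ≫
        (dlInv Q [W] S : Arr (mul Q [W] ++ mul Q S) (mul Q (W :: S)))

/-- The product of tapes. -/
def prod {P Q R S : List (Diag T)} (t₁ : Arr P Q) (t₂ : Arr R S) : Arr (mul P R) (mul Q S) :=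
  leftWhisker P t₂ ≫ rightWhisker S t₁

end TapeCat


/-! ### Finitely supported subdistributions -/

/-- A finitely supported probability subdistribution on `X`. -/
@[ext] structure SubDist (X : Type w) where
  /-- the weights -/
  val : X →₀ ℝ
  nonneg : ∀ x, 0 ≤ val x
  sum_le_one : (val.sum fun _ a => a) ≤ 1

namespace SubDist

variable {X : Type w} {Y : Type w'} {Z : Type v'}

/-- The total mass. -/
noncomputable def mass (d : SubDist X) : ℝ := d.val.sum fun _ a => a

theorem mass_nonneg (d : SubDist X) : 0 ≤ d.mass := Finset.sum_nonneg fun x _ => d.nonneg x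

theorem mass_le_one (d : SubDist X) : d.mass ≤ 1 := d.sum_le_one

/-- The null subdistribution. -/
noncomputable instance : Zero (SubDist X) :=
  ⟨⟨0, fun _ => le_rfl, by simp⟩⟩

/-- The Dirac distribution. -/
noncomputable def dirac (x : X) : SubDist X where
  val := Finsupp.single x 1
  nonneg y := by
    classical
    rw [Finsupp.single_apply]
    split_ifs <;> norm_num
  sum_le_one := by simp

/-- Multiplication by a scalar `p ∈ [0, 1]`. -/
noncomputable def smul (p : unitInterval) (d : SubDist X) : SubDist X where
  val := p.1 • d.val
  nonneg x := mul_nonneg p.2.1 (d.nonneg x)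
  sum_le_one := by
    rw [Finsupp.sum_smul_index (by simp), ← Finsupp.mul_sum]
    exact mul_le_one₀ p.2.2 d.mass_nonneg d.mass_le_one

theorem mass_smul (p : unitInterval) (d : SubDist X) : (smul p d).mass = p * d.mass := by
  rw [mass, smul, Finsupp.sum_smul_index (by simp), ← Finsupp.mul_sum, mass]

/-- A subdistribution transported along an equality of types. -/
def cast {X Y : Type w} (h : X = Y) (d : SubDist X) : SubDist Y := h ▸ d

theorem mass_cast {X Y : Type w} (h : X = Y) (d : SubDist X) : (cast h d).mass = d.mass := by
  subst h
  rfl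

theorem cast_smul {X Y : Type w} (h : X = Y) (p : unitInterval) (d : SubDist X) :
    cast h (smul p d) = smul p (cast h d) := by
  subst h
  rfl

theorem sum_finsuppSum {A : Type*} {B : Type*} (f : A →₀ ℝ) (g : A → ℝ → B →₀ ℝ) :
    (f.sum g).sum (fun _ a => a) = f.sum fun x a => (g x a).sum fun _ b => b := by
  exact map_finsuppSum (Finsupp.liftAddHom fun _ : B => AddMonoidHom.id ℝ) f g

theorem sum_finsetSum {A : Type*} {B : Type*} [Fintype A] (g : A → B →₀ ℝ) :
    (∑ a, g a).sum (fun _ a => a) = ∑ a, (g a).sum fun _ b => b := by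
  exact map_sum (Finsupp.liftAddHom fun _ : B => AddMonoidHom.id ℝ) g Finset.univ

/-- The subdistribution with value `∑ d(x) · e(y)` at `z`, where the sum is over all `(x, y)` with
`m x y = z`. -/
noncomputable def map₂ (m : X → Y → Z) (d : SubDist X) (e : SubDist Y) : SubDist Z where
  val := d.val.sum fun x a => e.val.sum fun y b => Finsupp.single (m x y) (a * b)
  nonneg z := by
    classical
    rw [Finsupp.sum_apply]
    refine Finset.sum_nonneg fun x _ => ?_
    simp only [Finsupp.sum_apply]
    refine Finset.sum_nonneg fun y _ => ?_
    change 0 ≤ Finsupp.single (m x y) (d.val x * e.val y) z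
    rw [Finsupp.single_apply]
    split_ifs
    · exact mul_nonneg (d.nonneg x) (e.nonneg y)
    · exact le_rfl
  sum_le_one := by
    simp only [sum_finsuppSum, Finsupp.sum_single_index, ← Finsupp.mul_sum]
    rw [← Finsupp.sum_mul]
    exact mul_le_one₀ d.mass_le_one e.mass_nonneg e.mass_le_one

theorem mass_map₂ (m : X → Y → Z) (d : SubDist X) (e : SubDist Y) :
    (map₂ m d e).mass = d.mass * e.mass := by
  simp only [mass, map₂, sum_finsuppSum, Finsupp.sum_single_index, ← Finsupp.mul_sum]
  rw [← Finsupp.sum_mul]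

theorem exists_smul {n : ℕ} {X : Fin n → Type w} (e : ∀ j, SubDist (X j))
    (h : ∑ j, (e j).mass ≤ 1) :
    ∃ (p : Fin n → unitInterval) (d : ∀ j, SubDist (X j)),
      ∑ j, (p j : ℝ) ≤ 1 ∧ ∀ j, e j = (d j).smul (p j) := by
  refine ⟨fun j => ⟨(e j).mass, (e j).mass_nonneg, (e j).mass_le_one⟩,
    fun j => ⟨(e j).mass⁻¹ • (e j).val,
      fun x => mul_nonneg (inv_nonneg.2 (e j).mass_nonneg) ((e j).nonneg x), ?_⟩, h, ?_⟩
  · rw [Finsupp.sum_smul_index (by simp), ← Finsupp.mul_sum]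
    exact inv_mul_le_one
  · intro j
    refine SubDist.ext ?_
    change (e j).val = (e j).mass • ((e j).mass⁻¹ • (e j).val)
    by_cases h0 : (e j).mass = 0
    · rw [h0, zero_smul]
      refine Finsupp.ext fun x => ?_
      by_contra hx
      have hx' : x ∈ (e j).val.support := Finsupp.mem_support_iff.2 hx
      exact hx ((Finset.sum_eq_zero_iff_of_nonneg fun x _ => (e j).nonneg x).1 h0 x hx')
    · rw [smul_smul, mul_inv_cancel₀ h0, one_smul]

theorem sum_mass_le {n : ℕ} {X : Fin n → Type w} {e : ∀ j, SubDist (X j)}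
    (h : ∃ (p : Fin n → unitInterval) (d : ∀ j, SubDist (X j)),
      ∑ j, (p j : ℝ) ≤ 1 ∧ ∀ j, e j = (d j).smul (p j)) : ∑ j, (e j).mass ≤ 1 := by
  obtain ⟨p, d, hp, he⟩ := h
  refine le_trans (Finset.sum_le_sum fun j _ => ?_) hp
  rw [he, mass_smul]
  exact mul_le_of_le_one_right (p j).2.1 (d j).mass_le_one

end SubDist

/-! ### Stochastic matrices over the free enrichment of a category -/

/-- The objects of the category of stochastic matrices: words of objects of `C`. -/
def StMat (C : Type u) : Type u := List C

namespace StMat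

section positions

variable {C : Type u}

/-- A position in `P ++ Q`, as a position in `P` or in `Q` with the same letter. -/
def splitAdd (P Q : List C) (i : Fin (P ++ Q).length) :
    {k : Fin P.length // P.get k = (P ++ Q).get i} ⊕
      {k : Fin Q.length // Q.get k = (P ++ Q).get i} :=
  if h : i < P.length then .inl ⟨⟨i, h⟩, by simp [List.getElem_append_left h]⟩
  else .inr ⟨⟨i - P.length, by have := i.2; simp at this; omega⟩, by
    simp [List.getElem_append_right (not_lt.1 h)]⟩

theorem sum_splitAdd (P Q : List C) (a : Fin P.length → ℝ) (b : Fin Q.length → ℝ) :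
    ∑ j, Sum.elim (fun k => a k.1) (fun k => b k.1) (splitAdd P Q j) = ∑ k, a k + ∑ k, b k := by
  rw [← Equiv.sum_comp (finSumFinEquiv.trans
    (finCongr (List.length_append (as := P) (bs := Q)).symm)), Fintype.sum_sum_type]
  congr 1
  · refine Finset.sum_congr rfl fun k _ => ?_
    have h : ((finSumFinEquiv.trans (finCongr (List.length_append (as := P) (bs := Q)).symm))
        (.inl k) : ℕ) < P.length := by simp
    rw [splitAdd, dif_pos h]
    simp
  · refine Finset.sum_congr rfl fun k _ => ?_
    have h : ¬ ((finSumFinEquiv.trans (finCongr (List.length_append (as := P) (bs := Q)).symm))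
        (.inr k) : ℕ) < P.length := by simp
    rw [splitAdd, dif_neg h]
    simp

end positions

section general

variable {C : Type u} [Category.{v} C]

/-- Stochastic matrices from `U_1 ⋯ U_n` to `V_1 ⋯ V_m` over the free enrichment `C⁺` of `C`, whose
homsets are the sets of subdistributions on the homsets of `C`. Such an arrow is an equivalence
class of matrices of pairs `(p_ji, d_ji)` with `d_ji : U_i → V_j` in `C⁺` and `∑_j p_ji ≤ 1`, where
two such matrices are equivalent if they have the same products `p_ji · d_ji`; a class is therefore
recorded by the matrix of these products. `entry i j` is the entry in row `j` and column `i`. -/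
@[ext] structure Hom (P Q : List C) where
  /-- the products `p_ji · d_ji` -/
  entry : ∀ (i : Fin P.length) (j : Fin Q.length), SubDist (P.get i ⟶ Q.get j)
  exists_rep : ∀ i, ∃ (p : Fin Q.length → unitInterval)
    (d : ∀ j : Fin Q.length, SubDist (P.get i ⟶ Q.get j)),
    ∑ j, (p j : ℝ) ≤ 1 ∧ ∀ j, entry i j = (d j).smul (p j)

/-- A matrix of subdistributions whose column masses are at most one. -/
def ofMass {P Q : List C}
    (e : ∀ (i : Fin P.length) (j : Fin Q.length), SubDist (P.get i ⟶ Q.get j))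
    (h : ∀ i, ∑ j, (e i j).mass ≤ 1) : Hom P Q :=
  ⟨e, fun i => SubDist.exists_smul _ (h i)⟩

theorem Hom.sum_mass_le {P Q : List C} (M : Hom P Q) (i : Fin P.length) :
    ∑ j, (M.entry i j).mass ≤ 1 := SubDist.sum_mass_le (M.exists_rep i)

/-- The matrix whose only nonzero entries are the Dirac distributions `f i` at the places
`(i, φ i)`. -/
noncomputable def monomial {P Q : List C} (φ : Fin P.length → Fin Q.length)
    (f : ∀ i, P.get i ⟶ Q.get (φ i)) : Hom P Q :=
  ofMass (fun i j => if h : φ i = j then SubDist.dirac (f i ≫ eqToHom (by rw [h])) else 0) (by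
    intro i
    rw [Finset.sum_eq_single (φ i)]
    · rw [dif_pos rfl]
      exact SubDist.mass_le_one _
    · intro j _ hj
      rw [dif_neg (Ne.symm hj)]
      exact Finsupp.sum_zero_index
    · simp)

theorem monomial_entry {P Q : List C} (φ : Fin P.length → Fin Q.length)
    (f : ∀ i, P.get i ⟶ Q.get (φ i)) (i : Fin P.length) :
    (monomial φ f).entry i (φ i) = SubDist.dirac (f i) := by
  have h : (monomial φ f).entry i (φ i) = SubDist.dirac (f i ≫ eqToHom rfl) := dif_pos rfl
  rw [h, eqToHom_refl, Category.comp_id]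

theorem monomial_entry_of_ne {P Q : List C} (φ : Fin P.length → Fin Q.length)
    (f : ∀ i, P.get i ⟶ Q.get (φ i)) {i : Fin P.length} {j : Fin Q.length} (h : φ i ≠ j) :
    (monomial φ f).entry i j = 0 := dif_neg h

/-- The identity matrix. -/
noncomputable def idMat (P : List C) : Hom P P := monomial (fun i => i) fun i => 𝟙 (P.get i)

theorem comp_mass {P Q R : List C} (M : Hom P Q) (N : Hom Q R) (i : Fin P.length) :
    ∑ k, ∑ j, (M.entry i j).mass * (N.entry j k).mass ≤ 1 := by
  rw [Finset.sum_comm]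
  refine le_trans (Finset.sum_le_sum fun j _ => ?_) (M.sum_mass_le i)
  rw [← Finset.mul_sum]
  exact mul_le_of_le_one_right (SubDist.mass_nonneg _) (N.sum_mass_le j)

/-- The product of matrices: the entry at `(i, k)` is the sum over `j` of the composites of the
entries at `(i, j)` and `(j, k)`, which are composed in `C⁺` by
`(d ; e)(h) = ∑_{f ; g = h} d(f) e(g)`. -/
noncomputable def comp {P Q R : List C} (M : Hom P Q) (N : Hom Q R) : Hom P R :=
  have hm : ∀ i k, ((∑ j, (SubDist.map₂ (fun f g => f ≫ g) (M.entry i j) (N.entry j k)).val).sum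
      fun _ a => a) = ∑ j, (M.entry i j).mass * (N.entry j k).mass := fun i k => by
    rw [SubDist.sum_finsetSum]
    exact Finset.sum_congr rfl fun j _ => SubDist.mass_map₂ _ _ _
  ofMass (fun i k =>
    { val := ∑ j, (SubDist.map₂ (fun f g => f ≫ g) (M.entry i j) (N.entry j k)).val
      nonneg := fun x => by
        rw [Finsupp.finsetSum_apply]
        exact Finset.sum_nonneg fun j _ => SubDist.nonneg _ x
      sum_le_one := by
        rw [hm]
        exact le_trans (Finset.single_le_sum (f := fun k => ∑ j, (M.entry i j).mass *
          (N.entry j k).mass) (fun k _ => Finset.sum_nonneg fun j _ =>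
            mul_nonneg (SubDist.mass_nonneg _) (SubDist.mass_nonneg _)) (Finset.mem_univ k))
          (comp_mass M N i) })
    (fun i => by
      refine le_trans (le_of_eq (Finset.sum_congr rfl fun k _ => ?_)) (comp_mass M N i)
      exact hm i k)

/-- An entry, as an arrow of the free `ℝ`-linear category on `C`. -/
def Hom.lin {P Q : List C} (M : Hom P Q) (i : Fin P.length) (j : Fin Q.length) :
    Free.of ℝ (P.get i) ⟶ Free.of ℝ (Q.get j) := (M.entry i j).val

theorem hom_ext {P Q : List C} {M N : Hom P Q} (h : ∀ i j, M.lin i j = N.lin i j) : M = N := by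
  refine Hom.ext (funext fun i => funext fun j => SubDist.ext (h i j))

theorem lin_comp {P Q R : List C} (M : Hom P Q) (N : Hom Q R) (i : Fin P.length)
    (k : Fin R.length) : (comp M N).lin i k = ∑ j, M.lin i j ≫ N.lin j k := rfl

theorem lin_idMat_self (P : List C) (i : Fin P.length) :
    (idMat P).lin i i = 𝟙 (Free.of ℝ (P.get i)) :=
  congrArg SubDist.val (monomial_entry (fun i => i) (fun i => 𝟙 (P.get i)) i)

theorem lin_idMat_of_ne (P : List C) {i j : Fin P.length} (h : i ≠ j) :
    (idMat P).lin i j = 0 :=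
  congrArg SubDist.val (monomial_entry_of_ne (fun i => i) (fun i => 𝟙 (P.get i)) h)

theorem id_comp {P Q : List C} (M : Hom P Q) : comp (idMat P) M = M := hom_ext fun i j => by
  rw [lin_comp, Finset.sum_eq_single i, lin_idMat_self, Category.id_comp]
  · intro k _ hk
    rw [lin_idMat_of_ne P hk.symm, Limits.zero_comp]
  · simp

theorem comp_id {P Q : List C} (M : Hom P Q) : comp M (idMat Q) = M := hom_ext fun i j => by
  rw [lin_comp, Finset.sum_eq_single j, lin_idMat_self, Category.comp_id]
  · intro k _ hk
    rw [lin_idMat_of_ne Q hk, Limits.comp_zero]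
  · simp

theorem assoc {P Q R S : List C} (M : Hom P Q) (N : Hom Q R) (L : Hom R S) :
    comp (comp M N) L = comp M (comp N L) := hom_ext fun i j => by
  simp only [lin_comp, Preadditive.sum_comp, Preadditive.comp_sum, Category.assoc]
  exact Finset.sum_comm

/-- The category of stochastic matrices over `C⁺`. -/
noncomputable instance : Category.{v} (StMat C) where
  Hom P Q := Hom (C := C) P Q
  id P := idMat P
  comp M N := comp M N
  id_comp M := id_comp M
  comp_id M := comp_id M
  assoc M N L := assoc M N L

/-- Arrows of `StMat C` between words. -/
abbrev Arr (P Q : List C) : Type v := @Quiver.Hom (StMat C) _ P Q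

/-- The entries of the block diagonal matrix with blocks `M` and `N`. -/
noncomputable def sumEntry {P₁ Q₁ P₂ Q₂ : List C} (M : Arr P₁ Q₁) (N : Arr P₂ Q₂)
    (i : Fin (P₁ ++ P₂).length) (j : Fin (Q₁ ++ Q₂).length) :
    SubDist ((P₁ ++ P₂).get i ⟶ (Q₁ ++ Q₂).get j) :=
  match splitAdd P₁ P₂ i, splitAdd Q₁ Q₂ j with
  | .inl ⟨k, hk⟩, .inl ⟨l, hl⟩ => SubDist.cast (by rw [hk, hl]) (Hom.entry M k l)
  | .inr ⟨k, hk⟩, .inr ⟨l, hl⟩ => SubDist.cast (by rw [hk, hl]) (Hom.entry N k l)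
  | _, _ => 0

theorem mass_zero {X : Type w} : (0 : SubDist X).mass = 0 := Finsupp.sum_zero_index

/-- The sum of matrices: the block diagonal matrix. -/
noncomputable def sum {P₁ Q₁ P₂ Q₂ : List C} (M : Arr P₁ Q₁) (N : Arr P₂ Q₂) :
    Arr (P₁ ++ P₂) (Q₁ ++ Q₂) :=
  ofMass (sumEntry M N) fun i => by
    rcases hi : splitAdd P₁ P₂ i with ⟨k, hk⟩ | ⟨k, hk⟩
    · refine le_trans (le_of_eq (Finset.sum_congr rfl fun j _ => ?_)) (le_trans (le_of_eq
        (sum_splitAdd Q₁ Q₂ (fun l => (Hom.entry M k l).mass) fun _ => 0)) ?_)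
      · unfold sumEntry
        rw [hi]
        rcases splitAdd Q₁ Q₂ j with ⟨l, hl⟩ | ⟨l, hl⟩
        · exact SubDist.mass_cast _ _
        · exact mass_zero
      · simpa using Hom.sum_mass_le M k
    · refine le_trans (le_of_eq (Finset.sum_congr rfl fun j _ => ?_)) (le_trans (le_of_eq
        (sum_splitAdd Q₁ Q₂ (fun _ => 0) fun l => (Hom.entry N k l).mass)) ?_)
      · unfold sumEntry
        rw [hi]
        rcases splitAdd Q₁ Q₂ j with ⟨l, hl⟩ | ⟨l, hl⟩
        · exact mass_zero
        · exact SubDist.mass_cast _ _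
      · simpa using Hom.sum_mass_le N k

/-- The matrix of a map of positions that preserves letters: the identities at the places
`(i, φ i)`, and zero elsewhere. -/
noncomputable def permMat {P Q : List C}
    (φ : ∀ i : Fin P.length, {j : Fin Q.length // Q.get j = P.get i}) : Arr P Q :=
  monomial (fun i => (φ i).1) fun i => eqToHom (φ i).2.symm

/-- A position of `P`, as a position of `P ++ Q`. -/
def inlIdx (P Q : List C) (k : Fin P.length) :
    {i : Fin (P ++ Q).length // (P ++ Q).get i = P.get k} :=
  ⟨⟨k, by have := k.2; simp; omega⟩, by simp⟩

/-- A position of `Q`, as a position of `P ++ Q`. -/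
def inrIdx (P Q : List C) (k : Fin Q.length) :
    {i : Fin (P ++ Q).length // (P ++ Q).get i = Q.get k} :=
  ⟨⟨P.length + k, by have := k.2; simp⟩, by simp⟩

/-- The symmetry of the sum: the matrix with blocks `0, id, id, 0`. -/
noncomputable def sumSymm (P Q : List C) : Arr (P ++ Q) (Q ++ P) :=
  permMat fun i => match splitAdd P Q i with
    | .inl ⟨k, hk⟩ => ⟨(inrIdx Q P k).1, (inrIdx Q P k).2.trans hk⟩
    | .inr ⟨k, hk⟩ => ⟨(inlIdx Q P k).1, (inlIdx Q P k).2.trans hk⟩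

/-- The `1 × 1` matrix `(1 · c)`. -/
noncomputable def tape {U V : C} (c : U ⟶ V) : Arr [U] [V] :=
  monomial (fun _ => ⟨0, Nat.one_pos⟩) fun i =>
    eqToHom (show [U].get i = U by simp) ≫ c

/-- The `1 × 2` matrix `(1 · id_U  1 · id_U)`. -/
noncomputable def codiag (U : C) : Arr [U, U] [U] :=
  permMat fun i => ⟨⟨0, Nat.one_pos⟩, by fin_cases i <;> rfl⟩

/-- The `1 × 0` matrix. -/
noncomputable def cobang (U : C) : Arr [] [U] := permMat fun i => i.elim0

/-- The `0 × 1` matrix. -/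
def bang (U : C) : Arr [U] [] := ofMass (fun _ j => j.elim0) fun _ => zero_le_one

/-- The `2 × 1` matrix with entries `p · id_U` and `(1 - p) · id_U`. -/
noncomputable def split (p : unitInterval) (U : C) : Arr [U] [U, U] where
  entry i j := SubDist.smul (if j = ⟨0, Nat.two_pos⟩ then p else unitInterval.symm p)
    (SubDist.dirac (eqToHom (show [U].get i = [U, U].get j by
      rw [show i = ⟨0, Nat.one_pos⟩ from Subsingleton.elim (α := Fin 1) _ _]
      fin_cases j <;> rfl)))
  exists_rep i := ⟨_, _, by
    change ∑ j : Fin 2, ((if j = 0 then p else unitInterval.symm p : unitInterval) : ℝ) ≤ 1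
    simp, fun j => rfl⟩

end general

section product

variable {T : MonoidalTheory.{u, v}}

theorem length_lmul (U : Diag T) (Q : List (Diag T)) : (lmul U Q).length = Q.length :=
  List.length_map _

theorem length_mul (P Q : List (Diag T)) : (mul P Q).length = P.length * Q.length := by
  induction P with
  | nil => simp [mul]
  | cons U P ih => rw [mul, List.length_append, length_lmul, ih, List.length_cons, Nat.succ_mul, Nat.add_comm]

theorem get_mul (P Q : List (Diag T)) (k : Fin P.length) (l : Fin Q.length)
    (h : l + Q.length * k < (mul P Q).length) :
    (mul P Q).get ⟨l + Q.length * k, h⟩ = Diag.mul (P.get k) (Q.get l) := by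
  induction P with
  | nil => exact k.elim0
  | cons U P ih =>
    obtain ⟨k, hk⟩ := k
    cases k with
    | zero => simp [mul, lmul]
    | succ k =>
      have e : (l : ℕ) + Q.length * (k + 1) = (l + Q.length * k) + (lmul U Q).length := by
        rw [length_lmul, Nat.mul_succ, Nat.add_assoc]
      have h' : (l : ℕ) + Q.length * k < (mul P Q).length := by
        simp only [mul, List.length_append] at h
        omega
      have := ih ⟨k, Nat.lt_of_succ_lt_succ hk⟩ h'
      simp only [List.get_eq_getElem] at this ⊢
      simp only [mul, e]
      rw [List.getElem_append_right (Nat.le_add_left _ _)]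
      simpa using this

/-- The position of the monomial `U_k V_l` in `P ⊗ Q`. -/
def pairIdx (P Q : List (Diag T)) (k : Fin P.length) (l : Fin Q.length) :
    {i : Fin (mul P Q).length // (mul P Q).get i = Diag.mul (P.get k) (Q.get l)} :=
  ⟨⟨l + Q.length * k, by
    rw [length_mul]
    exact (finProdFinEquiv (k, l)).2⟩, get_mul _ _ _ _ _⟩

/-- A position of `P ⊗ Q`, as a pair of positions. -/
def splitMul (P Q : List (Diag T)) (i : Fin (mul P Q).length) :
    {k : Fin P.length × Fin Q.length //
      Diag.mul (P.get k.1) (Q.get k.2) = (mul P Q).get i} :=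
  ⟨finProdFinEquiv.symm (Fin.cast (length_mul P Q) i), by
    have h := congrArg Fin.val
      (finProdFinEquiv.apply_symm_apply (Fin.cast (length_mul P Q) i))
    rw [← (pairIdx P Q _ _).2]
    exact congrArg (mul P Q).get (Fin.ext h)⟩

theorem sum_splitMul (P Q : List (Diag T)) (a : Fin P.length → Fin Q.length → ℝ) :
    ∑ j, a (splitMul P Q j).1.1 (splitMul P Q j).1.2 = ∑ k, ∑ l, a k l := by
  rw [← Fintype.sum_prod_type', ← Equiv.sum_comp
    ((finCongr (length_mul P Q)).trans finProdFinEquiv.symm)]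
  rfl

/-- The product of subdistributions of string diagrams: its value at `c` is the sum of
`d₁(c₁) d₂(c₂)` over all `(c₁, c₂)` with `c₁ ⊗ c₂ = c`. -/
noncomputable def tensorPlus {U₁ V₁ U₂ V₂ : Diag T} (d₁ : SubDist (U₁ ⟶ V₁))
    (d₂ : SubDist (U₂ ⟶ V₂)) : SubDist (Diag.mul U₁ U₂ ⟶ Diag.mul V₁ V₂) :=
  SubDist.map₂ Diag.tensor d₁ d₂

theorem smul_tensorPlus_smul {U₁ V₁ U₂ V₂ : Diag T} (p q : unitInterval) (d : SubDist (U₁ ⟶ V₁))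
    (e : SubDist (U₂ ⟶ V₂)) :
    tensorPlus (d.smul p) (e.smul q) = (tensorPlus d e).smul (p * q) := by
  refine SubDist.ext ?_
  simp only [tensorPlus, SubDist.map₂, SubDist.smul]
  rw [Finsupp.sum_smul_index (by simp), Finsupp.smul_sum]
  refine Finsupp.sum_congr fun x _ => ?_
  rw [Finsupp.sum_smul_index (by simp), Finsupp.smul_sum]
  refine Finsupp.sum_congr fun y _ => ?_
  rw [Finsupp.smul_single]
  congr 1
  simp only [smul_eq_mul, Set.Icc.coe_mul]
  ring

/-- The Kronecker product of matrices, with `tensorPlus` as multiplication of entries. For entries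
`p · d` and `q · e` the resulting entry is `(p q) · (d ⊗ e)`. -/
noncomputable def prod {P Q R S : List (Diag T)} (M : Arr P Q) (N : Arr R S) :
    Arr (mul P R) (mul Q S) :=
  ofMass (fun i j => SubDist.cast (by rw [(splitMul P R i).2, (splitMul Q S j).2])
      (tensorPlus (Hom.entry M (splitMul P R i).1.1 (splitMul Q S j).1.1)
        (Hom.entry N (splitMul P R i).1.2 (splitMul Q S j).1.2))) fun i => by
    simp only [SubDist.mass_cast, tensorPlus, SubDist.mass_map₂]
    rw [sum_splitMul Q S fun k l => (Hom.entry M (splitMul P R i).1.1 k).mass *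
      (Hom.entry N (splitMul P R i).1.2 l).mass, ← Finset.sum_mul_sum]
    exact mul_le_one₀ (Hom.sum_mass_le M _)
      (Finset.sum_nonneg fun l _ => SubDist.mass_nonneg _) (Hom.sum_mass_le N _)

/-- The symmetry of the product: the symmetries of string diagrams `U_i V_j → V_j U_i`, placed at
`((i, j), (j, i))`. -/
noncomputable def mulSymm (P Q : List (Diag T)) : Arr (mul P Q) (mul Q P) :=
  monomial (fun i => (pairIdx Q P (splitMul P Q i).1.2 (splitMul P Q i).1.1).1) fun i =>
    eqToHom (splitMul P Q i).2.symm ≫ Diag.symm _ _ ≫ eqToHom (pairIdx Q P _ _).2.symm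

/-- The left distributor `P ⊗ (Q ⊕ R) → (P ⊗ Q) ⊕ (P ⊗ R)`: the permutation matrix which
identifies equal monomials. -/
noncomputable def dl (P Q R : List (Diag T)) : Arr (mul P (Q ++ R)) (mul P Q ++ mul P R) :=
  permMat fun i => match splitAdd Q R (splitMul P (Q ++ R) i).1.2 with
    | .inl ⟨l, hl⟩ =>
        ⟨(inlIdx (mul P Q) (mul P R) (pairIdx P Q (splitMul P (Q ++ R) i).1.1 l).1).1, by
          rw [(inlIdx _ _ _).2, (pairIdx _ _ _ _).2, hl, (splitMul _ _ _).2]⟩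
    | .inr ⟨l, hl⟩ =>
        ⟨(inrIdx (mul P Q) (mul P R) (pairIdx P R (splitMul P (Q ++ R) i).1.1 l).1).1, by
          rw [(inrIdx _ _ _).2, (pairIdx _ _ _ _).2, hl, (splitMul _ _ _).2]⟩

end product

end StMat

/-! ### Rig categories -/

/-- The data of a symmetric monoidal structure on a category. -/
structure SymMonData (C : Type u) [Category.{v} C] where
  /-- the product of objects -/
  obj : C → C → C
  /-- the product of arrows -/
  hom : ∀ {X X' Y Y' : C}, (X ⟶ X') → (Y ⟶ Y') → (obj X Y ⟶ obj X' Y')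
  /-- the unit -/
  unit : C
  /-- the associator -/
  assoc : ∀ X Y Z : C, obj (obj X Y) Z ≅ obj X (obj Y Z)
  /-- the left unitor -/
  lunit : ∀ X : C, obj unit X ≅ X
  /-- the right unitor -/
  runit : ∀ X : C, obj X unit ≅ X
  /-- the symmetry -/
  symm : ∀ X Y : C, obj X Y ⟶ obj Y X

/-- The laws of symmetric monoidal categories. -/
structure SymMonData.IsSymmetricMonoidal {C : Type u} [Category.{v} C] (M : SymMonData C) :
    Prop where
  hom_id : ∀ X Y, M.hom (𝟙 X) (𝟙 Y) = 𝟙 (M.obj X Y)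
  hom_comp : ∀ {X Y Z X' Y' Z' : C} (f : X ⟶ Y) (g : Y ⟶ Z) (f' : X' ⟶ Y') (g' : Y' ⟶ Z'),
    M.hom (f ≫ g) (f' ≫ g') = M.hom f f' ≫ M.hom g g'
  assoc_nat : ∀ {X Y Z X' Y' Z' : C} (f : X ⟶ X') (g : Y ⟶ Y') (h : Z ⟶ Z'),
    M.hom (M.hom f g) h ≫ (M.assoc X' Y' Z').hom = (M.assoc X Y Z).hom ≫ M.hom f (M.hom g h)
  lunit_nat : ∀ {X Y : C} (f : X ⟶ Y),
    M.hom (𝟙 M.unit) f ≫ (M.lunit Y).hom = (M.lunit X).hom ≫ f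
  runit_nat : ∀ {X Y : C} (f : X ⟶ Y),
    M.hom f (𝟙 M.unit) ≫ (M.runit Y).hom = (M.runit X).hom ≫ f
  symm_nat : ∀ {X Y X' Y' : C} (f : X ⟶ X') (g : Y ⟶ Y'),
    M.hom f g ≫ M.symm X' Y' = M.symm X Y ≫ M.hom g f
  pentagon : ∀ W X Y Z,
    M.hom (M.assoc W X Y).hom (𝟙 Z) ≫ (M.assoc W (M.obj X Y) Z).hom ≫
      M.hom (𝟙 W) (M.assoc X Y Z).hom =
    (M.assoc (M.obj W X) Y Z).hom ≫ (M.assoc W X (M.obj Y Z)).hom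
  triangle : ∀ X Y,
    (M.assoc X M.unit Y).hom ≫ M.hom (𝟙 X) (M.lunit Y).hom = M.hom (M.runit X).hom (𝟙 Y)
  symm_symm : ∀ X Y, M.symm X Y ≫ M.symm Y X = 𝟙 (M.obj X Y)
  hexagon : ∀ X Y Z,
    (M.assoc X Y Z).hom ≫ M.symm X (M.obj Y Z) ≫ (M.assoc Y Z X).hom =
    M.hom (M.symm X Y) (𝟙 Z) ≫ (M.assoc Y X Z).hom ≫ M.hom (𝟙 Y) (M.symm X Z)

/-- The symmetric monoidal structure is strict: the structural isomorphisms other than the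
symmetry are identities. -/
structure SymMonData.IsStrict {C : Type u} [Category.{v} C] (M : SymMonData C) : Prop where
  assoc : ∀ X Y Z, ∃ h : M.obj (M.obj X Y) Z = M.obj X (M.obj Y Z), M.assoc X Y Z = eqToIso h
  lunit : ∀ X, ∃ h : M.obj M.unit X = X, M.lunit X = eqToIso h
  runit : ∀ X, ∃ h : M.obj X M.unit = X, M.runit X = eqToIso h

/-- The data of a rig category. -/
structure RigData (C : Type u) [Category.{v} C] where
  /-- the structure `(⊕, 0)` -/
  add : SymMonData C
  /-- the structure `(⊗, 1)` -/
  mul : SymMonData C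
  /-- the left distributor -/
  dl : ∀ X Y Z : C, mul.obj X (add.obj Y Z) ⟶ add.obj (mul.obj X Y) (mul.obj X Z)
  /-- the right distributor -/
  dr : ∀ X Y Z : C, mul.obj (add.obj X Y) Z ⟶ add.obj (mul.obj X Z) (mul.obj Y Z)
  /-- the left annihilator -/
  lz : ∀ X : C, mul.obj add.unit X ⟶ add.unit
  /-- the right annihilator -/
  rz : ∀ X : C, mul.obj X add.unit ⟶ add.unit

namespace RigData

variable {C : Type u} [Category.{v} C]

/-- The interchange `(W ⊕ X) ⊕ (Y ⊕ Z) → (W ⊕ Y) ⊕ (X ⊕ Z)` of the middle summands. -/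
def mid (R : RigData C) (W X Y Z : C) :
    R.add.obj (R.add.obj W X) (R.add.obj Y Z) ⟶ R.add.obj (R.add.obj W Y) (R.add.obj X Z) :=
  (R.add.assoc W X (R.add.obj Y Z)).hom ≫
    R.add.hom (𝟙 W) ((R.add.assoc X Y Z).inv ≫ R.add.hom (R.add.symm X Y) (𝟙 Z) ≫
      (R.add.assoc Y X Z).hom) ≫
    (R.add.assoc W Y (R.add.obj X Z)).inv

/-- The laws of rig categories: two symmetric monoidal structures, natural isomorphisms for the
distributive and annihilation laws, and Laplaza's coherence axioms. -/
structure IsRig (R : RigData C) : Prop where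
  add_symmetricMonoidal : R.add.IsSymmetricMonoidal
  mul_symmetricMonoidal : R.mul.IsSymmetricMonoidal
  dl_iso : ∀ X Y Z, IsIso (R.dl X Y Z)
  dr_iso : ∀ X Y Z, IsIso (R.dr X Y Z)
  lz_iso : ∀ X, IsIso (R.lz X)
  rz_iso : ∀ X, IsIso (R.rz X)
  dl_nat : ∀ {X Y Z X' Y' Z' : C} (f : X ⟶ X') (g : Y ⟶ Y') (h : Z ⟶ Z'),
    R.mul.hom f (R.add.hom g h) ≫ R.dl X' Y' Z' =
      R.dl X Y Z ≫ R.add.hom (R.mul.hom f g) (R.mul.hom f h)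
  dr_nat : ∀ {X Y Z X' Y' Z' : C} (f : X ⟶ X') (g : Y ⟶ Y') (h : Z ⟶ Z'),
    R.mul.hom (R.add.hom f g) h ≫ R.dr X' Y' Z' =
      R.dr X Y Z ≫ R.add.hom (R.mul.hom f h) (R.mul.hom g h)
  lz_nat : ∀ {X Y : C} (f : X ⟶ Y), R.mul.hom (𝟙 R.add.unit) f ≫ R.lz Y = R.lz X
  rz_nat : ∀ {X Y : C} (f : X ⟶ Y), R.mul.hom f (𝟙 R.add.unit) ≫ R.rz Y = R.rz X
  dl_symm : ∀ X Y Z, R.dl X Y Z ≫ R.add.symm (R.mul.obj X Y) (R.mul.obj X Z) =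
    R.mul.hom (𝟙 X) (R.add.symm Y Z) ≫ R.dl X Z Y
  dr_symm : ∀ X Y Z, R.dr X Y Z ≫ R.add.symm (R.mul.obj X Z) (R.mul.obj Y Z) =
    R.mul.hom (R.add.symm X Y) (𝟙 Z) ≫ R.dr Y X Z
  symm_dr : ∀ X Y Z, R.mul.symm X (R.add.obj Y Z) ≫ R.dr Y Z X =
    R.dl X Y Z ≫ R.add.hom (R.mul.symm X Y) (R.mul.symm X Z)
  dr_add_assoc : ∀ W X Y Z,
    R.dr (R.add.obj W X) Y Z ≫ R.add.hom (R.dr W X Z) (𝟙 (R.mul.obj Y Z)) ≫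
      (R.add.assoc (R.mul.obj W Z) (R.mul.obj X Z) (R.mul.obj Y Z)).hom =
    R.mul.hom (R.add.assoc W X Y).hom (𝟙 Z) ≫ R.dr W (R.add.obj X Y) Z ≫
      R.add.hom (𝟙 (R.mul.obj W Z)) (R.dr X Y Z)
  dl_add_assoc : ∀ W X Y Z,
    R.dl W (R.add.obj X Y) Z ≫ R.add.hom (R.dl W X Y) (𝟙 (R.mul.obj W Z)) ≫
      (R.add.assoc (R.mul.obj W X) (R.mul.obj W Y) (R.mul.obj W Z)).hom =
    R.mul.hom (𝟙 W) (R.add.assoc X Y Z).hom ≫ R.dl W X (R.add.obj Y Z) ≫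
      R.add.hom (𝟙 (R.mul.obj W X)) (R.dl W Y Z)
  dl_mul_assoc : ∀ W X Y Z,
    (R.mul.assoc W X (R.add.obj Y Z)).hom ≫ R.mul.hom (𝟙 W) (R.dl X Y Z) ≫
      R.dl W (R.mul.obj X Y) (R.mul.obj X Z) =
    R.dl (R.mul.obj W X) Y Z ≫ R.add.hom (R.mul.assoc W X Y).hom (R.mul.assoc W X Z).hom
  dr_mul_assoc : ∀ W X Y Z,
    R.mul.hom (R.dr W X Y) (𝟙 Z) ≫ R.dr (R.mul.obj W Y) (R.mul.obj X Y) Z ≫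
      R.add.hom (R.mul.assoc W Y Z).hom (R.mul.assoc X Y Z).hom =
    (R.mul.assoc (R.add.obj W X) Y Z).hom ≫ R.dr W X (R.mul.obj Y Z)
  dl_dr_mul_assoc : ∀ W X Y Z,
    R.mul.hom (R.dl W X Y) (𝟙 Z) ≫ R.dr (R.mul.obj W X) (R.mul.obj W Y) Z ≫
      R.add.hom (R.mul.assoc W X Z).hom (R.mul.assoc W Y Z).hom =
    (R.mul.assoc W (R.add.obj X Y) Z).hom ≫ R.mul.hom (𝟙 W) (R.dr X Y Z) ≫
      R.dl W (R.mul.obj X Z) (R.mul.obj Y Z)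
  dl_dr : ∀ W X Y Z,
    R.dl (R.add.obj W X) Y Z ≫ R.add.hom (R.dr W X Y) (R.dr W X Z) ≫
      R.mid (R.mul.obj W Y) (R.mul.obj X Y) (R.mul.obj W Z) (R.mul.obj X Z) =
    R.dr W X (R.add.obj Y Z) ≫ R.add.hom (R.dl W Y Z) (R.dl X Y Z)
  lz_zero : R.lz R.add.unit = R.rz R.add.unit
  dl_lz : ∀ X Y, R.dl R.add.unit X Y ≫ R.add.hom (R.lz X) (R.lz Y) ≫
    (R.add.lunit R.add.unit).hom = R.lz (R.add.obj X Y)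
  dr_rz : ∀ X Y, R.dr X Y R.add.unit ≫ R.add.hom (R.rz X) (R.rz Y) ≫
    (R.add.lunit R.add.unit).hom = R.rz (R.add.obj X Y)
  rz_one : R.rz R.mul.unit = (R.mul.lunit R.add.unit).hom
  lz_one : R.lz R.mul.unit = (R.mul.runit R.add.unit).hom
  symm_lz : ∀ X, R.mul.symm X R.add.unit ≫ R.lz X = R.rz X
  lz_mul : ∀ X Y, (R.mul.assoc R.add.unit X Y).hom ≫ R.lz (R.mul.obj X Y) =
    R.mul.hom (R.lz X) (𝟙 Y) ≫ R.lz Y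
  rz_lz_mul : ∀ X Y,
    (R.mul.assoc X R.add.unit Y).hom ≫ R.mul.hom (𝟙 X) (R.lz Y) ≫ R.rz X =
    R.mul.hom (R.rz X) (𝟙 Y) ≫ R.lz Y
  rz_mul : ∀ X Y, (R.mul.assoc X Y R.add.unit).hom ≫ R.mul.hom (𝟙 X) (R.rz Y) ≫ R.rz X =
    R.rz (R.mul.obj X Y)
  dl_zero_left : ∀ X Y, R.dl X R.add.unit Y ≫ R.add.hom (R.rz X) (𝟙 (R.mul.obj X Y)) ≫
    (R.add.lunit (R.mul.obj X Y)).hom = R.mul.hom (𝟙 X) (R.add.lunit Y).hom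
  dl_zero_right : ∀ X Y, R.dl X Y R.add.unit ≫ R.add.hom (𝟙 (R.mul.obj X Y)) (R.rz X) ≫
    (R.add.runit (R.mul.obj X Y)).hom = R.mul.hom (𝟙 X) (R.add.runit Y).hom
  dr_zero_left : ∀ X Y, R.dr R.add.unit X Y ≫ R.add.hom (R.lz Y) (𝟙 (R.mul.obj X Y)) ≫
    (R.add.lunit (R.mul.obj X Y)).hom = R.mul.hom (R.add.lunit X).hom (𝟙 Y)
  dr_zero_right : ∀ X Y, R.dr X R.add.unit Y ≫ R.add.hom (𝟙 (R.mul.obj X Y)) (R.lz Y) ≫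
    (R.add.runit (R.mul.obj X Y)).hom = R.mul.hom (R.add.runit X).hom (𝟙 Y)
  dl_one : ∀ X Y, R.dl R.mul.unit X Y ≫ R.add.hom (R.mul.lunit X).hom (R.mul.lunit Y).hom =
    (R.mul.lunit (R.add.obj X Y)).hom
  dr_one : ∀ X Y, R.dr X Y R.mul.unit ≫ R.add.hom (R.mul.runit X).hom (R.mul.runit Y).hom =
    (R.mul.runit (R.add.obj X Y)).hom

/-- A right strict rig category: both monoidal structures are strict, and the right distributor
and the annihilators are identities. -/
structure IsRightStrictRig (R : RigData C) : Prop extends R.IsRig where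
  add_strict : R.add.IsStrict
  mul_strict : R.mul.IsStrict
  dr_strict : ∀ X Y Z, ∃ h : R.mul.obj (R.add.obj X Y) Z =
    R.add.obj (R.mul.obj X Z) (R.mul.obj Y Z), R.dr X Y Z = eqToHom h
  lz_strict : ∀ X, ∃ h : R.mul.obj R.add.unit X = R.add.unit, R.lz X = eqToHom h
  rz_strict : ∀ X, ∃ h : R.mul.obj X R.add.unit = R.add.unit, R.rz X = eqToHom h

end RigData

/-- A functor which preserves a symmetric monoidal structure strictly. -/
structure SymMonData.IsPreservedBy {C : Type u} [Category.{v} C] {D : Type u'} [Category.{v'} D]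
    (M : SymMonData C) (N : SymMonData D) (F : C ⥤ D) : Prop where
  obj : ∀ X Y, F.obj (M.obj X Y) = N.obj (F.obj X) (F.obj Y)
  unit : F.obj M.unit = N.unit
  hom : ∀ {X X' Y Y' : C} (f : X ⟶ X') (g : Y ⟶ Y'),
    F.map (M.hom f g) ≍ N.hom (F.map f) (F.map g)
  assoc : ∀ X Y Z, F.map (M.assoc X Y Z).hom ≍ (N.assoc (F.obj X) (F.obj Y) (F.obj Z)).hom
  lunit : ∀ X, F.map (M.lunit X).hom ≍ (N.lunit (F.obj X)).hom
  runit : ∀ X, F.map (M.runit X).hom ≍ (N.runit (F.obj X)).hom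
  symm : ∀ X Y, F.map (M.symm X Y) ≍ N.symm (F.obj X) (F.obj Y)

/-- An isomorphism of rig categories: an isomorphism of categories which preserves both symmetric
monoidal structures, the distributors and the annihilators strictly. -/
structure RigData.IsRigIso {C : Type u} [Category.{v} C] {D : Type u'} [Category.{v'} D]
    (R : RigData C) (R' : RigData D) (F : C ⥤ D) : Prop where
  iso : ∃ G : D ⥤ C, F ⋙ G = 𝟭 C ∧ G ⋙ F = 𝟭 D
  add : R.add.IsPreservedBy R'.add F
  mul : R.mul.IsPreservedBy R'.mul F
  dl : ∀ X Y Z, F.map (R.dl X Y Z) ≍ R'.dl (F.obj X) (F.obj Y) (F.obj Z)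
  dr : ∀ X Y Z, F.map (R.dr X Y Z) ≍ R'.dr (F.obj X) (F.obj Y) (F.obj Z)
  lz : ∀ X, F.map (R.lz X) ≍ R'.lz (F.obj X)
  rz : ∀ X, F.map (R.rz X) ≍ R'.rz (F.obj X)

/-- The rig structure on tapes over the string diagrams of a monoidal theory. -/
def tapeRig (T : MonoidalTheory.{u, v}) : RigData (TapeCat (Diag T)) where
  add :=
    { obj := fun P Q => List.append P Q
      hom := fun f g => TapeCat.sum f g
      unit := ([] : List (Diag T))
      assoc := fun P Q R => eqToIso (List.append_assoc (α := Diag T) P Q R)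
      lunit := fun P => eqToIso (List.nil_append (α := Diag T) P)
      runit := fun P => eqToIso (List.append_nil (α := Diag T) P)
      symm := fun P Q => TapeCat.sumSymm P Q }
  mul :=
    { obj := fun P Q => mul P Q
      hom := fun f g => TapeCat.prod f g
      unit := ([Diag.one] : List (Diag T))
      assoc := fun P Q R => eqToIso (mul_assoc P Q R)
      lunit := fun P => eqToIso (one_mul P)
      runit := fun P => eqToIso (mul_one P)
      symm := fun P Q => TapeCat.mulSymm P Q }
  dl P Q R := TapeCat.dl P Q R
  dr P Q R := eqToHom (add_mul P Q R)
  lz P := eqToHom (zero_mul P)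
  rz P := eqToHom (mul_zero P)

/-- The rig structure on stochastic matrices over subdistributions of string diagrams of a
monoidal theory. -/
noncomputable def stMatRig (T : MonoidalTheory.{u, v}) : RigData (StMat (Diag T)) where
  add :=
    { obj := fun P Q => List.append P Q
      hom := fun f g => StMat.sum f g
      unit := ([] : List (Diag T))
      assoc := fun P Q R => eqToIso (List.append_assoc (α := Diag T) P Q R)
      lunit := fun P => eqToIso (List.nil_append (α := Diag T) P)
      runit := fun P => eqToIso (List.append_nil (α := Diag T) P)
      symm := fun P Q => StMat.sumSymm P Q }
  mul :=
    { obj := fun P Q => mul P Q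
      hom := fun f g => StMat.prod f g
      unit := ([Diag.one] : List (Diag T))
      assoc := fun P Q R => eqToIso (mul_assoc P Q R)
      lunit := fun P => eqToIso (one_mul P)
      runit := fun P => eqToIso (mul_one P)
      symm := fun P Q => StMat.mulSymm P Q }
  dl P Q R := StMat.dl P Q R
  dr P Q R := eqToHom (add_mul P Q R)
  lz P := eqToHom (zero_mul P)
  rz P := eqToHom (mul_zero P)

/-- The functor is the identity on objects and sends the generators of tapes to the matrices of the
same name. -/
structure IsInterpretation {C : Type u} [Category.{v} C] (F : TapeCat C ⥤ StMat C) : Prop where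
  obj : ∀ P : List C, F.obj P = P
  tape : ∀ {U V : C} (c : U ⟶ V), F.map (TapeCat.tape c) ≍ StMat.tape c
  split : ∀ (p : OpenUnit) (U : C), F.map (TapeCat.ofTerm (.gen (.split p U))) ≍
    StMat.split ⟨p.1, p.2.1.le, p.2.2.le⟩ U
  bang : ∀ U : C, F.map (TapeCat.ofTerm (.gen (.bang U))) ≍ StMat.bang U
  cobang : ∀ U : C, F.map (TapeCat.ofTerm (.gen (.cobang U))) ≍ StMat.cobang U
  codiag : ∀ U : C, F.map (TapeCat.ofTerm (.gen (.codiag U))) ≍ StMat.codiag U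

end TapeDiagrams

/-! The isomorphism exists because tapes have a normal form. Since `codiag` and `cobang` are natural
commutative monoids, `⊕` is a coproduct, so a tape is determined by its composites with the
injections of the summands of its source. A tape out of a single monomial `U` is, because of `split`
and `bang`, a convex combination of arrows `tape c` followed by an injection and of the zero arrow.
Its coefficients form one column of a stochastic matrix, and conversely every such column is
realised.

Matrices are handled through a faithful linear action. A vector is a formal real combination of
pairs of a position and an arrow, and a matrix acts on it by postcomposition (`act`, `hom_ext_act`).
Positions are natural numbers and arrows carry their source and target, so vectors do not mention
the word they live over. Strictness isomorphisms therefore act as the identity, `⊕` becomes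
concatenation of blocks with shifted positions, and `⊗` becomes a bilinear product `tens` with
position `y + n * x`. Equations between matrices are then checked block by block, or on pure
tensors.

Over an arbitrary category `C` the interpretation of tapes is sound (`interp_eqv`) because every
axiom holds for the action.

Completeness (`eqv_of_interp`) uses that the arrows `[U] ⟶ Q` of tapes form a convex algebra. A
convex algebra embeds in its cone, a module over the nonnegative reals where sums of many terms make
sense. There the expansion of `inj ; t` has the entries of the matrix of `t` as coefficients, apart
from the coefficient of the zero arrow (`denotes_interp`). The latter is fixed because the total
weight is one. Two tapes with the same matrix thus agree after every injection, and the injections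
are jointly epic (`eqv_of_inj`).

Fullness (`exists_interp`) is convexity: the vectors presented by tapes out of `U` form a convex set
which contains zero and all basis vectors, hence every subprobability vector. The columns of a
matrix are then copaired.

For string diagrams, the interpretation is shown to carry each recursively defined structure of
tapes (`dl`, whiskerings, `prod`, `mulSymm`) to the corresponding matrix. The essential case is
whiskering by a monomial: tensoring with a fixed vector over that monomial intertwines the action of
a tape with that of its whiskering (`Intertwines`). The rig laws are proved for matrices, where most
reduce to bookkeeping of blocks, and the genuinely diagrammatic input is interchange, naturality of
the symmetry and its hexagon. They are pulled back to tapes along the faithful, structure-preserving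
functor. -/

namespace TapeDiagrams

/-! ### The linear action of matrices on formal combinations of arrows -/

/-- An arrow of `C`, together with its source and target. -/
structure AnyHom (C : Type u) [Category.{v} C] where
  /-- the source -/
  src : C
  /-- the target -/
  tgt : C
  /-- the arrow -/
  hom : src ⟶ tgt

/-- Formal combinations of pairs of a position and an arrow. -/
abbrev Vec (C : Type u) [Category.{v} C] : Type (max u v) := (ℕ × AnyHom C) →₀ ℝ

section vec

variable {C : Type u} [Category.{v} C]

namespace AnyHom

/-- The identity of `U`. -/
def id (U : C) : AnyHom C := ⟨U, U, 𝟙 U⟩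

/-- The composite, if the arrows are composable. -/
noncomputable def comp (f g : AnyHom C) : AnyHom C :=
  open Classical in
  -- The default for non-composable arrows is `f`, which makes `comp_src` unconditional.
  if h : f.tgt = g.src then ⟨f.src, g.tgt, f.hom ≫ eqToHom h ≫ g.hom⟩ else f

@[simp] theorem comp_mk {U V W : C} (f : U ⟶ V) (g : V ⟶ W) :
    comp ⟨U, V, f⟩ ⟨V, W, g⟩ = ⟨U, W, f ≫ g⟩ := by
  simp [comp]

theorem comp_src (f g : AnyHom C) : (comp f g).src = f.src := by
  unfold comp; split <;> rfl

theorem comp_tgt {f g : AnyHom C} (h : f.tgt = g.src) : (comp f g).tgt = g.tgt := by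
  simp [comp, h]

theorem comp_assoc {f g h : AnyHom C} (hf : f.tgt = g.src) (hg : g.tgt = h.src) :
    comp (comp f g) h = comp f (comp g h) := by
  obtain ⟨A, B, f⟩ := f
  obtain ⟨B', D, g⟩ := g
  obtain ⟨D', E, h⟩ := h
  obtain rfl : B = B' := hf
  obtain rfl : D = D' := hg
  simp

theorem id_comp (f : AnyHom C) {U : C} (h : f.src = U) : comp (id U) f = f := by
  subst h
  obtain ⟨A, B, f⟩ := f
  simp [id]

/-- This is the purpose of bundling: a transport along an equality of objects leaves the bundled
arrow unchanged. -/
theorem mk_comp_eqToHom {A U V : C} (f : A ⟶ U) (h : U = V) :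
    (⟨A, V, f ≫ eqToHom h⟩ : AnyHom C) = ⟨A, U, f⟩ := by
  subst h; simp

theorem mk_eqToHom_comp {A U V : C} (f : U ⟶ V) (h : A = U) :
    (⟨A, V, eqToHom h ≫ f⟩ : AnyHom C) = ⟨U, V, f⟩ := by
  subst h; simp

end AnyHom

/-- The basis vector at `x`. -/
noncomputable abbrev ket (x : ℕ × AnyHom C) : Vec C := Finsupp.single x 1

/-- `x` is a pair of a position `i` of `P` and an arrow from `A` to the letter at `i`. -/
def Valid (A : C) (P : List C) (x : ℕ × AnyHom C) : Prop :=
  x.2.src = A ∧ P[x.1]? = some x.2.tgt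

/-- The span of the pairs of a position `i` of `P` and an arrow from `A` to the letter at `i`. -/
noncomputable def VSpace (A : C) (P : List C) : Submodule ℝ (Vec C) :=
  Submodule.span ℝ (ket '' {x | Valid A P x})

/-- The unit vectors of `P`. -/
def units (P : List C) : Set (Vec C) :=
  {v | ∃ i U, P[i]? = some U ∧ v = ket (i, AnyHom.id U)}

theorem ket_mem {A : C} {P : List C} {x : ℕ × AnyHom C} (h : Valid A P x) : ket x ∈ VSpace A P :=
  Submodule.subset_span ⟨x, h, rfl⟩

theorem VSpace_eq_supported (A : C) (P : List C) :
    VSpace A P = Finsupp.supported ℝ ℝ {x | Valid A P x} :=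
  (Finsupp.supported_eq_span_single ℝ _).symm

theorem valid_of_mem {A : C} {P : List C} {v : Vec C} (h : v ∈ VSpace A P) {x : ℕ × AnyHom C}
    (hx : x ∈ v.support) : Valid A P x := by
  rw [VSpace_eq_supported, Finsupp.mem_supported] at h
  exact h hx

/-- The unit at position `i` has the letter there as its source, so different units lie in different
spaces. -/
theorem units_mem {P : List C} {v : Vec C} (h : v ∈ units P) : ∃ A, v ∈ VSpace A P := by
  obtain ⟨i, U, h, rfl⟩ := h
  exact ⟨U, ket_mem ⟨rfl, h⟩⟩

theorem eqOn_VSpace {W : Type*} [AddCommMonoid W] [Module ℝ W] {A : C} {P : List C}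
    {f g : Vec C →ₗ[ℝ] W} (h : ∀ x, Valid A P x → f (ket x) = g (ket x)) {v : Vec C}
    (hv : v ∈ VSpace A P) : f v = g v := by
  refine LinearMap.eqOn_span (f := f) (g := g) ?_ hv
  rintro _ ⟨x, hx, rfl⟩
  exact h x hx

/-- The composite is spelled out as two applications so that goals of this shape unify directly. -/
theorem eqOn_comp {W W' : Type*} [AddCommMonoid W] [Module ℝ W] [AddCommMonoid W'] [Module ℝ W']
    {A : C} {P : List C} (f₂ : W →ₗ[ℝ] W') (f₁ : Vec C →ₗ[ℝ] W) (g : Vec C →ₗ[ℝ] W')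
    (h : ∀ x, Valid A P x → f₂ (f₁ (ket x)) = g (ket x)) {v : Vec C}
    (hv : v ∈ VSpace A P) : f₂ (f₁ v) = g v := by
  have := eqOn_VSpace (f := f₂ ∘ₗ f₁) (g := g) h hv
  exact this

theorem eqOn_comp_comp {W W' W'' : Type*} [AddCommMonoid W] [Module ℝ W] [AddCommMonoid W']
    [Module ℝ W'] [AddCommMonoid W''] [Module ℝ W'']
    {A : C} {P : List C} (f₂ : W →ₗ[ℝ] W') (f₁ : Vec C →ₗ[ℝ] W) (g₂ : W'' →ₗ[ℝ] W')
    (g₁ : Vec C →ₗ[ℝ] W'') (h : ∀ x, Valid A P x → f₂ (f₁ (ket x)) = g₂ (g₁ (ket x))) {v : Vec C}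
    (hv : v ∈ VSpace A P) : f₂ (f₁ v) = g₂ (g₁ v) :=
  eqOn_comp f₂ f₁ (g₂ ∘ₗ g₁) h hv

theorem eqOn_id {A : C} {P : List C} (f : Vec C →ₗ[ℝ] Vec C)
    (h : ∀ x, Valid A P x → f (ket x) = ket x) {v : Vec C} (hv : v ∈ VSpace A P) : f v = v :=
  eqOn_VSpace (g := LinearMap.id) h hv

theorem map_VSpace {A A' : C} {P P' : List C} {f : Vec C →ₗ[ℝ] Vec C}
    (h : ∀ x, Valid A P x → f (ket x) ∈ VSpace A' P') {v : Vec C}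
    (hv : v ∈ VSpace A P) : f v ∈ VSpace A' P' := by
  have : VSpace A P ≤ (VSpace A' P').comap f := by
    refine Submodule.span_le.2 ?_
    rintro _ ⟨x, hx, rfl⟩
    exact h x hx
  exact this hv

/-! ### Shifts and precomposition -/

/-- The shift of positions by `n`. -/
noncomputable def shift (n : ℕ) : Vec C →ₗ[ℝ] Vec C :=
  Finsupp.linearCombination ℝ fun x => ket (n + x.1, x.2)

@[simp] theorem shift_ket (n : ℕ) (x : ℕ × AnyHom C) : shift n (ket x) = ket (n + x.1, x.2) := by
  simp [shift]

theorem linearMap_ext {W : Type*} [AddCommMonoid W] [Module ℝ W] {f g : Vec C →ₗ[ℝ] W}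
    (h : ∀ x, f (ket x) = g (ket x)) : f = g :=
  Finsupp.lhom_ext' fun x => LinearMap.ext_ring (h x)

@[simp] theorem shift_shift (n m : ℕ) (v : Vec C) : shift n (shift m v) = shift (n + m) v := by
  refine LinearMap.congr_fun (f := shift n ∘ₗ shift m) (linearMap_ext fun x => ?_) v
  simp [add_assoc]

@[simp] theorem shift_zero (v : Vec C) : shift 0 v = v := by
  refine LinearMap.congr_fun (g := LinearMap.id) (linearMap_ext fun x => ?_) v
  simp

/-- Precomposition with an arrow. -/
noncomputable def pre (h : AnyHom C) : Vec C →ₗ[ℝ] Vec C :=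
  Finsupp.linearCombination ℝ fun x => ket (x.1, h.comp x.2)

@[simp] theorem pre_ket (h : AnyHom C) (x : ℕ × AnyHom C) :
    pre h (ket x) = ket (x.1, h.comp x.2) := by
  simp [pre]

theorem pre_shift (h : AnyHom C) (n : ℕ) (v : Vec C) : pre h (shift n v) = shift n (pre h v) := by
  refine LinearMap.congr_fun (f := pre h ∘ₗ shift n) (g := shift n ∘ₗ pre h)
    (linearMap_ext fun x => ?_) v
  simp

theorem valid_pre {B A : C} {P : List C} {x : ℕ × AnyHom C} (h : B ⟶ A) (hx : Valid A P x) :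
    Valid B P (x.1, AnyHom.comp ⟨B, A, h⟩ x.2) :=
  ⟨AnyHom.comp_src _ _, by rw [AnyHom.comp_tgt hx.1.symm]; exact hx.2⟩

theorem pre_mem {B A : C} {P : List C} {v : Vec C} (h : B ⟶ A) (hv : v ∈ VSpace A P) :
    pre ⟨B, A, h⟩ v ∈ VSpace B P := by
  refine map_VSpace (fun x hx => ?_) hv
  rw [pre_ket]
  exact ket_mem (valid_pre h hx)

theorem pre_pre {A B D : C} {P : List C} {v : Vec C} (h : A ⟶ B) (k : B ⟶ D)
    (hv : v ∈ VSpace D P) : pre ⟨A, B, h⟩ (pre ⟨B, D, k⟩ v) = pre ⟨A, D, h ≫ k⟩ v := by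
  refine eqOn_comp _ _ _ (fun x hx => ?_) hv
  simp only [pre_ket]
  rw [← AnyHom.comp_assoc rfl hx.1.symm, AnyHom.comp_mk]

theorem pre_id {A : C} {P : List C} {v : Vec C} (hv : v ∈ VSpace A P) :
    pre (AnyHom.id A) v = v := by
  refine eqOn_id _ (fun x hx => ?_) hv
  rw [pre_ket, AnyHom.id_comp _ hx.1]

/-! ### Words -/

theorem valid_append_iff {A : C} {P Q : List C} {x : ℕ × AnyHom C} :
    Valid A (P ++ Q) x ↔ Valid A P x ∨ (P.length ≤ x.1 ∧ Valid A Q (x.1 - P.length, x.2)) := by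
  obtain ⟨i, a⟩ := x
  simp only [Valid]
  rcases lt_or_ge i P.length with h | h
  · rw [List.getElem?_append_left h]
    constructor
    · exact fun h' => .inl h'
    · rintro (h' | ⟨h', -⟩)
      · exact h'
      · omega
  · rw [List.getElem?_append_right h, List.getElem?_eq_none h]
    simp [h]

theorem valid_lt {A : C} {P : List C} {x : ℕ × AnyHom C} (h : Valid A P x) : x.1 < P.length :=
  (List.getElem?_eq_some_iff.1 h.2).1

theorem valid_inl {A : C} {P : List C} (Q : List C) {x : ℕ × AnyHom C} (h : Valid A P x) :
    Valid A (P ++ Q) x := valid_append_iff.2 (.inl h)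

theorem valid_inr {A : C} (P : List C) {Q : List C} {x : ℕ × AnyHom C} (h : Valid A Q x) :
    Valid A (P ++ Q) (P.length + x.1, x.2) :=
  valid_append_iff.2 (.inr ⟨Nat.le_add_right _ _, by simpa using h⟩)

theorem inl_mem {A : C} {P : List C} (Q : List C) {v : Vec C} (h : v ∈ VSpace A P) :
    v ∈ VSpace A (P ++ Q) :=
  map_VSpace (f := LinearMap.id) (fun _ hx => ket_mem (valid_inl Q hx)) h

theorem shift_mem {A : C} (P : List C) {Q : List C} {v : Vec C} (h : v ∈ VSpace A Q) :
    shift P.length v ∈ VSpace A (P ++ Q) :=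
  map_VSpace (fun x hx => by rw [shift_ket]; exact ket_mem (valid_inr P hx)) h

/-- Together with `hom_ext_act` this reduces an equation of matrices out of a sum to its summands.
Positions of the first block are unchanged in `P ++ Q`, so only the second block needs a shift. -/
theorem units_append {P Q : List C} {v : Vec C} (h : v ∈ units (P ++ Q)) :
    v ∈ units P ∨ ∃ w ∈ units Q, v = shift P.length w := by
  obtain ⟨i, U, h, rfl⟩ := h
  rcases lt_or_ge i P.length with hi | hi
  · rw [List.getElem?_append_left hi] at h
    exact .inl ⟨i, U, h, rfl⟩
  · rw [List.getElem?_append_right hi] at h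
    refine .inr ⟨_, ⟨_, U, h, rfl⟩, ?_⟩
    rw [shift_ket, Nat.add_sub_cancel' hi]

theorem units_nil {v : Vec C} : v ∉ units ([] : List C) := by
  rintro ⟨i, U, h, -⟩
  simp at h

theorem valid_nil {A : C} {x : ℕ × AnyHom C} : ¬ Valid A [] x := by
  rintro ⟨-, h⟩
  simp at h

end vec

/-! ### The action of matrices on vectors -/

namespace StMat

variable {C : Type u} [Category.{v} C]

/-- The image of a basis vector under a matrix. -/
noncomputable def actKet {P Q : List C} (M : Arr P Q) (x : ℕ × AnyHom C) : Vec C :=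
  open Classical in
  -- There is no test that the target of the arrow is the letter at its position. Outside the spaces
  -- `VSpace A P` the values are meaningless, and the laws of composition and precomposition are
  -- restricted to these spaces.
  if h : x.1 < P.length then
    ∑ j, (Hom.entry M ⟨x.1, h⟩ j).val.sum fun g a =>
      Finsupp.single ((j : ℕ), x.2.comp ⟨_, _, g⟩) a
  else 0

/-- The action of a matrix on vectors, by postcomposition. -/
noncomputable def act {P Q : List C} (M : Arr P Q) : Vec C →ₗ[ℝ] Vec C :=
  Finsupp.linearCombination ℝ (actKet M)

theorem act_ket {P Q : List C} (M : Arr P Q) (i : Fin P.length) {A : C} (f : A ⟶ P.get i) :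
    act M (ket (i, ⟨A, P.get i, f⟩)) = ∑ j, (Hom.entry M i j).val.sum fun g a =>
      Finsupp.single ((j : ℕ), ⟨A, Q.get j, f ≫ g⟩) a := by
  simp [act, actKet]

/-- The coefficients stand outside the basis vectors, so that linear maps can be pushed through the
sum. -/
theorem act_ket' {P Q : List C} (M : Arr P Q) (i : Fin P.length) {A : C} (f : A ⟶ P.get i) :
    act M (ket (i, ⟨A, P.get i, f⟩)) = ∑ j, (Hom.entry M i j).val.sum fun g a =>
      a • ket ((j : ℕ), ⟨A, Q.get j, f ≫ g⟩) := by
  rw [act_ket]; simp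

/-- Valid basis vectors are given by a position in `Fin P.length` and a typed arrow. -/
theorem exists_of_valid {A : C} {P : List C} {x : ℕ × AnyHom C} (h : Valid A P x) :
    ∃ (i : Fin P.length) (f : A ⟶ P.get i), x = ((i : ℕ), ⟨A, P.get i, f⟩) := by
  obtain ⟨hA, h⟩ := h
  obtain ⟨hi, h⟩ := List.getElem?_eq_some_iff.1 h
  refine ⟨⟨x.1, hi⟩, eqToHom hA.symm ≫ x.2.hom ≫ eqToHom h.symm, Prod.ext rfl ?_⟩
  rw [AnyHom.mk_eqToHom_comp]
  exact (AnyHom.mk_comp_eqToHom x.2.hom h.symm).symm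

theorem valid_mk {A : C} {P : List C} (i : Fin P.length) (f : A ⟶ P.get i) :
    Valid A P ((i : ℕ), ⟨A, P.get i, f⟩) := ⟨rfl, by simp⟩

theorem act_mem {A : C} {P Q : List C} (M : Arr P Q) {v : Vec C} (hv : v ∈ VSpace A P) :
    act M v ∈ VSpace A Q := by
  refine map_VSpace (fun x hx => ?_) hv
  obtain ⟨i, f, rfl⟩ := exists_of_valid hx
  rw [act_ket']
  exact Submodule.sum_mem _ fun j _ => Submodule.sum_mem _ fun g _ =>
    Submodule.smul_mem _ _ (ket_mem (valid_mk _ _))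

/-- The action is by postcomposition, so this is associativity of composition in `C`. -/
theorem act_pre {A B : C} {P Q : List C} (M : Arr P Q) (h : B ⟶ A) {v : Vec C}
    (hv : v ∈ VSpace A P) : act M (pre ⟨B, A, h⟩ v) = pre ⟨B, A, h⟩ (act M v) := by
  refine eqOn_comp_comp _ _ _ _ (fun x hx => ?_) hv
  obtain ⟨i, f, rfl⟩ := exists_of_valid hx
  simp only [pre_ket, AnyHom.comp_mk]
  rw [act_ket', act_ket']
  simp only [Finsupp.sum, map_sum, map_smul, pre_ket, AnyHom.comp_mk, Category.assoc]

/-- A Yoneda argument: the coefficient at `(j, g)` of the image of the identity at position `i` is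
the weight of `g` in the entry `(i, j)`. -/
theorem hom_ext_act {P Q : List C} {M N : Arr P Q} (h : ∀ v ∈ units P, act M v = act N v) :
    M = N := by
  refine Hom.ext (funext fun i => funext fun j => SubDist.ext (Finsupp.ext fun g => ?_))
  have key : ∀ L : Arr P Q, act L (ket ((i : ℕ), AnyHom.id (P.get i))) ((j : ℕ), ⟨_, _, g⟩) =
      (Hom.entry L i j).val g := by
    intro L
    rw [AnyHom.id, act_ket, Finsupp.finsetSum_apply, Finset.sum_eq_single j]
    · simp only [Category.id_comp, Finsupp.sum_apply]
      rw [Finsupp.sum, Finset.sum_eq_single g]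
      · simp
      · intro g' _ hg'
        refine Finsupp.single_eq_of_ne ?_
        intro h
        exact hg' (by simpa using h.symm)
      · intro hg
        simpa using hg
    · intro j' _ hj'
      simp only [Finsupp.sum_apply]
      refine Finset.sum_eq_zero fun g' _ => Finsupp.single_eq_of_ne ?_
      intro h
      exact hj' (Fin.ext (congrArg Prod.fst h).symm)
    · simp
  refine (key M).symm.trans (Eq.trans ?_ (key N))
  rw [h]
  exact ⟨i, _, by simp, rfl⟩

/-- Vectors do not mention words, so matrices whose types agree only propositionally can be compared
by an honest equation of actions. All strictness laws are obtained in this way. -/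
theorem heq_of_act {P Q P' Q' : List C} (hP : P = P') (hQ : Q = Q') {M : Arr P Q} {N : Arr P' Q'}
    (h : ∀ v ∈ units P, act M v = act N v) : M ≍ N := by
  subst hP hQ
  exact heq_of_eq (hom_ext_act h)

theorem act_congr {P Q P' Q' : List C} (hP : P = P') (hQ : Q = Q') {M : Arr P Q} {N : Arr P' Q'}
    (h : M ≍ N) : act M = act N := by
  subst hP hQ
  rw [eq_of_heq h]

/-- The identity of a word. -/
noncomputable abbrev ident (P : List C) : Arr P P := CategoryStruct.id (obj := StMat C) P

theorem act_id {A : C} {P : List C} {v : Vec C} (hv : v ∈ VSpace A P) :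
    act (ident P) v = v := by
  refine eqOn_id _ (fun x hx => ?_) hv
  obtain ⟨i, f, rfl⟩ := exists_of_valid hx
  have h (j) : (Hom.entry (ident P) i j).val = (idMat P).lin i j := rfl
  rw [act_ket, Finset.sum_eq_single i, h, lin_idMat_self]
  · refine (Finsupp.sum_single_index ?_).trans ?_
    · simp
    · exact congrArg (fun f => ket (_, AnyHom.mk _ _ f)) (Category.comp_id f)
  · intro j _ hj
    rw [h, lin_idMat_of_ne _ hj.symm]
    exact Finsupp.sum_zero_index
  · simp

theorem act_eqToHom {A : C} {P Q : List C} (h : P = Q) {v : Vec C} (hv : v ∈ VSpace A P) :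
    act (eqToHom (C := StMat C) h : Arr P Q) v = v := by
  subst h
  exact act_id hv

theorem act_comp {A : C} {P Q R : List C} (M : Arr P Q) (N : Arr Q R) {v : Vec C}
    (hv : v ∈ VSpace A P) : act (M ≫ N : Arr P R) v = act N (act M v) := by
  refine (eqOn_comp _ _ _ (fun x hx => ?_) hv).symm
  obtain ⟨i, f, rfl⟩ := exists_of_valid hx
  rw [act_ket' M]
  have h (k) : (Hom.entry (M ≫ N : Arr P R) i k).val =
      ∑ j, (Hom.entry M i j).val.sum fun x a => (Hom.entry N j k).val.sum fun y b =>
        Finsupp.single (x ≫ y) (a * b) := rfl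
  -- Postcomposing `f` is written as a linear map of the entry, so that it passes through the sum
  -- defining the entry of the product. What remains is an exchange of finite sums.
  have e (k) : ((Hom.entry (M ≫ N : Arr P R) i k).val.sum fun g a =>
      Finsupp.single ((k : ℕ), (⟨A, R.get k, f ≫ g⟩ : AnyHom C)) a) =
      Finsupp.linearCombination ℝ (fun g => ket ((k : ℕ), (⟨A, R.get k, f ≫ g⟩ : AnyHom C)))
        (Hom.entry (M ≫ N : Arr P R) i k).val := by
    simp [Finsupp.linearCombination_apply]
  symm
  rw [act_ket, Finset.sum_congr rfl fun k _ => e k]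
  simp only [h, Finsupp.sum, map_sum, map_smul, act_ket', Finsupp.linearCombination_single]
  rw [Finset.sum_comm]
  refine Finset.sum_congr rfl fun j _ => ?_
  rw [Finset.sum_comm]
  refine Finset.sum_congr rfl fun g _ => ?_
  rw [Finset.smul_sum]
  refine Finset.sum_congr rfl fun k _ => ?_
  rw [Finset.smul_sum]
  refine Finset.sum_congr rfl fun g' _ => ?_
  rw [smul_smul, Category.assoc]

theorem act_monomial {P Q : List C} (φ : Fin P.length → Fin Q.length)
    (g : ∀ i, P.get i ⟶ Q.get (φ i)) (i : Fin P.length) {A : C} (f : A ⟶ P.get i) :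
    act (monomial φ g : Arr P Q) (ket (i, ⟨A, P.get i, f⟩)) =
      ket ((φ i : ℕ), ⟨A, Q.get (φ i), f ≫ g i⟩) := by
  rw [act_ket, Finset.sum_eq_single (φ i)]
  · have := monomial_entry φ g i
    refine Eq.trans (congrArg (fun d : SubDist _ => Finsupp.sum d.val _) this) ?_
    refine (Finsupp.sum_single_index ?_).trans ?_ <;> simp
  · intro j _ hj
    have := monomial_entry_of_ne φ g (i := i) (j := j) hj.symm
    refine Eq.trans (congrArg (fun d : SubDist _ => Finsupp.sum d.val _) this) ?_
    exact Finsupp.sum_zero_index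
  · simp

theorem act_permMat {P Q : List C} (φ : ∀ i : Fin P.length, {j : Fin Q.length // Q.get j = P.get i})
    (i : Fin P.length) {A : C} (f : A ⟶ P.get i) :
    act (permMat φ) (ket (i, ⟨A, P.get i, f⟩)) = ket (((φ i).1 : ℕ), ⟨A, P.get i, f⟩) := by
  refine (act_monomial _ _ _ _).trans ?_
  rw [AnyHom.mk_comp_eqToHom]

/-- The action is nonnegative. -/
theorem act_ket_nonneg {P Q : List C} (M : Arr P Q) (x y : ℕ × AnyHom C) :
    0 ≤ act M (ket x) y := by
  classical
  rw [act, Finsupp.linearCombination_single, one_smul, actKet]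
  split_ifs
  · rw [Finsupp.finsetSum_apply]
    refine Finset.sum_nonneg fun j _ => ?_
    rw [Finsupp.sum_apply]
    refine Finset.sum_nonneg fun g _ => ?_
    simp only [Finsupp.single_apply]
    split_ifs
    · exact SubDist.nonneg _ _
    · exact le_rfl
  · simp

/-- Postcomposition may merge arrows but preserves total weight, so the bound is the one on the
column masses. -/
theorem act_ket_mass_le {P Q : List C} (M : Arr P Q) (x : ℕ × AnyHom C) :
    ((act M (ket x)).sum fun _ a => a) ≤ 1 := by
  classical
  rw [act, Finsupp.linearCombination_single, one_smul, actKet]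
  split_ifs with h
  · rw [SubDist.sum_finsetSum]
    refine le_trans (le_of_eq (Finset.sum_congr rfl fun j _ => ?_)) (Hom.sum_mass_le M ⟨x.1, h⟩)
    rw [SubDist.sum_finsuppSum]
    simp [SubDist.mass]
  · simp

theorem cast_val_sum {X Y : Type w} (h : X = Y) (d : SubDist X) {Z : Type*} [AddCommMonoid Z]
    (F : Y → ℝ → Z) :
    (SubDist.cast h d).val.sum F = d.val.sum fun x a => F (h ▸ x) a := by
  subst h
  rfl

theorem splitAdd_inl {D : Type*} (P Q : List D) (i : Fin P.length) :
    splitAdd P Q (inlIdx P Q i).1 = .inl ⟨i, (inlIdx P Q i).2.symm⟩ := by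
  unfold splitAdd
  exact dif_pos (show ((inlIdx P Q i).1 : ℕ) < P.length from i.2)

theorem splitAdd_inr {D : Type*} (P Q : List D) (i : Fin Q.length) :
    splitAdd P Q (inrIdx P Q i).1 = .inr ⟨i, (inrIdx P Q i).2.symm⟩ := by
  unfold splitAdd
  refine (dif_neg (by simp [inrIdx])).trans ?_
  congr
  simp [inrIdx]

theorem sum_append {D Z : Type*} [AddCommMonoid Z] (P Q : List D)
    (F : Fin (P ++ Q).length → Z) :
    ∑ j, F j = ∑ k, F (inlIdx P Q k).1 + ∑ k, F (inrIdx P Q k).1 := by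
  rw [← Equiv.sum_comp (finSumFinEquiv.trans
    (finCongr (List.length_append (as := P) (bs := Q)).symm)), Fintype.sum_sum_type]
  rfl

/-- Removes the casts in the entries of block sums and Kronecker products: they vanish once the
composite is bundled. -/
theorem mk_cast_hom {A U U' V V' : C} (f : A ⟶ U) (hU : U = U') (hV : V = V') (g : U ⟶ V)
    (h : (U ⟶ V) = (U' ⟶ V')) (f' : A ⟶ U') (hf : f' = f ≫ eqToHom hU) :
    (⟨A, V', f' ≫ (h ▸ g)⟩ : AnyHom C) = ⟨A, V, f ≫ g⟩ := by
  subst hU hV hf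
  rw [eqToHom_refl, Category.comp_id]

theorem act_sum_inl {A : C} {P₁ Q₁ P₂ Q₂ : List C} (M : Arr P₁ Q₁) (N : Arr P₂ Q₂) {v : Vec C}
    (hv : v ∈ VSpace A P₁) : act (sum M N) v = act M v := by
  refine eqOn_VSpace (fun x hx => ?_) hv
  obtain ⟨i, f, rfl⟩ := exists_of_valid hx
  -- The same pair, now read as a position of the longer word so that the entries of the block
  -- matrix apply to it.
  have e : (((i : ℕ), ⟨A, P₁.get i, f⟩) : ℕ × AnyHom C) = (((inlIdx P₁ P₂ i).1 : ℕ),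
      ⟨A, (P₁ ++ P₂).get (inlIdx P₁ P₂ i).1, f ≫ eqToHom (inlIdx P₁ P₂ i).2.symm⟩) := by
    rw [AnyHom.mk_comp_eqToHom]; rfl
  rw [e, act_ket, ← e, act_ket, sum_append]
  have h1 (k) : Hom.entry (sum M N) (inlIdx P₁ P₂ i).1 (inlIdx Q₁ Q₂ k).1 =
      SubDist.cast (by rw [(inlIdx P₁ P₂ i).2, (inlIdx Q₁ Q₂ k).2]) (Hom.entry M i k) := by
    change sumEntry M N _ _ = _
    unfold sumEntry
    rw [splitAdd_inl, splitAdd_inl]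
  have h2 (k) : Hom.entry (sum M N) (inlIdx P₁ P₂ i).1 (inrIdx Q₁ Q₂ k).1 = 0 := by
    change sumEntry M N _ _ = _
    unfold sumEntry
    rw [splitAdd_inl, splitAdd_inr]
  simp only [h1, h2, cast_val_sum]
  refine (congrArg₂ _ rfl (Finset.sum_eq_zero fun k _ => Finsupp.sum_zero_index)).trans ?_
  rw [add_zero]
  refine Finset.sum_congr rfl fun k _ => Finsupp.sum_congr fun g _ => ?_
  rw [mk_cast_hom f (inlIdx P₁ P₂ i).2.symm (inlIdx Q₁ Q₂ k).2.symm g _ _ rfl]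
  rfl

theorem act_sum_inr {A : C} {P₁ Q₁ P₂ Q₂ : List C} (M : Arr P₁ Q₁) (N : Arr P₂ Q₂) {v : Vec C}
    (hv : v ∈ VSpace A P₂) :
    act (sum M N) (shift P₁.length v) = shift Q₁.length (act N v) := by
  refine eqOn_comp_comp _ _ _ _ (fun x hx => ?_) hv
  obtain ⟨i, f, rfl⟩ := exists_of_valid hx
  have e : ((P₁.length + (i : ℕ), ⟨A, P₂.get i, f⟩) : ℕ × AnyHom C) = (((inrIdx P₁ P₂ i).1 : ℕ),
      ⟨A, (P₁ ++ P₂).get (inrIdx P₁ P₂ i).1, f ≫ eqToHom (inrIdx P₁ P₂ i).2.symm⟩) := by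
    rw [AnyHom.mk_comp_eqToHom]; rfl
  rw [shift_ket, e, act_ket, act_ket', sum_append]
  have h1 (k) : Hom.entry (sum M N) (inrIdx P₁ P₂ i).1 (inrIdx Q₁ Q₂ k).1 =
      SubDist.cast (by rw [(inrIdx P₁ P₂ i).2, (inrIdx Q₁ Q₂ k).2]) (Hom.entry N i k) := by
    change sumEntry M N _ _ = _
    unfold sumEntry
    rw [splitAdd_inr, splitAdd_inr]
  have h2 (k) : Hom.entry (sum M N) (inrIdx P₁ P₂ i).1 (inlIdx Q₁ Q₂ k).1 = 0 := by
    change sumEntry M N _ _ = _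
    unfold sumEntry
    rw [splitAdd_inl, splitAdd_inr]
  simp only [h1, h2, cast_val_sum]
  refine (congrArg₂ _ (Finset.sum_eq_zero fun k _ => Finsupp.sum_zero_index) rfl).trans ?_
  rw [zero_add, map_sum]
  refine Finset.sum_congr rfl fun k _ => ?_
  rw [Finsupp.sum, Finsupp.sum, map_sum]
  refine Finset.sum_congr rfl fun g _ => ?_
  rw [mk_cast_hom f (inrIdx P₁ P₂ i).2.symm (inrIdx Q₁ Q₂ k).2.symm g _ _ rfl, map_smul, shift_ket]
  simp [inrIdx]

end StMat

end TapeDiagrams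

/-! ### Vectors with arbitrary sources, and block diagonal sums -/

namespace TapeDiagrams

section wide

variable {C : Type u} [Category.{v} C]

/-- The span of the pairs of a position `i` of `P` and an arrow to the letter at `i`. -/
noncomputable def WSpace (P : List C) : Submodule ℝ (Vec C) := ⨆ A, VSpace A P

theorem VSpace_le_WSpace (A : C) (P : List C) : VSpace A P ≤ WSpace P :=
  le_iSup (fun A => VSpace A P) A

/-- Most laws do not depend on the source of the arrows. Passing to `WSpace` removes the source from
the side conditions, which `simp` can then discharge. -/
theorem eqOn_WSpace {W : Type*} [AddCommMonoid W] [Module ℝ W] {P : List C}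
    (f g : Vec C →ₗ[ℝ] W) (h : ∀ A, ∀ v ∈ VSpace A P, f v = g v) {v : Vec C}
    (hv : v ∈ WSpace P) : f v = g v :=
  Submodule.iSup_induction _ (motive := fun v => f v = g v) hv h (by simp) fun x y hx hy => by
    rw [map_add, map_add, hx, hy]

theorem eqOn_WSpace_comp {W W' W'' : Type*} [AddCommMonoid W] [Module ℝ W] [AddCommMonoid W']
    [Module ℝ W'] [AddCommMonoid W''] [Module ℝ W''] {P : List C} (f₂ : W →ₗ[ℝ] W')
    (f₁ : Vec C →ₗ[ℝ] W) (g₂ : W'' →ₗ[ℝ] W') (g₁ : Vec C →ₗ[ℝ] W'')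
    (h : ∀ A, ∀ v ∈ VSpace A P, f₂ (f₁ v) = g₂ (g₁ v)) {v : Vec C} (hv : v ∈ WSpace P) :
    f₂ (f₁ v) = g₂ (g₁ v) :=
  eqOn_WSpace (f₂ ∘ₗ f₁) (g₂ ∘ₗ g₁) h hv

theorem map_WSpace {P Q : List C} (f : Vec C →ₗ[ℝ] Vec C)
    (h : ∀ A, ∀ v ∈ VSpace A P, f v ∈ WSpace Q) {v : Vec C} (hv : v ∈ WSpace P) :
    f v ∈ WSpace Q :=
  Submodule.iSup_induction _ (motive := fun v => f v ∈ WSpace Q) hv h (by simp) fun x y hx hy => by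
    rw [map_add]
    exact add_mem hx hy

theorem units_mem_WSpace {P : List C} {v : Vec C} (h : v ∈ units P) : v ∈ WSpace P := by
  obtain ⟨A, hA⟩ := units_mem h
  exact VSpace_le_WSpace A P hA

theorem inl_mem_WSpace {P : List C} (Q : List C) {v : Vec C} (h : v ∈ WSpace P) :
    v ∈ WSpace (P ++ Q) :=
  map_WSpace LinearMap.id (fun A _ hv => VSpace_le_WSpace A _ (inl_mem Q hv)) h

theorem shift_mem_WSpace (P : List C) {Q : List C} {v : Vec C} (h : v ∈ WSpace Q) :
    shift P.length v ∈ WSpace (P ++ Q) :=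
  map_WSpace _ (fun A _ hv => VSpace_le_WSpace A _ (shift_mem P hv)) h

theorem WSpace_nil {v : Vec C} (h : v ∈ WSpace ([] : List C)) : v = 0 := by
  refine eqOn_WSpace LinearMap.id 0 (fun A v hv => ?_) h
  refine eqOn_VSpace (f := LinearMap.id) (g := 0) (fun x hx => ?_) hv
  exact absurd hx valid_nil

end wide

namespace StMat

section sum

variable {C : Type u} [Category.{v} C]

@[simp] theorem act_mem_WSpace {P Q : List C} (M : Arr P Q) {v : Vec C} (hv : v ∈ WSpace P) :
    act M v ∈ WSpace Q :=
  map_WSpace _ (fun A _ hv => VSpace_le_WSpace A _ (act_mem M hv)) hv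

@[simp] theorem act_ident {P : List C} {v : Vec C} (hv : v ∈ WSpace P) : act (ident P) v = v :=
  eqOn_WSpace (act (ident P)) LinearMap.id (fun _ _ hv => act_id hv) hv

@[simp] theorem act_eqToHom_of_mem {P Q : List C} (h : P = Q) {v : Vec C} (hv : v ∈ WSpace P) :
    act (eqToHom (C := StMat C) h : Arr P Q) v = v :=
  eqOn_WSpace (act _) LinearMap.id (fun _ _ hv => act_eqToHom h hv) hv

@[simp] theorem act_comp_of_mem {P Q R : List C} (M : Arr P Q) (N : Arr Q R) {v : Vec C}
    (hv : v ∈ WSpace P) : act (M ≫ N : Arr P R) v = act N (act M v) :=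
  eqOn_WSpace_comp LinearMap.id (act (M ≫ N : Arr P R)) (act N) (act M)
    (fun _ _ hv => act_comp M N hv) hv

@[simp] theorem act_comp'_of_mem {P Q R : List C} (M : Arr P Q) (N : Arr Q R) {v : Vec C}
    (hv : v ∈ WSpace P) : act (comp M N : Arr P R) v = act N (act M v) :=
  act_comp_of_mem M N hv

@[simp] theorem act_sum_inl_of_mem {P₁ Q₁ P₂ Q₂ : List C} (M : Arr P₁ Q₁) (N : Arr P₂ Q₂)
    {v : Vec C} (hv : v ∈ WSpace P₁) : act (sum M N) v = act M v :=
  eqOn_WSpace (act _) (act M) (fun _ _ hv => act_sum_inl M N hv) hv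

@[simp] theorem act_sum_inr_of_mem {P₁ Q₁ P₂ Q₂ : List C} (M : Arr P₁ Q₁) (N : Arr P₂ Q₂)
    {v : Vec C} (hv : v ∈ WSpace P₂) :
    act (sum M N) (shift P₁.length v) = shift Q₁.length (act N v) :=
  eqOn_WSpace_comp (act _) (shift _) (shift _) (act N) (fun _ _ hv => act_sum_inr M N hv) hv

theorem hom_ext_units {P Q : List C} {M N : Arr P Q}
    (h : ∀ v ∈ units P, v ∈ WSpace P → act M v = act N v) : M = N :=
  hom_ext_act fun v hv => h v hv (units_mem_WSpace hv)

theorem hom_ext_append {P₁ P₂ Q : List C} {M N : Arr (P₁ ++ P₂) Q}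
    (h₁ : ∀ v ∈ units P₁, v ∈ WSpace P₁ → act M v = act N v)
    (h₂ : ∀ v ∈ units P₂, v ∈ WSpace P₂ →
      act M (shift P₁.length v) = act N (shift P₁.length v)) : M = N := by
  refine hom_ext_act fun v hv => ?_
  rcases units_append hv with hv | ⟨w, hw, rfl⟩
  · exact h₁ v hv (units_mem_WSpace hv)
  · exact h₂ w hw (units_mem_WSpace hw)

theorem hom_ext_nil {Q : List C} (M N : Arr [] Q) : M = N :=
  hom_ext_act fun _ hv => absurd hv units_nil

theorem sum_ident (P Q : List C) : sum (ident P) (ident Q) = ident (P ++ Q) :=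
  hom_ext_append (fun v _ hv => by simp [hv, inl_mem_WSpace]) fun v _ hv => by
    simp [hv, shift_mem_WSpace]

theorem sum_comp {P₁ Q₁ R₁ P₂ Q₂ R₂ : List C} (M₁ : Arr P₁ Q₁) (N₁ : Arr Q₁ R₁) (M₂ : Arr P₂ Q₂)
    (N₂ : Arr Q₂ R₂) : sum (M₁ ≫ N₁ : Arr P₁ R₁) (M₂ ≫ N₂ : Arr P₂ R₂) =
      (sum M₁ M₂ ≫ sum N₁ N₂ : Arr _ _) :=
  hom_ext_append (fun v _ hv => by simp [hv, inl_mem_WSpace]) fun v _ hv => by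
    simp [hv, shift_mem_WSpace]

/-- On each of the three blocks both bracketings apply the same matrix, and the shifts agree since
lengths add. -/
theorem sum_assoc {P₁ Q₁ P₂ Q₂ P₃ Q₃ : List C} (M₁ : Arr P₁ Q₁) (M₂ : Arr P₂ Q₂)
    (M₃ : Arr P₃ Q₃) : sum (sum M₁ M₂) M₃ ≍ sum M₁ (sum M₂ M₃) := by
  refine heq_of_act (List.append_assoc _ _ _) (List.append_assoc _ _ _) fun v hv => ?_
  rcases units_append hv with hv | ⟨w, hw, rfl⟩
  · rcases units_append hv with hv | ⟨w, hw, rfl⟩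
    · have hv := units_mem_WSpace hv
      simp [hv, inl_mem_WSpace]
    · have hv := units_mem_WSpace hw
      simp [hv, inl_mem_WSpace, shift_mem_WSpace]
  · have hv := units_mem_WSpace hw
    have e : shift (P₁ ++ P₂).length w = shift P₁.length (shift P₂.length w) := by simp
    rw [act_sum_inr_of_mem _ _ hv, e,
      act_sum_inr_of_mem _ _ (shift_mem_WSpace _ hv), act_sum_inr_of_mem _ _ hv, shift_shift,
      List.length_append]

theorem ident_nil_sum {P Q : List C} (M : Arr P Q) : sum (ident []) M = M := by
  refine hom_ext_units fun v _ hv => ?_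
  have := act_sum_inr_of_mem (ident []) M hv
  simpa using this

theorem sum_ident_nil {P Q : List C} (M : Arr P Q) : sum M (ident []) ≍ M :=
  heq_of_act (List.append_nil P) (List.append_nil Q) fun v hv => by
    rcases units_append hv with hv | ⟨w, hw, rfl⟩
    · rw [act_sum_inl_of_mem _ _ (units_mem_WSpace hv)]
    · exact absurd hw units_nil

theorem act_sumSymm_inl' {A : C} (P Q : List C) {v : Vec C} (hv : v ∈ VSpace A P) :
    act (sumSymm P Q) v = shift Q.length v := by
  refine eqOn_VSpace (fun x hx => ?_) hv
  obtain ⟨i, f, rfl⟩ := exists_of_valid hx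
  have e : (((i : ℕ), ⟨A, P.get i, f⟩) : ℕ × AnyHom C) = (((inlIdx P Q i).1 : ℕ),
      ⟨A, (P ++ Q).get (inlIdx P Q i).1, f ≫ eqToHom (inlIdx P Q i).2.symm⟩) := by
    rw [AnyHom.mk_comp_eqToHom]; rfl
  rw [e, sumSymm, act_permMat, splitAdd_inl, AnyHom.mk_comp_eqToHom, shift_ket]
  rfl

theorem act_sumSymm_inr' {A : C} (P Q : List C) {v : Vec C} (hv : v ∈ VSpace A Q) :
    act (sumSymm P Q) (shift P.length v) = v := by
  refine eqOn_comp _ _ LinearMap.id (fun x hx => ?_) hv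
  obtain ⟨i, f, rfl⟩ := exists_of_valid hx
  have e : ((P.length + (i : ℕ), ⟨A, Q.get i, f⟩) : ℕ × AnyHom C) = (((inrIdx P Q i).1 : ℕ),
      ⟨A, (P ++ Q).get (inrIdx P Q i).1, f ≫ eqToHom (inrIdx P Q i).2.symm⟩) := by
    rw [AnyHom.mk_comp_eqToHom]; rfl
  rw [shift_ket, e, sumSymm, act_permMat, splitAdd_inr, AnyHom.mk_comp_eqToHom]
  rfl

@[simp] theorem act_sumSymm_inl (P Q : List C) {v : Vec C} (hv : v ∈ WSpace P) :
    act (sumSymm P Q) v = shift Q.length v :=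
  eqOn_WSpace (act _) (shift _) (fun _ _ hv => act_sumSymm_inl' P Q hv) hv

@[simp] theorem act_sumSymm_inr (P Q : List C) {v : Vec C} (hv : v ∈ WSpace Q) :
    act (sumSymm P Q) (shift P.length v) = v :=
  eqOn_WSpace_comp (act _) (shift _) LinearMap.id LinearMap.id
    (fun _ _ hv => act_sumSymm_inr' P Q hv) hv

end sum

end StMat

/-! ### The interpretation of tapes as matrices -/

namespace TapeTerm

open StMat

variable {C : Type u} [Category.{v} C]

/-- The interpretation of generators. -/
noncomputable def interpGen : ∀ {P Q : List C}, TapeGen C P Q → StMat.Arr P Q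
  | _, _, .split p U => StMat.split ⟨p.1, p.2.1.le, p.2.2.le⟩ U
  | _, _, .bang U => StMat.bang U
  | _, _, .cobang U => StMat.cobang U
  | _, _, .codiag U => StMat.codiag U
  | _, _, .tape c => StMat.tape c

/-- The interpretation of terms. -/
noncomputable def interp : ∀ {P Q : List C}, TapeTerm C P Q → StMat.Arr P Q
  | _, _, .idZero => ident []
  | _, _, .id A => ident [A]
  | _, _, .symm A B => StMat.sumSymm [A] [B]
  | _, _, .gen s => interpGen s
  | _, _, .comp f g => StMat.comp (interp f) (interp g)
  | _, _, .tensor f g => StMat.sum (interp f) (interp g)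

/-- Casts of terms disappear in the action, so the reassociations in the axioms cost nothing. -/
theorem act_interp_castT {P Q P' Q' : List C} (hP : P = P') (hQ : Q = Q') (t : TapeTerm C P Q) :
    act (interp (Term.castT hP hQ t)) = act (interp t) := by
  subst hP hQ
  rfl

theorem act_interp_comp {P Q R : List C} (f : TapeTerm C P Q) (g : TapeTerm C Q R) {v : Vec C}
    (hv : v ∈ WSpace P) :
    act (interp (Term.comp f g)) v = act (interp g) (act (interp f) v) := by
  rw [interp, act_comp'_of_mem _ _ hv]

theorem act_interp_tensor_inl {P₁ Q₁ P₂ Q₂ : List C} (f : TapeTerm C P₁ Q₁) (g : TapeTerm C P₂ Q₂)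
    {v : Vec C} (hv : v ∈ WSpace P₁) :
    act (interp (Term.tensor f g)) v = act (interp f) v := by
  rw [interp, act_sum_inl_of_mem _ _ hv]

theorem act_interp_tensor_inr {P₁ Q₁ P₂ Q₂ : List C} (f : TapeTerm C P₁ Q₁) (g : TapeTerm C P₂ Q₂)
    {v : Vec C} (hv : v ∈ WSpace P₂) :
    act (interp (Term.tensor f g)) (shift P₁.length v) = shift Q₁.length (act (interp g) v) := by
  rw [interp, act_sum_inr_of_mem _ _ hv]

theorem interp_idW (P : List C) : interp (Term.idW P) = ident P := by
  induction P with
  | nil => rfl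
  | cons A P ih =>
    rw [Term.idW, interp, ih]
    exact sum_ident [A] P

@[simp] theorem act_interp_idW {P : List C} {v : Vec C} (hv : v ∈ WSpace P) :
    act (interp (Term.idW P)) v = v := by
  rw [interp_idW, act_ident hv]

/-- Induction along the recursive definition. For `Q = B ⊕ Q'` a vector over `A`, over `B` or over
`Q'` is followed through the two layers, with its shift regrouped to match the bracketing of each
layer. -/
theorem interp_symmL (A : C) (Q : List C) :
    interp (Term.symmL A Q : TapeTerm C _ _) = sumSymm [A] Q := by
  induction Q with
  | nil =>
    refine hom_ext_units fun v hv hv' => ?_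
    have h : v ∈ WSpace [A] := hv'
    rw [Term.symmL, act_sumSymm_inl _ _ h, interp, act_ident h, List.length_nil, shift_zero]
  | cons B Q ih =>
    rw [Term.symmL]
    refine hom_ext_append (fun v _ hv => ?_) fun v hv _ => ?_
    · have h1 : v ∈ WSpace ([A] ++ [B]) := inl_mem_WSpace _ hv
      have h2 : v ∈ WSpace (([A] ++ [B]) ++ Q) := inl_mem_WSpace _ h1
      rw [act_sumSymm_inl _ _ hv, act_interp_comp _ _ h2, act_interp_tensor_inl _ _ h1, interp,
        act_sumSymm_inl _ _ hv, act_interp_tensor_inr _ _ (inl_mem_WSpace _ hv), ih,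
        act_sumSymm_inl _ _ hv, shift_shift]
      simp [Nat.add_comm]
    · rw [← List.singleton_append] at hv
      rcases units_append hv with hw | ⟨w, hw, rfl⟩
      · replace hv := units_mem_WSpace hw
        have h1 : v ∈ WSpace (B :: Q) := inl_mem_WSpace (P := [B]) Q hv
        have h3 : shift [A].length v ∈ WSpace ([A] ++ [B]) := shift_mem_WSpace _ hv
        rw [act_sumSymm_inr _ _ h1, act_interp_comp _ _ (inl_mem_WSpace Q h3),
          act_interp_tensor_inl _ _ h3, interp, act_sumSymm_inr _ _ hv,
          act_interp_tensor_inl _ _ hv, interp, act_ident hv]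
      · replace hv := units_mem_WSpace hw
        have h1 : shift [B].length w ∈ WSpace (B :: Q) := shift_mem_WSpace [B] hv
        have h3 : shift [A].length (shift [B].length w) = shift ([A] ++ [B]).length w := by simp
        rw [act_sumSymm_inr _ _ h1, h3, act_interp_comp _ _ (shift_mem_WSpace ([A] ++ [B]) hv),
          act_interp_tensor_inr _ _ hv, act_interp_idW hv]
        have h4 : shift ([B] ++ [A]).length w = shift [B].length (shift [A].length w) := by simp
        rw [h4, act_interp_tensor_inr _ _ (shift_mem_WSpace _ hv), ih, act_sumSymm_inr _ _ hv]

/-- The symmetry of words is assembled from symmetries of letters. Once it is known to be the block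
permutation, later proofs use only its effect on the two blocks. -/
theorem interp_symmW (P Q : List C) :
    interp (Term.symmW P Q : TapeTerm C _ _) = sumSymm P Q := by
  induction P with
  | nil =>
    refine hom_ext_units fun v hv hv' => ?_
    have := act_sumSymm_inr [] Q hv'
    rw [List.length_nil, shift_zero] at this
    rw [Term.symmW, act_interp_castT, this]
    exact act_interp_idW hv'
  | cons A P ih =>
    rw [Term.symmW]
    refine hom_ext_append (P₁ := A :: P) (fun v hv h0 => ?_) fun v _ hv => ?_
    · rw [← List.singleton_append] at hv
      rw [act_sumSymm_inl _ _ h0]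
      have h0' : v ∈ WSpace ((A :: P) ++ Q) := inl_mem_WSpace Q h0
      rcases units_append hv with hw | ⟨w, hw, rfl⟩
      · replace hv := units_mem_WSpace hw
        rw [act_interp_comp _ _ h0', act_interp_tensor_inl _ _ hv, act_interp_castT, interp,
          act_ident hv, act_interp_tensor_inl _ _ (inl_mem_WSpace Q hv), interp_symmL,
          act_sumSymm_inl _ _ hv]
      · replace hv := units_mem_WSpace hw
        rw [act_interp_comp _ _ h0', act_interp_tensor_inr _ _ (inl_mem_WSpace Q hv),
          act_interp_castT, ih, act_sumSymm_inl _ _ hv, shift_shift, ← List.length_append,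
          act_interp_tensor_inr _ _ hv, act_interp_idW hv]
        simp
    · rw [act_sumSymm_inr _ _ hv, act_interp_comp _ _ (shift_mem_WSpace (A :: P) hv)]
      have e : shift (A :: P).length v = shift [A].length (shift P.length v) := by
        simp [Nat.add_comm]
      rw [e, act_interp_tensor_inr _ _ (shift_mem_WSpace P hv), ih, act_sumSymm_inr _ _ hv,
        act_interp_castT, act_interp_tensor_inl _ _ (shift_mem_WSpace _ hv), interp_symmL,
        act_sumSymm_inr _ _ hv]

@[simp] theorem act_interp_symmW_inl (P Q : List C) {v : Vec C} (hv : v ∈ WSpace P) :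
    act (interp (Term.symmW P Q)) v = shift Q.length v := by
  rw [interp_symmW, act_sumSymm_inl _ _ hv]

@[simp] theorem act_interp_symmW_inr (P Q : List C) {v : Vec C} (hv : v ∈ WSpace Q) :
    act (interp (Term.symmW P Q)) (shift P.length v) = v := by
  rw [interp_symmW, act_sumSymm_inr _ _ hv]

/-! #### The generators -/

theorem eqOn_single {W : Type*} [AddCommMonoid W] [Module ℝ W] {U : C} (f g : Vec C →ₗ[ℝ] W)
    (h : ∀ {A : C} (c : A ⟶ U), f (ket (0, ⟨A, U, c⟩)) = g (ket (0, ⟨A, U, c⟩))) {v : Vec C}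
    (hv : v ∈ WSpace [U]) : f v = g v := by
  refine eqOn_WSpace f g (fun A v hv => ?_) hv
  refine eqOn_VSpace (fun x hx => ?_) hv
  obtain ⟨i, c, rfl⟩ := exists_of_valid hx
  obtain rfl : i = ⟨0, Nat.one_pos⟩ := Subsingleton.elim (α := Fin 1) _ _
  exact h c

theorem act_split (p : unitInterval) (U : C) {v : Vec C} (hv : v ∈ WSpace [U]) :
    act (StMat.split p U) v = (p : ℝ) • v + (1 - p : ℝ) • shift 1 v := by
  refine eqOn_single _ ((p : ℝ) • LinearMap.id + (1 - p : ℝ) • shift 1) (fun {A} c => ?_) hv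
  refine (act_ket (StMat.split p U) ⟨0, Nat.one_pos⟩ c).trans ?_
  have h : ∀ j : Fin 2, (Hom.entry (StMat.split p U) ⟨0, Nat.one_pos⟩ j).val =
      Finsupp.single (eqToHom (by fin_cases j <;> rfl)) (if j = 0 then (p : ℝ) else 1 - p) := by
    intro j
    fin_cases j
    · exact (Finsupp.smul_single _ _ _).trans (by simp)
    · exact (Finsupp.smul_single _ _ _).trans (by simp)
  refine (Fin.sum_univ_two (f := fun j : Fin 2 => ((Hom.entry (StMat.split p U)
    ⟨0, Nat.one_pos⟩ j).val.sum fun g a =>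
      Finsupp.single ((j : ℕ), (⟨A, [U, U].get j, c ≫ g⟩ : AnyHom C)) a))).trans ?_
  rw [h, h, Finsupp.sum_single_index (by simp), Finsupp.sum_single_index (by simp)]
  simp

theorem act_bang (U : C) (v : Vec C) : act (StMat.bang U) v = 0 := by
  have : act (StMat.bang U) = 0 := by
    refine linearMap_ext fun x => ?_
    rw [act, Finsupp.linearCombination_single, actKet]
    simp
  rw [this]; rfl

theorem act_codiag_inl (U : C) {v : Vec C} (hv : v ∈ WSpace [U]) :
    act (StMat.codiag U) v = v := by
  refine eqOn_single _ LinearMap.id (fun {A} c => ?_) hv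
  exact act_permMat (P := [U, U]) (Q := [U]) _ ⟨0, Nat.two_pos⟩ c

theorem act_codiag_inr (U : C) {v : Vec C} (hv : v ∈ WSpace [U]) :
    act (StMat.codiag U) (shift 1 v) = v := by
  have := eqOn_single (act (StMat.codiag U) ∘ₗ shift 1) LinearMap.id (fun {A} c => ?_) hv
  · exact this
  rw [LinearMap.comp_apply, shift_ket]
  exact act_permMat (P := [U, U]) (Q := [U]) _ ⟨1, Nat.one_lt_two⟩ c

theorem act_tape {U V : C} (c : U ⟶ V) {A : C} (f : A ⟶ U) :
    act (StMat.tape c) (ket (0, ⟨A, U, f⟩)) = ket (0, ⟨A, V, f ≫ c⟩) := by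
  refine (act_monomial (P := [U]) (Q := [V]) _ _ ⟨0, Nat.one_pos⟩ f).trans ?_
  simp

end TapeTerm

end TapeDiagrams

/-! ### Soundness of the interpretation -/

namespace TapeDiagrams

variable {C : Type u} [Category.{v} C]

theorem eqOn_WSpace_append {W : Type*} [AddCommMonoid W] [Module ℝ W] {P Q : List C}
    (f g : Vec C →ₗ[ℝ] W) (h₁ : ∀ v ∈ WSpace P, f v = g v)
    (h₂ : ∀ v ∈ WSpace Q, f (shift P.length v) = g (shift P.length v)) {v : Vec C}
    (hv : v ∈ WSpace (P ++ Q)) : f v = g v := by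
  refine eqOn_WSpace f g (fun A v hv => ?_) hv
  refine eqOn_VSpace (fun x hx => ?_) hv
  rcases valid_append_iff.1 hx with hx | ⟨hl, hx⟩
  · exact h₁ _ (VSpace_le_WSpace _ _ (ket_mem hx))
  · have := h₂ _ (VSpace_le_WSpace _ _ (ket_mem hx))
    rwa [shift_ket, Nat.add_sub_cancel' hl] at this

-- An alternative to `eqOn_WSpace_append` for goals with nested applications, which do not unify
-- with two linear maps. No closure under scalars is required, since the two block hypotheses
-- already cover all multiples.
@[elab_as_elim]
theorem WSpace_append_induction {P Q : List C} {motive : Vec C → Prop} {v : Vec C}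
    (hv : v ∈ WSpace (P ++ Q)) (add : ∀ a b, motive a → motive b → motive (a + b))
    (h₁ : ∀ v ∈ WSpace P, motive v) (h₂ : ∀ v ∈ WSpace Q, motive (shift P.length v)) :
    motive v := by
  have h0 : motive 0 := h₁ 0 (zero_mem _)
  refine Submodule.iSup_induction _ (motive := motive) hv (fun A v hv => ?_) h0 add
  -- The predicate is strengthened to all multiples so that the scalar case of the span is
  -- immediate. The claim is the case of the scalar one.
  refine Submodule.span_induction (p := fun v _ => ∀ c : ℝ, motive (c • v)) ?_ ?_ ?_ ?_ hv 1 |>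
    fun h => by simpa using h
  · rintro _ ⟨x, hx, rfl⟩ c
    rcases valid_append_iff.1 hx with hx | ⟨hl, hx⟩
    · exact h₁ _ (Submodule.smul_mem _ _ (VSpace_le_WSpace _ _ (ket_mem hx)))
    · have := h₂ _ (Submodule.smul_mem _ c (VSpace_le_WSpace _ _ (ket_mem hx)))
      rwa [map_smul, shift_ket, Nat.add_sub_cancel' hl] at this
  · intro c; rwa [smul_zero]
  · intro x y _ _ hx hy c
    rw [smul_add]
    exact add _ _ (hx c) (hy c)
  · intro a x _ hx c
    rw [smul_smul]
    exact hx _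

namespace TapeTerm

open StMat

theorem act_interp_bang (P : List C) {v : Vec C} (hv : v ∈ WSpace P) :
    act (interp (bang P)) v = 0 :=
  WSpace_nil (act_mem_WSpace _ hv)

theorem act_interp_split (p : OpenUnit) (P : List C) {v : Vec C} (hv : v ∈ WSpace P) :
    act (interp (split p P)) v = (p.1 : ℝ) • v + (1 - p.1 : ℝ) • shift P.length v := by
  induction P generalizing v with
  | nil =>
    obtain rfl := WSpace_nil hv
    simp
  | cons U P ih =>
    refine eqOn_WSpace_append (P := [U]) (Q := P) _
      (p.1 • LinearMap.id + (1 - p.1) • shift (U :: P).length) (fun v hv => ?_) (fun v hv => ?_) hv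
    · have h0 : v ∈ WSpace (U :: P) := inl_mem_WSpace (P := [U]) P hv
      have h1 : v ∈ WSpace ([U] ++ P) := inl_mem_WSpace (P := [U]) P hv
      rw [split, act_interp_comp _ _ h0, act_interp_tensor_inl _ _ hv, act_interp_castT, interp,
        interpGen, act_split _ _ hv, map_add, map_smul, map_smul, act_interp_tensor_inl _ _ hv]
      have e := act_interp_tensor_inr (Term.id U : TapeTerm C _ _)
        (Term.tensor (Term.symmW [U] P) (Term.idW P)) (inl_mem_WSpace P h1)
      rw [act_interp_tensor_inl _ _ h1, act_interp_symmW_inl _ _ hv] at e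
      refine congrArg₂ (fun a b => p.1 • a + (1 - p.1) • b) ?_ (e.trans ?_)
      · exact act_ident hv
      · simp [Nat.add_comm]
    · have h0 : shift [U].length v ∈ WSpace (U :: P) := shift_mem_WSpace [U] hv
      rw [split, act_interp_comp _ _ h0, act_interp_tensor_inr _ _ hv, act_interp_castT, ih hv,
        map_add, map_smul, map_smul, map_add, map_smul, map_smul]
      -- The intermediate word is `U U P P`, and the middle symmetry turns it into `U P U P`. The
      -- shifts are regrouped to display the block that contains each summand.
      have e1 : shift [U, U].length v = shift [U].length (shift [U].length v) := by simp
      have e2 : shift [U, U].length (shift P.length v) =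
        shift [U].length (shift ([U] ++ P).length v) := by simp; congr 2; omega
      have h1 : shift [U].length v ∈ WSpace ([U] ++ P) := shift_mem_WSpace _ hv
      rw [e1, e2, act_interp_tensor_inr _ _ (inl_mem_WSpace P h1),
        act_interp_tensor_inr _ _ (shift_mem_WSpace _ hv),
        act_interp_tensor_inr _ _ hv, act_interp_tensor_inl _ _ h1, act_interp_symmW_inr _ _ hv,
        act_interp_idW hv]
      refine congrArg₂ (fun a b => p.1 • a + (1 - p.1) • b) rfl ?_
      simp only [shift_shift, List.length_append, List.length_cons]
      congr 2
      simp only [List.length_nil]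
      omega

theorem act_interp_codiag (P : List C) {v : Vec C} (hv : v ∈ WSpace P) :
    act (interp (codiag P)) v = v ∧ act (interp (codiag P)) (shift P.length v) = v := by
  induction P generalizing v with
  | nil =>
    obtain rfl := WSpace_nil hv
    simp
  | cons U P ih =>
    have key : ∀ v ∈ WSpace P, shift [U].length v ∈ WSpace ([U] ++ P) :=
      fun v hv => shift_mem_WSpace _ hv
    constructor
    · refine eqOn_WSpace_append (P := [U]) (Q := P) _ LinearMap.id (fun v hv => ?_)
        (fun v hv => ?_) hv
      · have h1 : v ∈ WSpace ([U] ++ P) := inl_mem_WSpace P hv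
        have h0 : v ∈ WSpace (U :: P ++ U :: P) := inl_mem_WSpace (P := U :: P) _ h1
        rw [codiag, act_interp_comp _ _ h0, act_interp_castT, act_interp_tensor_inl _ _ hv, interp,
          act_ident hv, act_interp_tensor_inl _ _ (inl_mem_WSpace (P := [U]) [U] hv), interp,
          interpGen, act_codiag_inl _ hv]; rfl
      · have h0 : shift [U].length v ∈ WSpace (U :: P ++ U :: P) :=
          inl_mem_WSpace (P := U :: P) _ (key v hv)
        rw [codiag, act_interp_comp _ _ h0, act_interp_castT, act_interp_tensor_inr _ _
          (inl_mem_WSpace P (inl_mem_WSpace [U] hv)),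
          act_interp_tensor_inl _ _ (inl_mem_WSpace [U] hv), act_interp_symmW_inl _ _ hv]
        have e : shift [U].length (shift [U].length v) = shift [U, U].length v := by simp
        rw [e, act_interp_tensor_inr _ _ (inl_mem_WSpace P hv), (ih hv).1]; rfl
    · refine WSpace_append_induction (P := [U]) (Q := P) hv (fun a b ha hb => by simp only [map_add, ha, hb])
        (fun v hv => ?_) (fun v hv => ?_)
      · have h1 : v ∈ WSpace ([U] ++ P) := inl_mem_WSpace P hv
        have h0 : shift (U :: P).length v ∈ WSpace (U :: P ++ U :: P) :=
          shift_mem_WSpace (U :: P) h1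
        have e : shift (U :: P).length v = shift [U].length (shift P.length v) := by
          simp [Nat.add_comm]
        rw [codiag, act_interp_comp _ _ h0, act_interp_castT, e,
          act_interp_tensor_inr _ _ (inl_mem_WSpace P (shift_mem_WSpace P hv)),
          act_interp_tensor_inl _ _ (shift_mem_WSpace P hv), act_interp_symmW_inr _ _ hv,
          act_interp_tensor_inl _ _ (shift_mem_WSpace [U] hv), interp,
          interpGen]
        exact act_codiag_inr _ hv
      · have h0 : shift (U :: P).length (shift [U].length v) ∈ WSpace (U :: P ++ U :: P) :=
          shift_mem_WSpace (U :: P) (key v hv)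
        have e : shift (U :: P).length (shift [U].length v) =
          shift [U].length (shift (P ++ [U]).length v) := by simp; congr 2; omega
        have e' : shift [U].length (shift ([U] ++ P).length v) =
          shift [U, U].length (shift P.length v) := by simp; congr 2; omega
        rw [codiag, act_interp_comp _ _ h0, act_interp_castT, e,
          act_interp_tensor_inr _ _ (shift_mem_WSpace (P ++ [U]) hv),
          act_interp_tensor_inr _ _ hv, act_interp_idW hv, e',
          act_interp_tensor_inr _ _ (shift_mem_WSpace P hv), (ih hv).2]

theorem act_interp_codiag_inl (P : List C) {v : Vec C} (hv : v ∈ WSpace P) :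
    act (interp (codiag P)) v = v := (act_interp_codiag P hv).1

theorem act_interp_codiag_inr (P : List C) {v : Vec C} (hv : v ∈ WSpace P) :
    act (interp (codiag P)) (shift P.length v) = v := (act_interp_codiag P hv).2

theorem heq_of_act_of_mem {P Q P' Q' : List C} (hP : P = P') (hQ : Q = Q') {M : StMat.Arr P Q}
    {N : StMat.Arr P' Q'} (h : ∀ v ∈ WSpace P, act M v = act N v) : M ≍ N :=
  heq_of_act hP hQ fun v hv => h v (units_mem_WSpace hv)

/-- Both sides are compared on vectors, block by block. `codiag` merges two copies of a word,
`split` sends `v` to `p v` in the first copy and `(1 - p) v` in the second, and anything through the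
empty word is zero. Naturality is then linearity of the action, and the pca axioms are identities of
coefficients. -/
theorem interp_ax {P Q : List C} {f g : TapeTerm C P Q} (h : TapeAx C f g) :
    interp f = interp g := by
  refine eq_of_heq (heq_of_act_of_mem rfl rfl fun v hv => ?_)
  induction h with
  | codiag_assoc P =>
    rw [act_interp_castT]
    have e : ∀ v ∈ WSpace P, shift P.length (shift P.length v) = shift (P ++ P).length v := by simp
    have hP : ∀ v ∈ WSpace P, v ∈ WSpace (P ++ P) := fun v hv => inl_mem_WSpace P hv
    have hP' : ∀ v ∈ WSpace P, shift P.length v ∈ WSpace (P ++ P) :=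
      fun v hv => shift_mem_WSpace P hv
    refine eqOn_WSpace_append _ _ (fun v hv => ?_) (fun v hv => ?_) hv
    · rw [act_interp_comp _ _ (inl_mem_WSpace _ hv), act_interp_comp _ _
        (inl_mem_WSpace _ (hP v hv)), act_interp_tensor_inl _ _ hv, act_interp_idW hv,
        act_interp_tensor_inl _ _ (hP v hv), act_interp_codiag_inl _ hv, act_interp_codiag_inl _ hv]
    · rw [act_interp_comp _ _ (shift_mem_WSpace _ hv), act_interp_tensor_inr _ _ hv]
      refine WSpace_append_induction hv (fun a b ha hb => by simp only [map_add, ha, hb])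
        (fun v hv => ?_) (fun v hv => ?_)
      · rw [act_interp_comp _ _ (inl_mem_WSpace _ (hP' v hv)), act_interp_codiag_inl _ hv,
          act_interp_codiag_inr _ hv, act_interp_tensor_inl _ _ (hP' v hv),
          act_interp_codiag_inr _ hv, act_interp_codiag_inl _ hv]
      · rw [e v hv, act_interp_comp _ _ (shift_mem_WSpace (P ++ P) hv),
          act_interp_codiag_inr _ hv,
          act_interp_codiag_inr _ hv, act_interp_tensor_inr _ _ hv,
          act_interp_idW hv, act_interp_codiag_inr _ hv]
  | codiag_unit P =>
    have e := act_interp_tensor_inr (cobang P) (Term.idW P) hv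
    rw [List.length_nil, shift_zero, act_interp_idW (P := P) hv] at e
    rw [act_interp_comp _ _ hv, e, act_interp_codiag_inr P hv]
    exact (act_interp_idW (P := P) hv).symm
  | codiag_symm P =>
    refine eqOn_WSpace_append _ _ (fun v hv => ?_) (fun v hv => ?_) hv
    · rw [act_interp_comp _ _ (inl_mem_WSpace _ hv), act_interp_symmW_inl _ _ hv,
        act_interp_codiag_inl _ hv, act_interp_codiag_inr _ hv]
    · rw [act_interp_comp _ _ (shift_mem_WSpace _ hv), act_interp_symmW_inr _ _ hv,
        act_interp_codiag_inl _ hv, act_interp_codiag_inr _ hv]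
  | cobang_zero => rfl
  | codiag_zero => rfl
  | cobang_sum P Q => obtain rfl := WSpace_nil hv; simp
  | codiag_sum P Q =>
    -- There are four blocks `P Q P Q`, of which the middle two are exchanged. Shifts are split and
    -- recombined to follow the bracketing on each side.
    have e : ∀ v : Vec C, shift (P ++ Q).length v = shift P.length (shift Q.length v) := by simp
    have e' : ∀ v : Vec C, shift (P ++ P).length v = shift P.length (shift P.length v) := by simp
    refine eqOn_WSpace_append (P := P ++ Q) _ _ (fun v hv => ?_) (fun v hv => ?_) hv
    · rw [act_interp_codiag_inl _ hv, act_interp_comp _ _ (inl_mem_WSpace (P ++ Q) hv),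
        act_interp_castT]
      symm
      refine WSpace_append_induction hv (fun a b ha hb => by simp only [map_add, ha, hb])
        (fun v hv => ?_) (fun v hv => ?_)
      · rw [act_interp_tensor_inl _ _ hv, act_interp_idW hv,
          act_interp_tensor_inl _ _ (inl_mem_WSpace P hv), act_interp_codiag_inl _ hv]
      · rw [act_interp_tensor_inr _ _
          (inl_mem_WSpace Q (inl_mem_WSpace P hv)),
          act_interp_tensor_inl _ _ (inl_mem_WSpace P hv), act_interp_symmW_inl _ _ hv,
          ← e', act_interp_tensor_inr _ _ (inl_mem_WSpace Q hv), act_interp_codiag_inl _ hv]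
    · rw [act_interp_codiag_inr _ hv, act_interp_comp _ _ (shift_mem_WSpace (P ++ Q) hv),
        act_interp_castT, e]
      symm
      refine WSpace_append_induction hv (fun a b ha hb => by simp only [map_add, ha, hb])
        (fun v hv => ?_) (fun v hv => ?_)
      · rw [act_interp_tensor_inr _ _
          (inl_mem_WSpace Q (shift_mem_WSpace Q hv)),
          act_interp_tensor_inl _ _ (shift_mem_WSpace Q hv), act_interp_symmW_inr _ _ hv,
          act_interp_tensor_inl _ _ (shift_mem_WSpace P hv), act_interp_codiag_inr _ hv]
      · have e2 : ∀ v : Vec C, shift P.length (shift Q.length (shift P.length v)) =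
          shift P.length (shift (Q ++ P).length v) := by simp
        have e3 : ∀ v : Vec C, shift P.length (shift (P ++ Q).length v) =
          shift (P ++ P).length (shift Q.length v) := by simp [Nat.add_assoc]
        rw [e2, act_interp_tensor_inr _ _ (shift_mem_WSpace (Q ++ P) hv),
          act_interp_tensor_inr _ _ hv, act_interp_idW hv, e3,
          act_interp_tensor_inr _ _ (shift_mem_WSpace Q hv), act_interp_codiag_inr _ hv]
  | cobang_nat f => obtain rfl := WSpace_nil hv; simp
  | @codiag_nat P Q f =>
    refine eqOn_WSpace_append _ _ (fun v hv => ?_) (fun v hv => ?_) hv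
    · rw [act_interp_comp _ _ (inl_mem_WSpace _ hv), act_interp_comp _ _ (inl_mem_WSpace _ hv),
        act_interp_codiag_inl _ hv, act_interp_tensor_inl _ _ hv,
        act_interp_codiag_inl _ (act_mem_WSpace _ hv)]
    · rw [act_interp_comp _ _ (shift_mem_WSpace _ hv), act_interp_comp _ _ (shift_mem_WSpace _ hv),
        act_interp_codiag_inr _ hv, act_interp_tensor_inr _ _ hv,
        act_interp_codiag_inr _ (act_mem_WSpace _ hv)]
  | split_assoc p q P =>
    have e : shift (P ++ P).length v = shift P.length (shift P.length v) := by simp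
    rw [act_interp_comp _ _ hv, act_interp_comp _ _ hv, act_interp_split _ _ hv,
      act_interp_split _ _ hv, map_add, map_add, map_smul, map_smul, map_smul, map_smul,
      act_interp_castT, act_interp_tensor_inl _ _ hv, act_interp_tensor_inl _ _ hv,
      act_interp_tensor_inr _ _ hv, act_interp_tensor_inr _ _ hv, act_interp_split _ _ hv,
      act_interp_split _ _ hv, act_interp_idW hv, e, map_add, map_smul, map_smul]
    -- The three copies carry weights `p q`, `p (1 - q)` and `1 - p` on the left. On the right the
    -- last two are `(1 - p q) q̃` and `(1 - p q) (1 - q̃)`, so the definition of `q̃` has to be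
    -- cleared of its denominator.
    have h : 1 - p.1 * q.1 ≠ 0 := by
      have := (p.assocFst q).2.2
      simp only [OpenUnit.assocFst] at this
      linarith
    have h1 : (1 - p.1 * q.1) * ((p.1 - p.1 * q.1) / (1 - p.1 * q.1)) = p.1 - p.1 * q.1 := by
      field_simp
    simp only [OpenUnit.assocFst, OpenUnit.assocSnd, smul_add, smul_smul, mul_sub, mul_one]
    rw [add_assoc]
    rw [h1]
    congr 3
    ring
  | split_idem p P =>
    rw [act_interp_comp _ _ hv, act_interp_split _ _ hv, map_add, map_smul, map_smul,
      act_interp_codiag_inl _ hv, act_interp_codiag_inr _ hv, ← add_smul, act_interp_idW hv]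
    simp
  | split_symm p P =>
    rw [act_interp_comp _ _ hv, act_interp_split _ _ hv, act_interp_split _ _ hv, map_add,
      map_smul, map_smul, act_interp_symmW_inl _ _ hv, act_interp_symmW_inr _ _ hv, add_comm]
    simp [OpenUnit.compl]
  | split_zero p => rfl
  | bang_zero => rfl
  | bang_sum P Q => exact (act_interp_bang _ hv).trans (WSpace_nil (act_mem_WSpace _ hv)).symm
  | split_sum p P Q =>
    rw [act_interp_split _ _ hv]
    symm
    refine eqOn_WSpace_append _ (p.1 • LinearMap.id + (1 - p.1) • shift _)
      (fun v hv => ?_) (fun v hv => ?_) hv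
    · rw [act_interp_comp _ _ (inl_mem_WSpace _ hv), act_interp_tensor_inl _ _ hv,
        act_interp_castT, act_interp_split _ _ hv, map_add, map_smul, map_smul,
        act_interp_tensor_inl _ _ hv, act_interp_idW hv, act_interp_tensor_inr _ _
        (inl_mem_WSpace Q (inl_mem_WSpace Q hv)), act_interp_tensor_inl _ _ (inl_mem_WSpace Q hv),
        act_interp_symmW_inl _ _ hv]
      simp
    · have e1 : shift (P ++ P).length v = shift P.length (shift P.length v) := by simp
      have e2 : shift (P ++ P).length (shift Q.length v) =
        shift P.length (shift (P ++ Q).length v) := by simp [Nat.add_assoc]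
      rw [act_interp_comp _ _ (shift_mem_WSpace _ hv), act_interp_tensor_inr _ _ hv,
        act_interp_castT, act_interp_split _ _ hv, map_add, map_smul, map_smul, map_add, map_smul,
        map_smul, e1, e2, act_interp_tensor_inr _ _ (inl_mem_WSpace Q (shift_mem_WSpace P hv)),
        act_interp_tensor_inl _ _ (shift_mem_WSpace P hv), act_interp_symmW_inr _ _ hv,
        act_interp_tensor_inr _ _ (shift_mem_WSpace (P ++ Q) hv), act_interp_tensor_inr _ _ hv,
        act_interp_idW hv]
      simp only [LinearMap.add_apply, LinearMap.smul_apply, LinearMap.id_apply, shift_shift,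
        List.length_append]
      congr 3
      congr 1
      omega
  | bang_nat f => exact (WSpace_nil (act_mem_WSpace _ hv)).trans (act_interp_bang _ hv).symm
  | split_nat p f =>
    rw [act_interp_comp _ _ hv, act_interp_comp _ _ hv, act_interp_split _ _ hv,
      act_interp_split _ _ (act_mem_WSpace _ hv), map_add, map_smul, map_smul,
      act_interp_tensor_inl _ _ hv, act_interp_tensor_inr _ _ hv]
  | tape_id U =>
    rw [act_interp_idW hv]
    refine eqOn_single _ LinearMap.id (fun {A} c => ?_) hv
    rw [interp, interpGen, act_tape]
    simp
  | tape_comp c d =>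
    rw [act_interp_comp _ _ hv]
    have := eqOn_single (act (interp (.gen (.tape (c ≫ d)))))
      (act (interp (.gen (.tape d))) ∘ₗ act (interp (.gen (.tape c)))) (fun {A} c => ?_) hv
    · exact this
    rw [LinearMap.comp_apply]
    refine (act_tape _ _).trans ?_
    refine Eq.trans ?_ (congrArg (act (interp (.gen (.tape d)))) (act_tape _ _).symm)
    refine Eq.trans ?_ (act_tape _ _).symm
    rw [Category.assoc]

/-- Soundness of the interpretation. -/
theorem interp_eqv {P Q P' Q' : List C} {f : TapeTerm C P Q} {g : TapeTerm C P' Q'}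
    (h : Term.Eqv (TapeAx C) f g) : interp f ≍ interp g := by
  induction h with
  | ax h => exact heq_of_eq (interp_ax h)
  | refl f => rfl
  | symm _ ih => exact ih.symm
  | trans _ _ ih₁ ih₂ => exact ih₁.trans ih₂
  | comp h₁ h₂ ih₁ ih₂ =>
    -- Related terms have equal types, so the heterogeneous hypotheses become equations that can be
    -- rewritten.
    obtain ⟨rfl, rfl⟩ := h₁.type_eq
    obtain ⟨-, rfl⟩ := h₂.type_eq
    rw [interp, interp, eq_of_heq ih₁, eq_of_heq ih₂]
  | tensor h₁ h₂ ih₁ ih₂ =>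
    obtain ⟨rfl, rfl⟩ := h₁.type_eq
    obtain ⟨rfl, rfl⟩ := h₂.type_eq
    rw [interp, interp, eq_of_heq ih₁, eq_of_heq ih₂]
  | comp_assoc f g h => exact heq_of_eq (StMat.assoc _ _ _)
  | id_comp f => rw [interp, interp_idW]; exact heq_of_eq (StMat.id_comp _)
  | comp_id f => rw [interp, interp_idW]; exact heq_of_eq (StMat.comp_id _)
  | interchange f₁ g₁ f₂ g₂ => exact heq_of_eq (StMat.sum_comp _ _ _ _).symm
  | idZero_tensor f => exact heq_of_eq (ident_nil_sum _)
  | tensor_idZero f => exact sum_ident_nil _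
  | tensor_assoc f g h => exact sum_assoc _ _ _
  | symm_symm P Q =>
    refine heq_of_act_of_mem rfl rfl fun v hv => ?_
    rw [act_interp_comp _ _ hv, act_interp_idW hv]
    refine WSpace_append_induction hv (fun a b ha hb => by simp only [map_add, ha, hb])
      (fun v hv => ?_) (fun v hv => ?_)
    · rw [act_interp_symmW_inl _ _ hv, act_interp_symmW_inr _ _ hv]
    · rw [act_interp_symmW_inr _ _ hv, act_interp_symmW_inl _ _ hv]
  | symm_nat s R =>
    refine heq_of_act_of_mem rfl rfl fun v hv => ?_
    refine eqOn_WSpace_append _ _ (fun v hv => ?_) (fun v hv => ?_) hv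
    · rw [act_interp_comp _ _ (inl_mem_WSpace _ hv), act_interp_comp _ _ (inl_mem_WSpace _ hv),
        act_interp_tensor_inl _ _ hv, act_interp_symmW_inl _ _ hv,
        act_interp_symmW_inl _ _ (act_mem_WSpace _ hv), act_interp_tensor_inr _ _ hv]
    · rw [act_interp_comp _ _ (shift_mem_WSpace _ hv), act_interp_comp _ _ (shift_mem_WSpace _ hv),
        act_interp_tensor_inr _ _ hv, act_interp_symmW_inr _ _ hv, act_interp_idW hv,
        act_interp_symmW_inr _ _ hv, act_interp_tensor_inl _ _ hv, act_interp_idW hv]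

end TapeTerm

/-- The interpretation functor. -/
noncomputable def interpFunctor (C : Type u) [Category.{v} C] : TapeCat C ⥤ StMat C where
  obj P := P
  map {P Q} t := Quot.lift (fun s : TapeTerm C P Q => TapeTerm.interp s)
    (fun _ _ h => eq_of_heq (TapeTerm.interp_eqv h)) t
  map_id P := TapeTerm.interp_idW P
  map_comp {P Q R} f g := by
    induction f using Quot.ind
    induction g using Quot.ind
    rfl

end TapeDiagrams

namespace TapeDiagrams

/-! ### Convex algebras and their cones -/

/-- A convex algebra: binary convex combinations with open parameters. -/
class ConvexAlgebra (A : Type w) where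
  /-- the convex combination `p a + (1 - p) b` -/
  op : OpenUnit → A → A → A
  op_idem : ∀ p a, op p a a = a
  op_symm : ∀ p a b, op p a b = op p.compl b a
  op_assoc : ∀ p q a b c,
    op p (op q a b) c = op (p.assocFst q) a (op (p.assocSnd q) b c)

/-- The cone over a convex algebra: formal positive multiples of its elements, and zero. -/
inductive Cone (A : Type w) : Type w
  | zero : Cone A
  | mk (s : ℝ) (hs : 0 < s) (a : A) : Cone A

namespace Cone

variable {A : Type w} {B : Type w'} [ConvexAlgebra A] [ConvexAlgebra B]

/-- The ratio `s / (s + t)`. -/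
noncomputable def ratio (s t : ℝ) (hs : 0 < s) (ht : 0 < t) : OpenUnit :=
  ⟨s / (s + t), div_pos hs (add_pos hs ht), (div_lt_one (add_pos hs ht)).2 (by linarith)⟩

/-- The sum in the cone. -/
noncomputable def add : Cone A → Cone A → Cone A
  | zero, y => y
  | x, zero => x
  | mk s hs a, mk t ht b => mk (s + t) (add_pos hs ht) (ConvexAlgebra.op (ratio s t hs ht) a b)

/-- Multiplication by a nonnegative scalar. -/
noncomputable def smul (r : NNReal) : Cone A → Cone A
  | zero => zero
  | mk s hs a => open Classical in if h : 0 < r then mk (r * s) (mul_pos h hs) a else zero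

noncomputable instance : Add (Cone A) := ⟨add⟩

instance : Zero (Cone A) := ⟨zero⟩

noncomputable instance : SMul NNReal (Cone A) := ⟨smul⟩

theorem mk_congr {s t : ℝ} {hs : 0 < s} {ht : 0 < t} {a b : A} (h : s = t) (h' : a = b) :
    mk s hs a = mk t ht b := by
  subst h h'
  rfl

theorem mk_add_mk {s t : ℝ} (hs : 0 < s) (ht : 0 < t) (a b : A) :
    mk s hs a + mk t ht b =
      mk (s + t) (add_pos hs ht) (ConvexAlgebra.op (ratio s t hs ht) a b) := rfl

theorem zero_add' (x : Cone A) : 0 + x = x := by cases x <;> rfl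

theorem add_zero' (x : Cone A) : x + 0 = x := by cases x <;> rfl

theorem add_comm' (x y : Cone A) : x + y = y + x := by
  cases x with
  | zero => exact (zero_add' y).trans (add_zero' y).symm
  | mk s hs a =>
    cases y with
    | zero => rfl
    | mk t ht b =>
      rw [mk_add_mk, mk_add_mk]
      refine mk_congr (add_comm _ _) ?_
      rw [ConvexAlgebra.op_symm]
      congr 1
      refine Subtype.ext ?_
      simp only [ratio, OpenUnit.compl]
      field_simp
      ring

/-- For weights `s`, `t`, `r` this is `op_assoc` with `p = (s + t) / (s + t + r)` and `q = s / (s +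
t)`. Then `p̃ = s / (s + t + r)` and `q̃ = t / (t + r)`, which are the ratios of the other
bracketing. -/
theorem add_assoc' (x y z : Cone A) : x + y + z = x + (y + z) := by
  cases x with
  | zero => exact congrArg (· + z) (zero_add' y) |>.trans (zero_add' _).symm
  | mk s hs a =>
    cases y with
    | zero => exact congrArg (mk s hs a + ·) (zero_add' z).symm
    | mk t ht b =>
      cases z with
      | zero => rfl
      | mk r hr c =>
        simp only [mk_add_mk]
        refine mk_congr (add_assoc _ _ _) ?_
        rw [ConvexAlgebra.op_assoc]
        have h : s + t ≠ 0 := (add_pos hs ht).ne'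
        have h1 : s + t + r ≠ 0 := (add_pos (add_pos hs ht) hr).ne'
        have h2 : t + r ≠ 0 := (add_pos ht hr).ne'
        have h3 : s + (t + r) ≠ 0 := by rwa [← add_assoc]
        have e1 : (s + t) / (s + t + r) * (s / (s + t)) = s / (s + (t + r)) := by
          rw [← add_assoc]
          field_simp
        congr 1
        · exact Subtype.ext e1
        · congr 1
          refine Subtype.ext ?_
          simp only [ratio, OpenUnit.assocSnd]
          rw [e1, div_eq_div_iff _ h2]
          · field_simp
            ring
          · have : 1 - s / (s + (t + r)) = (t + r) / (s + (t + r)) := by field_simp; ring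
            rw [this]
            exact div_ne_zero h2 h3

theorem smul_mk {r : NNReal} (hr : 0 < r) {s : ℝ} (hs : 0 < s) (a : A) :
    r • mk s hs a = mk (r * s) (mul_pos hr hs) a := dif_pos hr

theorem zero_smul' (x : Cone A) : (0 : NNReal) • x = 0 := by
  cases x with
  | zero => rfl
  | mk s hs a => exact dif_neg (lt_irrefl _)

theorem smul_zero' (r : NNReal) : r • (0 : Cone A) = 0 := rfl

noncomputable instance : AddCommMonoid (Cone A) where
  add_assoc := add_assoc'
  zero_add := zero_add'
  add_zero := add_zero'
  add_comm := add_comm'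
  nsmul := nsmulRec

/-- Distributivity over sums in the cone holds because ratios are invariant under scaling.
Distributivity over sums of scalars is where idempotence of convex combinations is needed. -/
noncomputable instance : Module NNReal (Cone A) where
  one_smul x := by
    cases x with
    | zero => rfl
    | mk s hs a => rw [smul_mk one_pos]; exact mk_congr (one_mul s) rfl
  mul_smul r r' x := by
    rcases eq_zero_or_pos r with rfl | hr
    · rw [zero_mul, zero_smul', zero_smul']
    rcases eq_zero_or_pos r' with rfl | hr'
    · rw [mul_zero, zero_smul', smul_zero']
    cases x with
    | zero => rfl
    | mk s hs a =>
      rw [smul_mk (mul_pos hr hr'), smul_mk hr', smul_mk hr]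
      exact mk_congr (by rw [NNReal.coe_mul, mul_assoc]) rfl
  smul_zero := smul_zero'
  zero_smul := zero_smul'
  smul_add r x y := by
    rcases eq_zero_or_pos r with rfl | hr
    · rw [zero_smul', zero_smul', zero_smul', add_zero]
    cases x with
    | zero => exact congrArg (r • ·) (zero_add y) |>.trans (zero_add _).symm
    | mk s hs a =>
      cases y with
      | zero => exact congrArg (r • ·) (add_zero _) |>.trans (add_zero _).symm
      | mk t ht b =>
        rw [mk_add_mk, smul_mk hr, smul_mk hr, smul_mk hr, mk_add_mk]
        refine mk_congr (mul_add _ _ _) ?_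
        congr 1
        refine Subtype.ext ?_
        have hr' : (r : ℝ) ≠ 0 := NNReal.coe_ne_zero.2 hr.ne'
        simp only [ratio]
        rw [← mul_add, mul_div_mul_left _ _ hr']
  add_smul r r' x := by
    rcases eq_zero_or_pos r with rfl | hr
    · rw [zero_add, zero_smul', zero_add]
    rcases eq_zero_or_pos r' with rfl | hr'
    · rw [add_zero, zero_smul', add_zero]
    cases x with
    | zero => rfl
    | mk s hs a =>
      rw [smul_mk hr, smul_mk hr', smul_mk (add_pos hr hr'), mk_add_mk, ConvexAlgebra.op_idem]
      exact mk_congr (by rw [NNReal.coe_add, add_mul]) rfl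

/-- An element of a convex algebra as an element of the cone. -/
def emb (a : A) : Cone A := mk 1 one_pos a

/-- The cone forgets nothing, so equations in a convex algebra may be verified there with linear
algebra. The algebra itself need not be cancellative. -/
theorem emb_injective : Function.Injective (emb : A → Cone A) := by
  intro a b h
  unfold emb at h
  injection h

/-- The weights add up to one, so their ratio is `p` itself. -/
theorem emb_op (p : OpenUnit) (a b : A) :
    emb (ConvexAlgebra.op p a b) =
      (p.1.toNNReal) • emb a + ((1 - p.1).toNNReal) • emb b := by
  have h1 := p.2.1
  have h2 : 0 < 1 - p.1 := by linarith [p.2.2]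
  unfold emb
  rw [smul_mk (Real.toNNReal_pos.2 h1), smul_mk (Real.toNNReal_pos.2 h2), mk_add_mk]
  refine mk_congr ?_ ?_
  · rw [Real.coe_toNNReal _ h1.le, Real.coe_toNNReal _ h2.le]; ring
  · congr 1
    refine Subtype.ext ?_
    simp only [ratio]
    rw [Real.coe_toNNReal _ h1.le, Real.coe_toNNReal _ h2.le]
    simp

/-- The linear map of cones induced by a map which preserves convex combinations. -/
noncomputable def map (φ : A → B)
    (h : ∀ p a b, φ (ConvexAlgebra.op p a b) = ConvexAlgebra.op p (φ a) (φ b)) :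
    Cone A →ₗ[NNReal] Cone B where
  toFun
    | zero => zero
    | mk s hs a => mk s hs (φ a)
  map_add' x y := by
    cases x with
    | zero => rw [show (zero : Cone A) = 0 from rfl, zero_add]; exact (zero_add _).symm
    | mk s hs a =>
      cases y with
      | zero => rfl
      | mk t ht b => exact mk_congr rfl (h _ _ _)
  map_smul' r x := by
    rcases eq_zero_or_pos r with rfl | hr
    · rw [zero_smul, RingHom.id_apply, zero_smul]; rfl
    cases x with
    | zero => rfl
    | mk s hs a => rw [smul_mk hr, RingHom.id_apply, smul_mk hr]

@[simp] theorem map_emb (φ : A → B)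
    (h : ∀ p a b, φ (ConvexAlgebra.op p a b) = ConvexAlgebra.op p (φ a) (φ b)) (a : A) :
    map φ h (emb a) = emb (φ a) := rfl

/-- The weight of an element of the cone. -/
noncomputable def weight : Cone A →ₗ[NNReal] NNReal where
  toFun
    | zero => 0
    | mk s hs _ => ⟨s, hs.le⟩
  map_add' x y := by
    cases x with
    | zero => rw [show (zero : Cone A) = 0 from rfl, zero_add]; exact (zero_add _).symm
    | mk s hs a =>
      cases y with
      | zero => exact (add_zero (⟨s, hs.le⟩ : NNReal)).symm
      | mk t ht b => rfl
  map_smul' r x := by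
    rcases eq_zero_or_pos r with rfl | hr
    · rw [zero_smul, RingHom.id_apply, zero_smul]
    cases x with
    | zero => exact (mul_zero _).symm
    | mk s hs a => rw [smul_mk hr]; rfl

@[simp] theorem weight_emb (a : A) : weight (emb a) = 1 := rfl

end Cone

/-! ### Calculations with terms -/

namespace Term

variable {S : Type u} {G : List S → List S → Type w}
  {E : ∀ {P Q : List S}, Term G P Q → Term G P Q → Prop}

theorem idW_tensor_idW (P Q : List S) :
    Eqv E ((idW P).tensor (idW Q)) (idW (P ++ Q) : Term G _ _) := by
  induction P with
  | nil => exact .idZero_tensor _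
  | cons A P ih => exact (Eqv.tensor_assoc _ _ _).trans (.tensor (.refl _) ih)

theorem castT_right {P Q P' Q' P'' Q'' : List S} {hP : P = P'} {hQ : Q = Q'} {t : Term G P Q}
    {s : Term G P'' Q''} (h : Eqv E s t) : Eqv E s (castT hP hQ t) :=
  h.trans (eqv_castT _ _ _).symm

theorem castT_left {P Q P' Q' P'' Q'' : List S} {hP : P = P'} {hQ : Q = Q'} {t : Term G P Q}
    {s : Term G P'' Q''} (h : Eqv E t s) : Eqv E (castT hP hQ t) s :=
  (eqv_castT _ _ _).trans h

theorem id_tensor_nil (A : S) : Eqv E (idW [A] : Term G _ _) (id A) := .tensor_idZero _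

theorem idW_congr {P Q : List S} (h : P = Q) : Eqv E (idW P : Term G _ _) (idW Q) := by
  subst h; exact .refl _

theorem symmL_nil (A : S) : Eqv E (symmL A [] : Term G _ _) (idW [A]) := (id_tensor_nil A).symm

theorem comp_idW {P Q P' Q' R : List S} {f : Term G P Q} {f' : Term G P' Q'} {g : Term G Q R}
    (hf : Eqv E f f') (hg : Eqv E g (idW Q' : Term G _ _)) : Eqv E (f.comp g) f' :=
  (Eqv.comp hf hg).trans (.comp_id _)

theorem symmW_nil_right (P : List S) : Eqv E (symmW P [] : Term G _ _) (idW P) := by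
  induction P with
  | nil => exact .refl _
  | cons A P ih =>
    refine comp_idW (.tensor (.refl _) ih) (castT_left ?_)
    exact (Eqv.tensor (symmL_nil A) (.refl _)).trans (idW_tensor_idW [A] P)

/-- Lets the naturality axiom, which speaks of derived symmetries, be applied to the generating
symmetry of two letters. -/
theorem symmW_single (A B : S) : Eqv E (symmW [A] [B] : Term G _ _) (symm A B) := by
  have h1 : Eqv E (tensor (id A) (symmW [] [B]) : Term G ([A] ++ ([] ++ [B])) ([A] ++ ([B] ++ [])))
      (idW ([A] ++ [B]) : Term G _ _) :=
    .tensor (.refl _) (castT_left (.refl _))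
  have h2 : Eqv E (tensor (symmL A [B]) (idW []) : Term G _ _) (symm A B) := by
    refine (Eqv.tensor_idZero _).trans ?_
    refine comp_idW (.tensor_idZero _) ?_
    exact Eqv.tensor (.refl _) (symmL_nil A)
  exact (Eqv.comp h1 (castT_left h2)).trans (.id_comp _)

theorem tensor_comp_left {P Q R P' Q' : List S} (f : Term G P Q) (g : Term G Q R)
    (h : Term G P' Q') :
    Eqv E ((f.comp g).tensor h) ((f.tensor (idW P')).comp (g.tensor h)) :=
  ((Eqv.interchange _ _ _ _).trans (.tensor (.refl _) (.id_comp _))).symm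

theorem tensor_comp_left' {P Q R P' Q' : List S} (f : Term G P Q) (g : Term G Q R)
    (h : Term G P' Q') :
    Eqv E ((f.comp g).tensor h) ((f.tensor h).comp (g.tensor (idW Q'))) :=
  ((Eqv.interchange _ _ _ _).trans (.tensor (.refl _) (.comp_id _))).symm

theorem tensor_comp_right {P Q R P' Q' : List S} (f : Term G P Q) (g : Term G Q R)
    (h : Term G P' Q') :
    Eqv E (h.tensor (f.comp g)) (((idW P').tensor f).comp (h.tensor g)) :=
  ((Eqv.interchange _ _ _ _).trans (.tensor (.id_comp _) (.refl _))).symm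

theorem tensor_comp_right' {P Q R P' Q' : List S} (f : Term G P Q) (g : Term G Q R)
    (h : Term G P' Q') :
    Eqv E (h.tensor (f.comp g)) ((h.tensor f).comp ((idW Q').tensor g)) :=
  ((Eqv.interchange _ _ _ _).trans (.tensor (.comp_id _) (.refl _))).symm

end Term

namespace FreeHom

variable {S : Type u} {G : List S → List S → Type w}
  {E : ∀ {P Q : List S}, Term G P Q → Term G P Q → Prop}

theorem symm_symm (P Q : List S) :
    (mk (Term.symmW P Q) : FreeHom E _ _).comp (mk (Term.symmW Q P)) = mk (Term.idW (P ++ Q)) :=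
  sound (.symm_symm P Q)

theorem symm_nat_left {P Q : List S} (s : FreeHom E P Q) (R : List S) :
    (s.tensor (mk (Term.idW R))).comp (mk (Term.symmW Q R)) =
      (mk (Term.symmW P R)).comp ((mk (Term.idW R)).tensor s) := by
  induction s using Quot.ind
  exact sound (.symm_nat _ _)

/-- The axiom gives naturality in the first argument only. Conjugating with the inverse symmetry
yields the other one. -/
theorem symm_nat_right {P Q : List S} (s : FreeHom E P Q) (R : List S) :
    ((mk (Term.idW R)).tensor s).comp (mk (Term.symmW R Q)) =
      (mk (Term.symmW R P)).comp (s.tensor (mk (Term.idW R))) := by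
  rw [← comp_id ((mk (Term.symmW R P)).comp (s.tensor (mk (Term.idW R)))), ← symm_symm,
    comp_assoc, ← comp_assoc (s.tensor _), symm_nat_left, ← comp_assoc, ← comp_assoc, symm_symm,
    id_comp]

theorem symm_nat {P Q P' Q' : List S} (s : FreeHom E P Q) (t : FreeHom E P' Q') :
    (s.tensor t).comp (mk (Term.symmW Q Q')) = (mk (Term.symmW P P')).comp (t.tensor s) := by
  have h1 : s.tensor t = (s.tensor (mk (Term.idW P'))).comp ((mk (Term.idW Q)).tensor t) := by
    rw [interchange, comp_id, id_comp]
  have h2 : t.tensor s = ((mk (Term.idW P')).tensor s).comp (t.tensor (mk (Term.idW Q))) := by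
    rw [interchange, comp_id, id_comp]
  rw [h1, h2, comp_assoc, symm_nat_right, ← comp_assoc, symm_nat_left, comp_assoc]

end FreeHom

/-! ### The convex algebra of tapes -/

namespace TapeCat

variable {C : Type u} [Category.{v} C]

open Term TapeTerm

/-- The identity of a word. -/
abbrev ident (P : List C) : Arr P P := CategoryStruct.id (obj := TapeCat C) P

theorem comp_assoc {P Q R S : List C} (f : Arr P Q) (g : Arr Q R) (h : Arr R S) :
    ((f ≫ g : Arr P R) ≫ h : Arr P S) = (f ≫ (g ≫ h : Arr Q S) : Arr P S) :=
  FreeHom.comp_assoc f g h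

theorem id_comp {P Q : List C} (f : Arr P Q) : (ident P ≫ f : Arr P Q) = f := FreeHom.id_comp f

theorem comp_id {P Q : List C} (f : Arr P Q) : (f ≫ ident Q : Arr P Q) = f := FreeHom.comp_id f

theorem sum_comp {P₁ Q₁ R₁ P₂ Q₂ R₂ : List C} (f₁ : Arr P₁ Q₁) (g₁ : Arr Q₁ R₁) (f₂ : Arr P₂ Q₂)
    (g₂ : Arr Q₂ R₂) : sum (f₁ ≫ g₁ : Arr P₁ R₁) (f₂ ≫ g₂ : Arr P₂ R₂) =
      (sum f₁ f₂ ≫ sum g₁ g₂ : Arr _ _) :=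
  (FreeHom.interchange f₁ g₁ f₂ g₂).symm

theorem codiag_nat {P Q : List C} (f : Arr P Q) :
    (ofTerm (codiag P) ≫ f : Arr _ _) = (sum f f ≫ ofTerm (codiag Q) : Arr _ _) := by
  induction f using Quot.ind
  exact FreeHom.sound (.ax (.codiag_nat _))

theorem split_nat (p : OpenUnit) {P Q : List C} (f : Arr P Q) :
    (f ≫ ofTerm (split p Q) : Arr _ _) = (ofTerm (split p P) ≫ sum f f : Arr _ _) := by
  induction f using Quot.ind
  exact FreeHom.sound (.ax (.split_nat _ _))

theorem cobang_nat {P Q : List C} (f : Arr P Q) :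
    (ofTerm (cobang P) ≫ f : Arr _ _) = ofTerm (cobang Q) := by
  induction f using Quot.ind
  exact FreeHom.sound (.ax (.cobang_nat _))

theorem sum_symm_nat {P Q P' Q' : List C} (s : Arr P Q) (t : Arr P' Q') :
    (sum s t ≫ sumSymm Q Q' : Arr _ _) = (sumSymm P P' ≫ sum t s : Arr _ _) :=
  FreeHom.symm_nat s t

/-- The convex combinations of tapes. -/
def convex {P Q : List C} (p : OpenUnit) (f g : Arr P Q) : Arr P Q :=
  (ofTerm (split p P) ≫ sum f g ≫ ofTerm (codiag Q) : Arr _ _)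

/-- Both sides are rearranged into three layers: two splits, the sum of `f`, `g` and `h`, two
codiagonals. The layers match by `split_assoc`, associativity of `⊕` and `codiag_assoc`. -/
theorem convex_assoc {P Q : List C} (p q : OpenUnit) (f g h : Arr P Q) :
    convex p (convex q f g) h = convex (p.assocFst q) f (convex (p.assocSnd q) g h) := by
  induction f using Quot.ind with | _ f => ?_
  induction g using Quot.ind with | _ g => ?_
  induction h using Quot.ind with | _ h => ?_
  refine FreeHom.sound ?_
  have L : Eqv (TapeAx C)
      ((split p P).comp ((((split q P).comp ((f.tensor g).comp (codiag Q))).tensor h).comp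
        (codiag Q)))
      (((split p P).comp ((split q P).tensor (idW P))).comp (((f.tensor g).tensor h).comp
        (((codiag Q).tensor (idW Q)).comp (codiag Q)))) := by
    refine Eqv.trans ?_ (Eqv.comp_assoc _ _ _).symm
    refine Eqv.comp (.refl _) ?_
    refine (Eqv.comp (tensor_comp_left _ _ _) (.refl _)).trans ?_
    refine (Eqv.comp_assoc _ _ _).trans (Eqv.comp (.refl _) ?_)
    refine (Eqv.comp (tensor_comp_left' _ _ _) (.refl _)).trans (Eqv.comp_assoc _ _ _)
  have R : Eqv (TapeAx C)
      ((split (p.assocFst q) P).comp ((f.tensor ((split (p.assocSnd q) P).comp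
        ((g.tensor h).comp (codiag Q)))).comp (codiag Q)))
      (((split (p.assocFst q) P).comp ((idW P).tensor (split (p.assocSnd q) P))).comp
        ((f.tensor (g.tensor h)).comp (((idW Q).tensor (codiag Q)).comp (codiag Q)))) := by
    refine Eqv.trans ?_ (Eqv.comp_assoc _ _ _).symm
    refine Eqv.comp (.refl _) ?_
    refine (Eqv.comp (tensor_comp_right _ _ _) (.refl _)).trans ?_
    refine (Eqv.comp_assoc _ _ _).trans (Eqv.comp (.refl _) ?_)
    refine (Eqv.comp (tensor_comp_right' _ _ _) (.refl _)).trans (Eqv.comp_assoc _ _ _)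
  refine L.trans (Eqv.trans ?_ R.symm)
  refine Eqv.comp ?_ (Eqv.comp (.tensor_assoc _ _ _) ?_)
  · exact (Eqv.ax (.split_assoc p q P)).trans (Eqv.comp (.refl _) (castT_left (.refl _)))
  · exact ((Eqv.ax (.codiag_assoc Q)).trans (castT_left (.refl _))).symm

/-- Idempotence slides two copies of `f` through the codiagonal and uses that `split` followed by
`codiag` is the identity. Commutativity inserts a symmetry before the codiagonal and slides it back
to the split. -/
noncomputable instance {P Q : List C} : ConvexAlgebra (Arr P Q) where
  op := convex
  op_idem p f := by
    rw [convex, ← codiag_nat, ← comp_assoc]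
    have : (ofTerm (split p P) ≫ ofTerm (codiag P) : Arr P P) = ident P :=
      FreeHom.sound (.ax (.split_idem p P))
    rw [this]
    exact id_comp f
  op_symm p f g := by
    have h1 : (sumSymm Q Q ≫ ofTerm (codiag Q) : Arr _ _) = ofTerm (codiag Q) :=
      FreeHom.sound (.ax (.codiag_symm Q))
    have h2 : (ofTerm (split p P) ≫ sumSymm P P : Arr _ _) = ofTerm (split p.compl P) :=
      FreeHom.sound (.ax (.split_symm p P))
    rw [convex, convex, ← h1, ← comp_assoc (sum f g), sum_symm_nat, ← h2]
    simp only [comp_assoc, h1]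
  op_assoc p q f g h := convex_assoc p q f g h

/-- Naturality of `codiag` makes postcomposition affine, hence linear on cones. This is what allows
composites of expansions to be computed. -/
theorem convex_comp {P Q R : List C} (p : OpenUnit) (f g : Arr P Q) (h : Arr Q R) :
    (ConvexAlgebra.op p f g ≫ h : Arr P R) =
      ConvexAlgebra.op p (f ≫ h : Arr P R) (g ≫ h : Arr P R) := by
  change (convex p f g ≫ h : Arr P R) = convex p _ _
  rw [convex, convex, sum_comp]
  simp only [comp_assoc]
  rw [codiag_nat]

end TapeCat

end TapeDiagrams

/-! ### Injections and copairing of tapes -/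

namespace TapeDiagrams

variable {C : Type u} [Category.{v} C]

/-- The congruence is already an equivalence relation on each type of terms, so the quotient
identifies nothing more. -/
theorem Term.Eqv.exact {S : Type u} {G : List S → List S → Type w}
    {E : ∀ {P Q : List S}, Term G P Q → Term G P Q → Prop} {P Q : List S} {f g : Term G P Q}
    (h : (FreeHom.mk f : FreeHom E P Q) = FreeHom.mk g) : Term.Eqv E f g :=
  (Equivalence.quot_mk_eq_iff ⟨Eqv.refl, Eqv.symm, Eqv.trans⟩ f g).1 h

namespace TapeTerm

open Term

/-- The zero tape. -/
def zero (U : C) (Q : List C) : TapeTerm C [U] Q := (bang [U]).comp (cobang Q)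

/-- The tape of an arrow followed by the injection at a position. -/
noncomputable def inj (U : C) : (Q : List C) → ℕ × AnyHom C → TapeTerm C [U] Q
  | [], _ => zero U []
  | V :: Q, (0, f) =>
      open Classical in
      if h : f.src = U ∧ f.tgt = V then
        (tensor (gen (.tape (eqToHom h.1.symm ≫ f.hom ≫ eqToHom h.2))) (cobang Q) :
          TapeTerm C ([U] ++ []) ([V] ++ Q))
      -- A default value, for arrows that do not run from `U` to the letter at the position.
      else zero U (V :: Q)
  | V :: Q, (n + 1, f) => (tensor (cobang [V]) (inj U Q (n, f)) : TapeTerm C ([] ++ [U]) ([V] ++ Q))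

theorem inj_zero {U V : C} (Q : List C) (f : U ⟶ V) :
    Eqv (TapeAx C) (inj U (V :: Q) (0, ⟨U, V, f⟩))
      (tensor (gen (.tape f)) (cobang Q) : TapeTerm C ([U] ++ []) ([V] ++ Q)) := by
  have h : (⟨U, V, f⟩ : AnyHom C).src = U ∧ (⟨U, V, f⟩ : AnyHom C).tgt = V := ⟨rfl, rfl⟩
  have e : inj U (V :: Q) (0, ⟨U, V, f⟩) =
      (tensor (gen (.tape f)) (cobang Q) : TapeTerm C ([U] ++ []) ([V] ++ Q)) := by
    rw [inj]
    refine (dif_pos h).trans ?_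
    simp
  rw [e]
  exact .refl _

theorem inj_succ {U V : C} (Q : List C) (n : ℕ) (f : AnyHom C) :
    Eqv (TapeAx C) (inj U (V :: Q) (n + 1, f))
      (tensor (cobang [V]) (inj U Q (n, f)) : TapeTerm C ([] ++ [U]) ([V] ++ Q)) := .refl _

theorem valid_zero {U V : C} {Q : List C} {f : AnyHom C} (h : Valid U (V :: Q) (0, f)) :
    ∃ g : U ⟶ V, f = ⟨U, V, g⟩ := by
  obtain ⟨U', V', g⟩ := f
  obtain ⟨h1, h2⟩ := h
  simp only [List.getElem?_cons_zero, Option.some.injEq] at h1 h2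
  subst h1 h2
  exact ⟨g, rfl⟩

theorem valid_succ {U V : C} {Q : List C} {n : ℕ} {f : AnyHom C}
    (h : Valid U (V :: Q) (n + 1, f)) : Valid U Q (n, f) := by
  obtain ⟨h1, h2⟩ := h
  exact ⟨h1, by simpa using h2⟩

theorem cobang_single (V : C) : Eqv (TapeAx C) (cobang [V]) (gen (.cobang V)) := .tensor_idZero _

/-- The remaining summands of an injection are filled with `cobang`, and `cobang` of a sum is the
sum of the two `cobang`s. -/
theorem inj_append_left {U : C} {P : List C} (Q : List C) {x : ℕ × AnyHom C} (hx : Valid U P x) :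
    Eqv (TapeAx C) (inj U (P ++ Q) x) ((inj U P x).tensor (cobang Q)) := by
  induction P generalizing x with
  | nil => exact absurd hx valid_nil
  | cons V P ih =>
    obtain ⟨n, f⟩ := x
    cases n with
    | zero =>
      obtain ⟨g, rfl⟩ := valid_zero hx
      refine (inj_zero (P ++ Q) g).trans (Eqv.trans ?_ (Eqv.tensor (inj_zero P g).symm (.refl _)))
      exact (Eqv.tensor (.refl _) (.ax (.cobang_sum P Q))).trans (Eqv.tensor_assoc _ _ _).symm
    | succ n =>
      exact (Eqv.tensor (.refl _) (ih (valid_succ hx))).trans (Eqv.tensor_assoc _ _ _).symm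

theorem inj_append_right {U : C} (P : List C) {Q : List C} (x : ℕ × AnyHom C) :
    Eqv (TapeAx C) (inj U (P ++ Q) (P.length + x.1, x.2)) ((cobang P).tensor (inj U Q x)) := by
  induction P with
  | nil => rw [List.length_nil, Nat.zero_add]; exact (Eqv.idZero_tensor _).symm
  | cons V P ih =>
    rw [List.length_cons, Nat.add_right_comm]
    refine (Eqv.tensor (.refl _) ih).trans ((Eqv.tensor_assoc _ _ _).symm.trans ?_)
    exact Eqv.tensor (Eqv.tensor (cobang_single V) (.refl _)) (.refl _)

/-- The left injection. -/
def inl (P Q : List C) : TapeTerm C P (P ++ Q) :=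
  castT (List.append_nil P) rfl ((idW P).tensor (cobang Q))

/-- The right injection. -/
def inr (P Q : List C) : TapeTerm C Q (P ++ Q) := ((cobang P).tensor (idW Q) : TapeTerm C ([] ++ Q) _)

theorem comp_inl {P Q : List C} (a : TapeTerm C P Q) (R : List C) :
    Eqv (TapeAx C) (a.comp (inl Q R)) (a.tensor (cobang R)) := by
  have h : Eqv (TapeAx C) (inl Q R) ((idW Q).tensor (cobang R)) := castT_left (.refl _)
  refine (Eqv.comp (Eqv.tensor_idZero a).symm h).trans ((Eqv.interchange _ _ _ _).trans ?_)
  exact Eqv.tensor (.comp_id _) (Eqv.id_comp (cobang R))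

theorem comp_inr {P Q : List C} (a : TapeTerm C P Q) (R : List C) :
    Eqv (TapeAx C) (a.comp (inr R Q)) ((cobang R).tensor a) := by
  refine (Eqv.comp (Eqv.idZero_tensor a).symm (.refl ((cobang R).tensor (idW Q)))).trans
    ((Eqv.interchange _ _ _ _).trans ?_)
  exact Eqv.tensor (Eqv.id_comp (cobang R)) (.comp_id _)

/-- Naturality of `cobang` absorbs `t₂`: on the first summand only `t₁` is seen. -/
theorem tensor_cobang_comp {P P₁ P₂ Q₁ Q₂ : List C} (a : TapeTerm C P P₁) (t₁ : TapeTerm C P₁ Q₁)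
    (t₂ : TapeTerm C P₂ Q₂) :
    Eqv (TapeAx C) ((a.tensor (cobang P₂)).comp (t₁.tensor t₂))
      ((a.comp t₁).tensor (cobang Q₂)) :=
  (Eqv.interchange _ _ _ _).trans (Eqv.tensor (.refl _) (.ax (.cobang_nat t₂)))

theorem cobang_tensor_comp {P P₁ P₂ Q₁ Q₂ : List C} (a : TapeTerm C P P₂) (t₁ : TapeTerm C P₁ Q₁)
    (t₂ : TapeTerm C P₂ Q₂) :
    Eqv (TapeAx C) (((cobang P₁).tensor a).comp (t₁.tensor t₂))
      ((cobang Q₁).tensor (a.comp t₂)) :=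
  (Eqv.interchange _ _ _ _).trans (Eqv.tensor (.ax (.cobang_nat t₁)) (.refl _))

theorem cobang_tensor_codiag {P Q : List C} (a : TapeTerm C P Q) :
    Eqv (TapeAx C) (((cobang Q).tensor a).comp (codiag Q)) a := by
  refine (Eqv.comp (comp_inr a Q).symm (.refl _)).trans ((Eqv.comp_assoc _ _ _).trans ?_)
  exact comp_idW (.refl _) (.ax (.codiag_unit Q))

/-- The axioms contain only the left unit law. The right one follows by commutativity of the
codiagonal and naturality of the symmetry. -/
theorem tensor_cobang_codiag {P Q : List C} (a : TapeTerm C P Q) :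
    Eqv (TapeAx C) ((a.tensor (cobang Q)).comp (codiag Q)) a := by
  refine (Eqv.comp (.refl _) (Eqv.ax (.codiag_symm Q)).symm).trans
    ((Eqv.comp_assoc _ _ _).symm.trans ?_)
  have h : Eqv (TapeAx C) ((a.tensor (cobang Q)).comp (symmW Q Q)) ((cobang Q).tensor a) := by
    refine (Eqv.exact (FreeHom.symm_nat (FreeHom.mk a) (FreeHom.mk (cobang Q)))).trans ?_
    exact (Eqv.comp (symmW_nil_right P) (.refl ((cobang Q).tensor a))).trans
      (Eqv.id_comp ((cobang Q).tensor a))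
  exact (Eqv.comp h (.refl _)).trans (cobang_tensor_codiag a)

/-- Copairing the injections followed by arrows. -/
theorem copair_inj {P P' Q Q' : List C} (a : TapeTerm C P P') (b : TapeTerm C Q Q') :
    Eqv (TapeAx C)
      (((a.tensor (cobang Q')).tensor ((cobang P').tensor b)).comp (codiag (P' ++ Q')))
      (a.tensor b) := by
  -- The two units in the middle are merged into one `cobang`. It absorbs the symmetry that comes
  -- from the codiagonal of a sum, and is then split again in the other order, so that each factor
  -- meets its own unit.
  have h1 : Eqv (TapeAx C) ((a.tensor (cobang Q')).tensor ((cobang P').tensor b))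
      (a.tensor ((cobang (Q' ++ P')).tensor b)) := by
    refine (Eqv.tensor_assoc _ _ _).trans (Eqv.tensor (.refl _) ?_)
    refine (Eqv.tensor_assoc _ _ _).symm.trans (Eqv.tensor ?_ (.refl _))
    exact (Eqv.ax (.cobang_sum _ _)).symm
  have h2 : Eqv (TapeAx C) (codiag (P' ++ Q'))
      (((idW P').tensor ((symmW Q' P').tensor (idW Q'))).comp
        (castT (by simp) rfl ((codiag P').tensor (codiag Q')))) :=
    (Eqv.ax (.codiag_sum _ _)).trans (Eqv.comp (castT_left (.refl _)) (castT_right (.refl _)))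
  refine (Eqv.comp h1 h2).trans ((Eqv.comp_assoc _ _ _).symm.trans ?_)
  have h3 : Eqv (TapeAx C) ((a.tensor ((cobang (Q' ++ P')).tensor b)).comp
      ((idW P').tensor ((symmW Q' P').tensor (idW Q'))))
      (((a.tensor (cobang P')).tensor ((cobang Q').tensor b))) := by
    refine (Eqv.interchange _ _ _ _).trans ?_
    refine (Eqv.tensor (.comp_id _) (Eqv.interchange _ _ _ _)).trans ?_
    refine (Eqv.tensor (.refl _) (Eqv.tensor (.ax (.cobang_nat _)) (.comp_id _))).trans ?_
    refine Eqv.trans ?_ (Eqv.tensor_assoc _ _ _).symm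
    refine Eqv.tensor (.refl _) ?_
    exact (Eqv.tensor (.ax (.cobang_sum _ _)) (.refl _)).trans (Eqv.tensor_assoc _ _ _)
  refine (Eqv.comp h3 (castT_left (.refl _))).trans ((Eqv.interchange _ _ _ _).trans ?_)
  refine Eqv.tensor ?_ ?_
  · exact tensor_cobang_codiag a
  · exact cobang_tensor_codiag b

end TapeTerm

end TapeDiagrams

/-! ### Faithfulness: expansion of tapes in the cone -/

namespace TapeDiagrams

variable {C : Type u} [Category.{v} C]

/-- The nonnegative part of a vector. -/
noncomputable def nnPart (v : Vec C) : (ℕ × AnyHom C) →₀ NNReal :=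
  v.mapRange Real.toNNReal Real.toNNReal_zero

theorem nnPart_ket (x : ℕ × AnyHom C) : nnPart (ket x) = Finsupp.single x 1 := by
  rw [nnPart, Finsupp.mapRange_single, Real.toNNReal_one]

theorem apply_eq_sum (K : Vec C →ₗ[ℝ] Vec C) (v : Vec C) :
    K v = ∑ y ∈ v.support, v y • K (ket y) := by
  conv_lhs => rw [← Finsupp.sum_single v]
  rw [Finsupp.sum, map_sum]
  refine Finset.sum_congr rfl fun y _ => ?_
  rw [← map_smul]
  simp

/-- `Real.toNNReal` is additive only on nonnegative reals, hence the positivity hypotheses. The cone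
has no negative scalars, while the action is over the reals. -/
theorem nnPart_apply (K : Vec C →ₗ[ℝ] Vec C) {v : Vec C} (hv : ∀ x, 0 ≤ v x)
    (hK : ∀ x ∈ v.support, ∀ y, 0 ≤ K (ket x) y) :
    nnPart (K v) = ∑ y ∈ v.support, (v y).toNNReal • nnPart (K (ket y)) := by
  refine Finsupp.ext fun z => ?_
  rw [nnPart, Finsupp.mapRange_apply, apply_eq_sum, Finsupp.finsetSum_apply,
    Finsupp.finsetSum_apply, Real.toNNReal_sum_of_nonneg]
  · refine Finset.sum_congr rfl fun y _ => ?_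
    rw [Finsupp.smul_apply, smul_eq_mul, Real.toNNReal_mul (hv y)]
    rfl
  · intro y hy
    rw [Finsupp.smul_apply, smul_eq_mul]
    exact mul_nonneg (hv y) (hK y hy z)

namespace TapeCat

open Term TapeTerm Cone

/-- The arrow followed by the injection at a position. -/
noncomputable abbrev injArr (U : C) (Q : List C) (x : ℕ × AnyHom C) : Arr [U] Q :=
  ofTerm (inj U Q x)

/-- The zero arrow. -/
abbrev zeroArr (U : C) (Q : List C) : Arr [U] Q := ofTerm (zero U Q)

/-- The formal combination denoted by a vector. -/
noncomputable def denote (U : C) (Q : List C) (v : Vec C) : Cone (Arr [U] Q) :=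
  Finsupp.linearCombination NNReal (fun y => emb (injArr U Q y)) (nnPart v)

@[simp] theorem denote_ket (U : C) (Q : List C) (x : ℕ × AnyHom C) :
    denote U Q (ket x) = emb (injArr U Q x) := by
  rw [denote, nnPart_ket, Finsupp.linearCombination_single, one_smul]

@[simp] theorem denote_zero (U : C) (Q : List C) : denote U Q 0 = 0 := by
  rw [denote, nnPart, Finsupp.mapRange_zero, map_zero]

theorem denote_apply (U : C) (Q : List C) (K : Vec C →ₗ[ℝ] Vec C) {v : Vec C}
    (hv : ∀ x, 0 ≤ v x) (hK : ∀ x ∈ v.support, ∀ y, 0 ≤ K (ket x) y) :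
    denote U Q (K v) = ∑ y ∈ v.support, (v y).toNNReal • denote U Q (K (ket y)) := by
  rw [denote, nnPart_apply K hv hK, map_sum]
  simp only [map_smul]
  rfl

theorem denote_eq_sum (U : C) (Q : List C) {v : Vec C} (hv : ∀ x, 0 ≤ v x) :
    denote U Q v = ∑ y ∈ v.support, (v y).toNNReal • emb (injArr U Q y) := by
  classical
  have := denote_apply U Q LinearMap.id hv fun x _ y => by
    rw [LinearMap.id_apply, Finsupp.single_apply]
    split_ifs <;> norm_num
  simpa using this

/-- The zero arrow ends with `cobang`, which absorbs what follows. -/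
theorem zeroArr_comp {U : C} {P Q : List C} (s : Arr P Q) :
    (zeroArr U P ≫ s : Arr [U] Q) = zeroArr U Q := by
  change ((ofTerm (bang [U]) ≫ ofTerm (cobang P) : Arr [U] P) ≫ s : Arr [U] Q) = _
  rw [comp_assoc, cobang_nat]
  rfl

/-- The arrow `t` acts on vectors as `K` does. -/
def Denotes {P Q : List C} (K : Vec C →ₗ[ℝ] Vec C) (t : Arr P Q) : Prop :=
  ∀ U x, Valid U P x → K (ket x) ∈ VSpace U Q ∧ (∀ y, 0 ≤ K (ket x) y) ∧
    -- The left side has weight one, while a column of the matrix may have smaller mass. The missing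
    -- mass `r` sits on the zero arrow.
    ∃ r : NNReal, emb (injArr U P x ≫ t : Arr [U] Q) =
      denote U Q (K (ket x)) + r • emb (zeroArr U Q)

theorem ket_nonneg (x y : ℕ × AnyHom C) : 0 ≤ ket x y := by
  classical
  rw [Finsupp.single_apply]
  split_ifs <;> norm_num

theorem Denotes.of_ket {P Q : List C} {K : Vec C →ₗ[ℝ] Vec C} {t : Arr P Q}
    (φ : ℕ × AnyHom C → ℕ × AnyHom C)
    (h : ∀ U x, Valid U P x → Valid U Q (φ x) ∧ K (ket x) = ket (φ x) ∧
      (injArr U P x ≫ t : Arr [U] Q) = injArr U Q (φ x)) : Denotes K t := by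
  intro U x hx
  obtain ⟨h1, h2, h3⟩ := h U x hx
  rw [h2, h3]
  exact ⟨ket_mem h1, ket_nonneg _, 0, by simp⟩

theorem Denotes.congr {P Q : List C} {K L : Vec C →ₗ[ℝ] Vec C} {t : Arr P Q} (h : Denotes K t)
    (hL : ∀ U x, Valid U P x → L (ket x) = K (ket x)) : Denotes L t := by
  intro U x hx
  rw [hL U x hx]
  exact h U x hx

/-- Expand `inj ; t`, postcompose the expansion with `s`, and expand each resulting `inj ; s`. The
mass lost is what `t` loses plus the weighted average of what `s` loses. -/
theorem Denotes.comp {P Q R : List C} {K L : Vec C →ₗ[ℝ] Vec C} {t : Arr P Q} {s : Arr Q R}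
    (hK : Denotes K t) (hL : Denotes L s) : Denotes (L ∘ₗ K) (t ≫ s : Arr P R) := by
  intro U x hx
  obtain ⟨h1, h2, r, h3⟩ := hK U x hx
  have hv : ∀ y ∈ (K (ket x)).support, Valid U Q y := fun y hy => valid_of_mem h1 hy
  refine ⟨?_, ?_, ?_⟩
  · exact map_VSpace (fun y hy => (hL U y hy).1) h1
  · intro z
    rw [LinearMap.comp_apply, apply_eq_sum, Finsupp.finsetSum_apply]
    refine Finset.sum_nonneg fun y hy => ?_
    rw [Finsupp.smul_apply, smul_eq_mul]
    exact mul_nonneg (h2 y) ((hL U y (hv y hy)).2.1 z)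
  · have hL' : ∀ y, ∃ r : NNReal, Valid U Q y → emb (injArr U Q y ≫ s : Arr [U] R) =
        denote U R (L (ket y)) + r • emb (zeroArr U R) := by
      intro y
      by_cases hy : Valid U Q y
      · obtain ⟨-, -, r, hr⟩ := hL U y hy
        exact ⟨r, fun _ => hr⟩
      · exact ⟨0, fun h => absurd h hy⟩
    choose r' hr' using hL'
    refine ⟨∑ y ∈ (K (ket x)).support, (K (ket x) y).toNNReal * r' y + r, ?_⟩
    -- Postcomposition with `s`, as a linear map of cones, is applied to the expansion of `inj ; t`.
    have h4 := congrArg (Cone.map (fun a : Arr [U] Q => (a ≫ s : Arr [U] R))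
      fun p a b => convex_comp p a b s) h3
    rw [map_emb, map_add, map_smul, map_emb, zeroArr_comp, denote_eq_sum _ _ h2, map_sum] at h4
    rw [← comp_assoc, h4, LinearMap.comp_apply,
      denote_apply _ _ L h2 fun y hy => (hL U y (hv y hy)).2.1, add_smul, ← add_assoc,
      Finset.sum_smul, ← Finset.sum_add_distrib]
    congr 1
    refine Finset.sum_congr rfl fun y hy => ?_
    rw [map_smul, map_emb, hr' y (hv y hy), smul_add, smul_smul]

theorem Denotes.inl (P Q : List C) : Denotes LinearMap.id (ofTerm (inl P Q)) :=
  .of_ket id fun _ _ hx => ⟨valid_inl Q hx, rfl,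
    FreeHom.sound ((comp_inl _ Q).trans (inj_append_left Q hx).symm)⟩

theorem Denotes.inr (P Q : List C) : Denotes (shift P.length) (ofTerm (inr P Q)) :=
  .of_ket (fun x => (P.length + x.1, x.2)) fun _ x hx => ⟨valid_inr P hx, shift_ket _ _,
    FreeHom.sound ((comp_inr _ P).trans (inj_append_right P x).symm)⟩

/-- An injection into a sum lands in one summand. Followed by `t₁ ⊕ t₂` it becomes the injection
into that summand, its component, and a coproduct injection, so the claim reduces to composition
with `inl` or `inr`. -/
theorem Denotes.sum {P₁ P₂ Q₁ Q₂ : List C} {t₁ : TapeTerm C P₁ Q₁} {t₂ : TapeTerm C P₂ Q₂}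
    (h₁ : Denotes (StMat.act (interp t₁)) (ofTerm t₁))
    (h₂ : Denotes (StMat.act (interp t₂)) (ofTerm t₂)) :
    Denotes (StMat.act (interp (t₁.tensor t₂))) (ofTerm (t₁.tensor t₂)) := by
  intro U x hx
  rcases valid_append_iff.1 hx with hx | ⟨hl, hx⟩
  · rw [act_interp_tensor_inl _ _ (VSpace_le_WSpace _ _ (ket_mem hx))]
    have := (h₁.comp (Denotes.inl Q₁ Q₂)) U x hx
    have e : (injArr U (P₁ ++ P₂) x ≫ ofTerm (t₁.tensor t₂) : Arr [U] (Q₁ ++ Q₂)) =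
        (injArr U P₁ x ≫ (ofTerm t₁ ≫ ofTerm (TapeTerm.inl Q₁ Q₂) : Arr P₁ (Q₁ ++ Q₂)) :
          Arr [U] (Q₁ ++ Q₂)) := by
      rw [← comp_assoc]
      refine FreeHom.sound ?_
      refine (Eqv.comp (inj_append_left P₂ hx) (.refl _)).trans ((tensor_cobang_comp _ _ _).trans ?_)
      exact (comp_inl _ Q₂).symm
    rw [e]
    exact this
  · have h0 : shift P₁.length (ket (x.1 - P₁.length, x.2)) = ket x := by
      rw [shift_ket, Nat.add_sub_cancel' hl]
    rw [← h0, act_interp_tensor_inr _ _ (VSpace_le_WSpace _ _ (ket_mem hx))]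
    have := (h₂.comp (Denotes.inr Q₁ Q₂)) U _ hx
    have e : (injArr U (P₁ ++ P₂) x ≫ ofTerm (t₁.tensor t₂) : Arr [U] (Q₁ ++ Q₂)) =
        (injArr U P₂ (x.1 - P₁.length, x.2) ≫
          (ofTerm t₂ ≫ ofTerm (TapeTerm.inr Q₁ Q₂) : Arr P₂ (Q₁ ++ Q₂)) :
          Arr [U] (Q₁ ++ Q₂)) := by
      rw [← comp_assoc]
      refine FreeHom.sound ?_
      have h1 := inj_append_right (U := U) P₁ (Q := P₂) (x.1 - P₁.length, x.2)
      simp only [Nat.add_sub_cancel' hl] at h1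
      refine (Eqv.comp h1 (.refl _)).trans ((cobang_tensor_comp _ _ _).trans ?_)
      exact (comp_inr _ Q₁).symm
    rw [e]
    exact this

theorem valid_single {U V : C} {x : ℕ × AnyHom C} (h : Valid U [V] x) :
    ∃ g : U ⟶ V, x = (0, ⟨U, V, g⟩) := by
  obtain ⟨n, f⟩ := x
  obtain rfl : n = 0 := by have := valid_lt h; simpa using this
  obtain ⟨g, rfl⟩ := valid_zero h
  exact ⟨g, rfl⟩

theorem injArr_single {U V : C} (g : U ⟶ V) : injArr U [V] (0, ⟨U, V, g⟩) = tape g :=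
  FreeHom.sound ((inj_zero [] g).trans (.tensor_idZero _))

/-- Only `split` creates a proper combination and only `bang` loses mass. The generators `codiag`
and `tape` send injections to injections, and `cobang` has no injections to test. -/
theorem denotes_gen {P Q : List C} (s : TapeGen C P Q) :
    Denotes (StMat.act (interp (.gen s))) (ofTerm (.gen s)) := by
  cases s with
  | split p V =>
    intro U x hx
    obtain ⟨g, rfl⟩ := valid_single hx
    have hm : ket (0, ⟨U, V, g⟩) ∈ WSpace [V] := VSpace_le_WSpace _ _ (ket_mem hx)
    have e : StMat.act (interp (.gen (.split p V))) (ket (0, ⟨U, V, g⟩)) =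
        p.1 • ket (0, ⟨U, V, g⟩) + (1 - p.1) • ket (1, ⟨U, V, g⟩) := by
      refine (act_split _ _ hm).trans ?_
      rw [shift_ket]
      rfl
    have hp := p.2.1.le
    have hp' : 0 ≤ 1 - p.1 := by linarith [p.2.2]
    have hx' : Valid U [V, V] (0, ⟨U, V, g⟩) := ⟨rfl, rfl⟩
    have hx'' : Valid U [V, V] (1, ⟨U, V, g⟩) := ⟨rfl, rfl⟩
    rw [e]
    refine ⟨add_mem (Submodule.smul_mem _ _ (ket_mem hx')) (Submodule.smul_mem _ _ (ket_mem hx'')),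
      fun y => ?_, 0, ?_⟩
    · rw [Finsupp.add_apply, Finsupp.smul_apply, Finsupp.smul_apply]
      exact add_nonneg (mul_nonneg hp (ket_nonneg _ _)) (mul_nonneg hp' (ket_nonneg _ _))
    · have h1 : (ofTerm (.gen (.split p V)) : Arr [V] [V, V]) = ofTerm (split p [V]) := by
        refine FreeHom.sound (Eqv.symm ?_)
        refine comp_idW (Q' := [V, V]) (Eqv.tensor_idZero (gen (TapeGen.split p V))) (castT_left ?_)
        refine Eqv.tensor (.refl _) ?_
        exact (Eqv.tensor_idZero _).trans (symmW_nil_right [V])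
      have h2 : (injArr U [V] (0, ⟨U, V, g⟩) ≫ ofTerm (.gen (.split p V)) : Arr [U] [V, V]) =
          ConvexAlgebra.op p (injArr U [V, V] (0, ⟨U, V, g⟩)) (injArr U [V, V] (1, ⟨U, V, g⟩)) := by
        rw [h1, split_nat, injArr_single]
        refine FreeHom.sound (Eqv.comp (.refl _) (Eqv.symm ?_))
        refine Eqv.trans (Eqv.comp ?_ (.refl _)) (copair_inj (gen (.tape g)) (gen (.tape g)))
        refine Eqv.tensor (inj_zero [V] g) ?_
        refine (inj_succ [V] 0 _).trans (Eqv.tensor (.refl _) ?_)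
        exact (inj_zero [] g).trans (.tensor_idZero _)
      rw [h2, emb_op, zero_smul, add_zero]
      -- Both coefficients are nonnegative, so here taking nonnegative parts is additive.
      have h4 : nnPart (p.1 • ket (0, ⟨U, V, g⟩) + (1 - p.1) • ket (1, ⟨U, V, g⟩)) =
          p.1.toNNReal • Finsupp.single (0, ⟨U, V, g⟩) 1 +
            (1 - p.1).toNNReal • Finsupp.single (1, ⟨U, V, g⟩) 1 := by
        refine Finsupp.ext fun z => ?_
        rw [nnPart, Finsupp.mapRange_apply, Finsupp.add_apply, Finsupp.smul_apply,
          Finsupp.smul_apply, smul_eq_mul, smul_eq_mul,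
          Real.toNNReal_add (mul_nonneg hp (ket_nonneg _ _)) (mul_nonneg hp' (ket_nonneg _ _)),
          Real.toNNReal_mul hp, Real.toNNReal_mul hp', Finsupp.add_apply, Finsupp.smul_apply,
          Finsupp.smul_apply, ← nnPart_ket, ← nnPart_ket]
        rfl
      rw [denote, h4, map_add, map_smul, map_smul, Finsupp.linearCombination_single,
        Finsupp.linearCombination_single, one_smul, one_smul]
  | bang V =>
    intro U x hx
    obtain ⟨g, rfl⟩ := valid_single hx
    have e : StMat.act (interp (.gen (.bang V))) (ket (0, ⟨U, V, g⟩)) = 0 := act_bang _ _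
    rw [e]
    -- The column is empty, so all of the mass goes to the zero arrow.
    refine ⟨zero_mem _, fun _ => le_rfl, 1, ?_⟩
    rw [denote_zero, zero_add, one_smul, injArr_single]
    refine congrArg emb (FreeHom.sound ?_)
    refine (Eqv.comp (.refl _) (Eqv.tensor_idZero (gen (TapeGen.bang V))).symm).trans ?_
    refine (Eqv.ax (.bang_nat (gen (.tape g)))).trans ?_
    exact (Eqv.comp_id _).symm
  | cobang V => exact fun U x hx => absurd hx valid_nil
  | codiag V =>
    refine .of_ket (fun x => (0, x.2)) fun U x hx => ?_
    have h1 : Eqv (TapeAx C) (gen (.codiag V)) (codiag [V]) := by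
      refine Eqv.symm ((Eqv.comp (castT_left ?_) (.refl _)).trans
        ((Eqv.id_comp (P := [V] ++ [V])
          (tensor (gen (.codiag V)) (codiag []) : TapeTerm C ([V, V] ++ []) ([V] ++ []))).trans
            (.tensor_idZero _)))
      refine (Eqv.tensor (.refl _) ((Eqv.tensor_idZero _).trans (.refl _))).trans ?_
      exact Eqv.tensor (.refl _) (castT_left (.refl _))
    obtain ⟨n, f⟩ := x
    cases n with
    | zero =>
      obtain ⟨g, rfl⟩ := valid_zero hx
      have hx' : Valid U [V] (0, ⟨U, V, g⟩) := ⟨rfl, rfl⟩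
      refine ⟨hx', act_codiag_inl _ (VSpace_le_WSpace _ _ (ket_mem hx')), ?_⟩
      refine Eq.trans ?_ (injArr_single g).symm
      exact FreeHom.sound ((Eqv.comp (inj_zero [V] g) h1).trans (tensor_cobang_codiag _))
    | succ n =>
      obtain ⟨g, hg⟩ := valid_single (valid_succ hx)
      obtain ⟨rfl, rfl⟩ := Prod.mk.inj hg
      have hx' : Valid U [V] (0, ⟨U, V, g⟩) := ⟨rfl, rfl⟩
      refine ⟨hx', ?_, ?_⟩
      · have := act_codiag_inr V (VSpace_le_WSpace _ _ (ket_mem hx'))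
        rw [shift_ket] at this
        exact this
      refine Eq.trans ?_ (injArr_single g).symm
      refine FreeHom.sound ((Eqv.comp ((inj_succ [V] 0 _).trans (Eqv.tensor (.refl _)
        ((inj_zero [] g).trans (.tensor_idZero _)))) h1).trans (cobang_tensor_codiag _))
  | @tape V W c =>
    refine .of_ket (fun x => (0, x.2.comp ⟨V, W, c⟩)) fun U x hx => ?_
    obtain ⟨g, rfl⟩ := valid_single hx
    refine ⟨⟨by rw [AnyHom.comp_mk], by simp⟩, ?_, ?_⟩
    · rw [AnyHom.comp_mk]
      exact act_tape c g
    · simp only [AnyHom.comp_mk]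
      rw [injArr_single, injArr_single]
      exact (FreeHom.sound (.ax (.tape_comp g c))).symm

theorem Denotes.ident (P : List C) {K : Vec C →ₗ[ℝ] Vec C}
    (hK : ∀ U x, Valid U P x → K (ket x) = ket x) : Denotes K (ident P) :=
  .of_ket id fun U x hx => ⟨hx, hK U x hx, comp_id _⟩

theorem denotes_symm (V W : C) :
    Denotes (StMat.act (interp (.symm V W))) (ofTerm (.symm V W)) := by
  -- The exchange of the positions `0` and `1`.
  refine .of_ket (fun x => (1 - x.1, x.2)) fun U x hx => ?_
  have h1 : Eqv (TapeAx C) (.symm V W) (symmW [V] [W]) := (symmW_single V W).symm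
  obtain ⟨n, f⟩ := x
  cases n with
  | zero =>
    obtain ⟨g, rfl⟩ := valid_zero hx
    have hx' : Valid U [V] (0, ⟨U, V, g⟩) := ⟨rfl, rfl⟩
    refine ⟨⟨rfl, rfl⟩, ?_, ?_⟩
    · refine (StMat.act_sumSymm_inl [V] [W] (VSpace_le_WSpace _ _ (ket_mem hx'))).trans ?_
      rw [shift_ket]; rfl
    · refine FreeHom.sound ((Eqv.comp (inj_zero [W] g) h1).trans ?_)
      refine (Eqv.exact (FreeHom.symm_nat (FreeHom.mk (gen (.tape g)))
        (FreeHom.mk (cobang [W])))).trans ?_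
      refine (Eqv.comp (symmW_nil_right [U])
        (.refl ((cobang [W]).tensor (gen (.tape g))))).trans ?_
      refine (Eqv.id_comp ((cobang [W]).tensor (gen (.tape g)))).trans ?_
      refine Eqv.trans ?_ (inj_succ [V] 0 _).symm
      exact Eqv.tensor (.refl _) ((inj_zero [] g).trans (.tensor_idZero _)).symm
  | succ n =>
    obtain ⟨g, hg⟩ := valid_single (valid_succ hx)
    obtain ⟨rfl, rfl⟩ := Prod.mk.inj hg
    have hx' : Valid U [W] (0, ⟨U, W, g⟩) := ⟨rfl, rfl⟩
    refine ⟨⟨rfl, rfl⟩, ?_, ?_⟩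
    · have := StMat.act_sumSymm_inr [V] [W] (VSpace_le_WSpace _ _ (ket_mem hx'))
      rw [shift_ket] at this
      exact this
    · refine FreeHom.sound ((Eqv.comp ((inj_succ [W] 0 _).trans (Eqv.tensor (.refl _)
        ((inj_zero [] g).trans (.tensor_idZero _)))) h1).trans ?_)
      refine (Eqv.exact (FreeHom.symm_nat (FreeHom.mk (cobang [V]))
        (FreeHom.mk (gen (.tape g))))).trans ?_
      refine (Eqv.comp (castT_left (.refl _))
        (.refl ((gen (.tape g)).tensor (cobang [V])))).trans ?_
      exact (Eqv.id_comp ((gen (.tape g)).tensor (cobang [V]))).trans (inj_zero [V] g).symm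

/-- The normal form of tapes: restricted to a monomial, a tape is a combination of injections, with
coefficients read off from its matrix, and of the zero arrow. -/
theorem denotes_interp {P Q : List C} (t : TapeTerm C P Q) :
    Denotes (StMat.act (interp t)) (ofTerm t) := by
  induction t with
  | idZero => exact fun U x hx => absurd hx valid_nil
  | id A =>
    have e : (ofTerm (.id A) : Arr [A] [A]) = ident [A] :=
      FreeHom.sound (Term.id_tensor_nil A).symm
    rw [e]
    exact Denotes.ident [A] fun U x hx =>
      StMat.act_ident (VSpace_le_WSpace _ _ (ket_mem hx))
  | symm A B => exact denotes_symm A B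
  | gen s => exact denotes_gen s
  | comp f g ihf ihg =>
    exact (ihf.comp ihg).congr fun U x hx => act_interp_comp f g (VSpace_le_WSpace _ _ (ket_mem hx))
  | tensor f g ihf ihg => exact Denotes.sum ihf ihg

/-- The injections are jointly epic. -/
theorem eqv_of_inj {P Q : List C} {t s : TapeTerm C P Q}
    (h : ∀ U x, Valid U P x → Eqv (TapeAx C) ((inj U P x).comp t) ((inj U P x).comp s)) :
    Eqv (TapeAx C) t s := by
  induction P with
  | nil =>
    have e : ∀ t : TapeTerm C [] Q, Eqv (TapeAx C) t (cobang Q) := fun t =>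
      (Eqv.id_comp t).symm.trans (.ax (.cobang_nat t))
    exact (e t).trans (e s).symm
  | cons V P ih =>
    have hl : Eqv (TapeAx C) (inl [V] P) (inj V (V :: P) (0, ⟨V, V, 𝟙 V⟩)) := by
      refine Eqv.trans ?_ (inj_zero P (𝟙 V)).symm
      exact (castT_left (.refl _)).trans (Eqv.tensor (Eqv.ax (.tape_id V)).symm (.refl _))
    -- The universal property of the coproduct: the copairing of the injections is the identity, so
    -- naturality of `codiag` rebuilds `t` from its restrictions to the first letter and to the
    -- rest.
    have e : ∀ t : TapeTerm C (V :: P) Q, Eqv (TapeAx C) t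
        ((((inl [V] P).comp t).tensor ((inr [V] P).comp t)).comp (codiag Q)) := by
      intro t
      have h1 : Eqv (TapeAx C) (((inl [V] P).tensor (inr [V] P)).comp (codiag ([V] ++ P)))
          (idW ([V] ++ P)) := by
        refine Eqv.trans (Eqv.comp (Eqv.tensor (castT_left (.refl _)) (.refl _)) (.refl _)) ?_
        exact (copair_inj (idW [V]) (idW P)).trans (idW_tensor_idW [V] P)
      refine (Eqv.id_comp t).symm.trans ((Eqv.comp h1.symm (.refl t)).trans ?_)
      refine (Eqv.comp_assoc _ _ _).trans ((Eqv.comp (.refl _) (.ax (.codiag_nat t))).trans ?_)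
      refine (Eqv.comp_assoc _ _ _).symm.trans (Eqv.comp ?_ (.refl _))
      exact Eqv.interchange _ _ _ _
    refine (e t).trans (Eqv.trans ?_ (e s).symm)
    refine Eqv.comp (Eqv.tensor ?_ (ih fun U x hx => ?_)) (.refl _)
    · exact (Eqv.comp hl (.refl t)).trans ((h V _ ⟨rfl, rfl⟩).trans (Eqv.comp hl (.refl s)).symm)
    · have h1 : Eqv (TapeAx C) ((inj U P x).comp (inr [V] P)) (inj U (V :: P) (x.1 + 1, x.2)) :=
        comp_inr _ [V]
      have hx' : Valid U (V :: P) (x.1 + 1, x.2) := ⟨hx.1, by simpa using hx.2⟩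
      refine (Eqv.comp_assoc _ _ _).symm.trans ((Eqv.comp h1 (.refl t)).trans
        ((h U _ hx').trans ?_))
      exact (Eqv.comp h1 (.refl s)).symm.trans (Eqv.comp_assoc _ _ _)

/-- Equal matrices give expansions that may differ only in the coefficient of the zero arrow. Both
expansions have weight one, and nonnegative reals cancel, so these coefficients agree too. -/
theorem eqv_of_interp {P Q : List C} {t s : TapeTerm C P Q} (h : interp t = interp s) :
    Eqv (TapeAx C) t s := by
  refine eqv_of_inj fun U x hx => Eqv.exact (emb_injective (A := Arr [U] Q) ?_)
  obtain ⟨-, -, r, hr⟩ := denotes_interp t U x hx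
  obtain ⟨-, -, r', hr'⟩ := denotes_interp s U x hx
  rw [← h] at hr'
  have w := congrArg weight hr
  have w' := congrArg weight hr'
  rw [weight_emb, map_add, map_smul, weight_emb, smul_eq_mul, mul_one] at w w'
  obtain rfl : r = r' := add_left_cancel (w.symm.trans w')
  exact hr.trans hr'.symm

end TapeCat

theorem interpFunctor_map_injective {P Q : List C} {t s : TapeCat.Arr P Q}
    (h : (interpFunctor C).map t = (interpFunctor C).map s) : t = s := by
  induction t using Quot.ind
  induction s using Quot.ind
  exact FreeHom.sound (TapeCat.eqv_of_interp h)

end TapeDiagrams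

namespace TapeDiagrams

variable {C : Type u} [Category.{v} C]

/-! ### Fullness of the interpretation -/

namespace TapeTerm

open Term StMat

theorem valid_id (U : C) : Valid U [U] (0, AnyHom.id U) := ⟨rfl, rfl⟩

theorem ket_id_mem (U : C) : ket (0, AnyHom.id U) ∈ WSpace [U] :=
  VSpace_le_WSpace _ _ (ket_mem (valid_id U))

/-- The vectors presented by tapes with a single source. -/
def presented (U : C) (Q : List C) : Set (Vec C) :=
  {v | ∃ t : TapeTerm C [U] Q, act (interp t) (ket (0, AnyHom.id U)) = v}

theorem zero_mem_presented (U : C) (Q : List C) : (0 : Vec C) ∈ presented U Q :=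
  ⟨(bang [U]).comp (cobang Q), by
    rw [act_interp_comp _ _ (ket_id_mem U), act_interp_bang _ (ket_id_mem U), map_zero]⟩

theorem act_interp_congr {P Q P' Q' : List C} {f : TapeTerm C P Q} {g : TapeTerm C P' Q'}
    (h : Eqv (TapeAx C) f g) : act (interp f) = act (interp g) :=
  act_congr h.type_eq.1 h.type_eq.2 (interp_eqv h)

/-- Basis vectors are presented by the injections. They are the extreme points for the convexity
argument. -/
theorem act_interp_inj {U : C} {Q : List C} {y : ℕ × AnyHom C} (hy : Valid U Q y) :
    act (interp (inj U Q y)) (ket (0, AnyHom.id U)) = ket y := by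
  induction Q generalizing y with
  | nil => exact absurd hy valid_nil
  | cons V Q ih =>
    obtain ⟨n, f⟩ := y
    cases n with
    | zero =>
      obtain ⟨g, rfl⟩ := valid_zero hy
      rw [act_interp_congr (inj_zero Q g), act_interp_tensor_inl _ _ (ket_id_mem U)]
      refine (act_tape g (𝟙 U)).trans ?_
      rw [Category.id_comp]
    | succ n =>
      have := act_interp_tensor_inr (cobang [V]) (inj U Q (n, f)) (ket_id_mem U)
      rw [List.length_nil, shift_zero, ih (valid_succ hy), shift_ket] at this
      refine (LinearMap.congr_fun (act_interp_congr (inj_succ Q n f)) _).trans (this.trans ?_)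
      simp [Nat.add_comm]

/-- Given tapes `s` and `t` for two vectors, `split` followed by `s ⊕ t` and `codiag` presents their
combination. Open parameters suffice for convexity. -/
theorem convex_presented (U : C) (Q : List C) : Convex ℝ (presented U Q) := by
  rw [convex_iff_forall_pos]
  rintro _ ⟨s, rfl⟩ _ ⟨t, rfl⟩ a b ha hb hab
  let p : OpenUnit := ⟨a, ha, by linarith⟩
  refine ⟨(split p [U]).comp ((s.tensor t).comp (codiag Q)), ?_⟩
  have hU := ket_id_mem U
  have hU' := inl_mem_WSpace [U] hU
  have hU'' := shift_mem_WSpace [U] hU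
  rw [act_interp_comp _ _ hU, act_interp_split p [U] hU, map_add, map_smul, map_smul,
    act_interp_comp _ _ hU', act_interp_comp _ _ hU'', act_interp_tensor_inl _ _ hU,
    act_interp_tensor_inr _ _ hU, act_interp_codiag_inl _ (act_mem_WSpace _ hU),
    act_interp_codiag_inr _ (act_mem_WSpace _ hU)]
  have hb' : (1 - p.1 : ℝ) = b := by change 1 - a = b; linarith
  rw [hb']

/-- A nonzero `v` is its total mass times a centre of mass of basis vectors, and the mass is at most
one, so `v` lies between that centre and zero. Mass zero is treated apart, since the centre of mass
divides by it. -/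
theorem mem_presented {U : C} {Q : List C} {v : Vec C} (hv : v ∈ VSpace U Q)
    (h0 : ∀ y, 0 ≤ v y) (h1 : (v.sum fun _ a => a) ≤ 1) : v ∈ presented U Q := by
  have hsum : v = ∑ y ∈ v.support, v y • ket y := by
    simpa using apply_eq_sum LinearMap.id v
  rcases (Finset.sum_nonneg fun y (_ : y ∈ v.support) => h0 y).eq_or_lt with hm | hm
  · have : v = 0 := by
      rw [hsum]
      refine Finset.sum_eq_zero fun y hy => ?_
      rw [(Finset.sum_eq_zero_iff_of_nonneg fun y _ => h0 y).1 hm.symm y hy, zero_smul]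
    rw [this]
    exact zero_mem_presented U Q
  · have hc := (convex_presented U Q).centerMass_mem (t := v.support) (w := v) (z := fun y => ket y)
      (fun y _ => h0 y) hm fun y hy => ⟨_, act_interp_inj (valid_of_mem hv hy)⟩
    have := (convex_presented U Q).smul_mem_of_zero_mem (zero_mem_presented U Q) hc
      ⟨hm.le, h1⟩
    rw [Finset.centerMass, smul_smul, mul_inv_cancel₀ hm.ne', one_smul, ← hsum] at this
    exact this

/-- Tapes for the individual columns are assembled by copairing, one letter of the source at a time.
-/
theorem exists_of_presented {P Q : List C} (w : ℕ → Vec C)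
    (h : ∀ i U, P[i]? = some U → w i ∈ presented U Q) :
    ∃ t : TapeTerm C P Q, ∀ i U, P[i]? = some U →
      act (interp t) (ket (i, AnyHom.id U)) = w i := by
  induction P generalizing w with
  | nil => exact ⟨cobang Q, fun i U hi => by simp at hi⟩
  | cons V P ih =>
    obtain ⟨t, ht⟩ := ih (fun i => w (i + 1)) fun i U hi => h (i + 1) U (by simpa using hi)
    obtain ⟨s, hs⟩ := h 0 V rfl
    refine ⟨((s.tensor t).comp (codiag Q) : TapeTerm C ([V] ++ P) Q), fun i U hi => ?_⟩
    cases i with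
    | zero =>
      obtain rfl : V = U := by simpa using hi
      have hV := ket_id_mem V
      rw [act_interp_comp _ _ (inl_mem_WSpace P hV), act_interp_tensor_inl _ _ hV, hs,
        act_interp_codiag_inl _ (hs ▸ act_mem_WSpace _ hV)]
    | succ i =>
      have hi' : P[i]? = some U := by simpa using hi
      have hU : ket (i, AnyHom.id U) ∈ WSpace P :=
        VSpace_le_WSpace U _ (ket_mem ⟨rfl, hi'⟩)
      have e : ket (i + 1, AnyHom.id U) = shift [V].length (ket (i, AnyHom.id U)) := by
        rw [shift_ket, List.length_singleton, Nat.add_comm]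
      rw [e, act_interp_comp _ _ (shift_mem_WSpace [V] hU), act_interp_tensor_inr _ _ hU,
        act_interp_codiag_inr _ (act_mem_WSpace _ hU), ht i U hi']

theorem exists_interp {P Q : List C} (M : StMat.Arr P Q) : ∃ t : TapeTerm C P Q, interp t = M := by
  -- The columns are chosen as a function on all natural numbers, with zero beyond the length of
  -- `P`.
  have hw : ∀ i, ∃ v, ∀ U, P[i]? = some U → v = act M (ket (i, AnyHom.id U)) := by
    intro i
    cases h : P[i]? with
    | none => exact ⟨0, fun U hU => by simp at hU⟩
    | some V => exact ⟨act M (ket (i, AnyHom.id V)), fun U hU => by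
        obtain rfl : V = U := by simpa using hU
        rfl⟩
  choose w hw using hw
  obtain ⟨t, ht⟩ := exists_of_presented (P := P) (Q := Q) w fun i U hi => by
    rw [hw i U hi]
    exact mem_presented (act_mem M (ket_mem ⟨rfl, hi⟩)) (fun y => act_ket_nonneg _ _ _)
      (act_ket_mass_le _ _)
  refine ⟨t, hom_ext_act ?_⟩
  rintro _ ⟨i, U, hi, rfl⟩
  rw [ht i U hi, hw i U hi]

end TapeTerm

theorem interpFunctor_map_surjective {P Q : List C} (M : StMat.Arr P Q) :
    ∃ t : TapeCat.Arr P Q, (interpFunctor C).map t = M := by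
  obtain ⟨t, ht⟩ := TapeTerm.exists_interp M
  exact ⟨TapeCat.ofTerm t, ht⟩

/-- The arrow of tapes presenting a matrix. -/
noncomputable def interpInv {P Q : List C} (M : StMat.Arr P Q) : TapeCat.Arr P Q :=
  (interpFunctor_map_surjective M).choose

theorem map_interpInv {P Q : List C} (M : StMat.Arr P Q) :
    (interpFunctor C).map (interpInv M) = M :=
  (interpFunctor_map_surjective M).choose_spec

/-- The inverse of the interpretation functor. -/
noncomputable def interpInvFunctor (C : Type u) [Category.{v} C] : StMat C ⥤ TapeCat C where
  obj P := P
  map M := interpInv M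
  map_id P := by
    refine interpFunctor_map_injective ?_
    refine (map_interpInv _).trans ?_
    exact ((interpFunctor C).map_id P).symm
  map_comp M N := by
    refine interpFunctor_map_injective ?_
    refine (map_interpInv _).trans ?_
    refine Eq.trans ?_ ((interpFunctor C).map_comp _ _).symm
    exact (congrArg₂ StMat.comp (map_interpInv M) (map_interpInv N)).symm

theorem interpFunctor_comp_inv :
    interpFunctor C ⋙ interpInvFunctor C = 𝟭 (TapeCat C) :=
  Functor.hext (fun _ => rfl) fun _ _ _ => heq_of_eq (interpFunctor_map_injective (map_interpInv _))

theorem interpInvFunctor_comp :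
    interpInvFunctor C ⋙ interpFunctor C = 𝟭 (StMat C) :=
  Functor.hext (fun _ => rfl) fun _ _ M => heq_of_eq (map_interpInv M)

theorem interpFunctor_isInterpretation : IsInterpretation (interpFunctor C) where
  obj _ := rfl
  tape _ := heq_of_eq rfl
  split _ _ := heq_of_eq rfl
  bang _ := heq_of_eq rfl
  cobang _ := heq_of_eq rfl
  codiag _ := heq_of_eq rfl

end TapeDiagrams

namespace TapeDiagrams

/-! ### The symmetric monoidal structure of string diagrams -/

namespace Term

variable {S : Type u} {G : List S → List S → Type w}
  {E : ∀ {P Q : List S}, Term G P Q → Term G P Q → Prop}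

/-- One hexagon, by induction on the argument along which the symmetry of words is defined
recursively. -/
theorem symmW_append_left (P P' Q : List S) :
    Eqv E (symmW (P ++ P') Q : Term G _ _)
      (((idW P).tensor (symmW P' Q)).comp
        (castT (List.append_assoc _ _ _) rfl ((symmW P Q).tensor (idW P')))) := by
  induction P with
  | nil =>
    refine Eqv.symm ((Eqv.comp (Eqv.idZero_tensor (symmW P' Q)) ?_).trans (.comp_id _))
    exact castT_left ((Eqv.tensor (castT_left (.refl _)) (.refl _)).trans (idW_tensor_idW Q P'))
  | cons A P ih =>
    have h1 : Eqv E (symmW (A :: P ++ P') Q : Term G _ _)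
        (((idW [A]).tensor (((idW P).tensor (symmW P' Q)).comp
          (castT (List.append_assoc _ _ _) rfl ((symmW P Q).tensor (idW P'))))).comp
          (castT (by simp) (by simp)
            (((symmL A Q).tensor (idW P)).tensor (idW P')) :
              Term G ([A] ++ ((Q ++ P) ++ P')) (Q ++ (A :: (P ++ P'))))) := by
      refine Eqv.comp (Eqv.tensor (id_tensor_nil A).symm ih) (castT_left (castT_right ?_))
      exact (Eqv.tensor (.refl _) (idW_tensor_idW P P').symm).trans (Eqv.tensor_assoc _ _ _).symm
    refine h1.trans ((Eqv.comp (tensor_comp_right' _ _ _) (.refl _)).trans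
      ((Eqv.comp_assoc _ _ _).trans (Eqv.comp ?_ ?_)))
    · exact (Eqv.tensor (id_tensor_nil A) (.refl _)).trans (Eqv.tensor_assoc _ _ _).symm
    · refine castT_right (Eqv.trans ?_ (tensor_comp_left _ _ _).symm)
      refine Eqv.comp ?_ (castT_left (Eqv.tensor (castT_right (.refl _)) (.refl _)))
      exact (Eqv.tensor (id_tensor_nil A) (castT_left (.refl _))).trans (Eqv.tensor_assoc _ _ _).symm

/-- The other hexagon follows by inverting the first: the right side is an inverse of `symmW (Q ++
R) P`, and so is `symmW P (Q ++ R)`. -/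
theorem symmW_append_right (P Q R : List S) :
    Eqv E (symmW P (Q ++ R) : Term G _ _)
      (((symmW P Q).tensor (idW R)).comp
        (castT (List.append_assoc _ _ _).symm rfl ((idW Q).tensor (symmW P R)))) := by
  have hb : Eqv E (((idW Q).tensor (symmW R P)).comp ((idW Q).tensor (symmW P R)))
      (idW (Q ++ (R ++ P)) : Term G _ _) := by
    refine (Eqv.interchange _ _ _ _).trans ((Eqv.tensor (.id_comp _) (.symm_symm R P)).trans ?_)
    exact idW_tensor_idW _ _
  have ha : Eqv E (((symmW Q P).tensor (idW R)).comp ((symmW P Q).tensor (idW R)))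
      (idW ((Q ++ P) ++ R) : Term G _ _) := by
    refine (Eqv.interchange _ _ _ _).trans ((Eqv.tensor (.symm_symm Q P) (.id_comp _)).trans ?_)
    exact idW_tensor_idW _ _
  -- After expansion of the first factor the inner symmetries cancel by `ha`, and the outer ones by
  -- `hb`.
  have hy : Eqv E ((symmW (Q ++ R) P).comp (castT (List.append_assoc _ _ _) rfl
      (((symmW P Q).tensor (idW R)).comp
        (castT (List.append_assoc _ _ _).symm rfl ((idW Q).tensor (symmW P R))))))
      (idW (Q ++ (R ++ P)) : Term G _ _) := by
    refine (Eqv.comp (symmW_append_left Q R P) (castT_left (.refl _))).trans ?_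
    refine (Eqv.comp_assoc _ _ _).trans ((Eqv.comp (.refl _) (Eqv.trans ?_ (Eqv.id_comp
      ((idW Q).tensor (symmW P R))))).trans hb)
    refine (Eqv.comp (castT_left (.refl ((symmW Q P).tensor (idW R)))) (.refl _)).trans
      ((Eqv.comp_assoc _ _ _).symm.trans ?_)
    exact Eqv.comp (ha.trans (idW_congr (List.append_assoc _ _ _))) (castT_left (.refl _))
  refine (Eqv.comp_id _).symm.trans ((Eqv.comp (.refl _)
    ((idW_congr (List.append_assoc _ _ _)).trans hy.symm)).trans ?_)
  refine (Eqv.comp (.refl _) (Eqv.comp (.refl _) (castT_left (castT_right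
    (hP := (List.append_assoc P Q R)) (hQ := rfl) (.refl _))))).trans ?_
  refine (Eqv.comp_assoc _ _ _).symm.trans ((Eqv.comp (.symm_symm _ _) (.refl _)).trans ?_)
  exact (Eqv.id_comp _).trans (castT_left (.refl _))

end Term

namespace Diag

variable {T : MonoidalTheory.{u, v}}

/-- The class of a term. -/
abbrev ofTerm {U V : List T.Sorts} (f : Term T.TypedGen U V) :
    @Quiver.Hom (Diag T) _ U V :=
  FreeHom.mk f

/-- The congruence relates terms of different types. Bundling turns this into an equality, so the
strict monoidal laws hold for bundled arrows without casts. -/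
theorem any_eq {U V U' V' : List T.Sorts} {f : Term T.TypedGen U V} {g : Term T.TypedGen U' V'}
    (h : Term.Eqv (fun f g => T.E (FreeHom.mk f) (FreeHom.mk g)) f g) :
    (⟨U, V, ofTerm f⟩ : AnyHom (Diag T)) = ⟨U', V', ofTerm g⟩ := by
  obtain ⟨rfl, rfl⟩ := h.type_eq
  rw [show ofTerm f = ofTerm g from FreeHom.sound h]

end Diag

namespace AnyHom

open Diag

variable {T : MonoidalTheory.{u, v}}

/-- The monoidal product of arrows. -/
def tens (f g : AnyHom (Diag T)) : AnyHom (Diag T) :=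
  ⟨Diag.mul f.src g.src, Diag.mul f.tgt g.tgt, Diag.tensor f.hom g.hom⟩

theorem exists_term (f : AnyHom (Diag T)) :
    ∃ (U V : List T.Sorts) (t : Term T.TypedGen U V), f = ⟨U, V, Diag.ofTerm t⟩ := by
  obtain ⟨U, V, f⟩ := f
  induction f using Quot.ind with | _ t => ?_
  exact ⟨U, V, t, rfl⟩

theorem tens_assoc (f g h : AnyHom (Diag T)) : tens (tens f g) h = tens f (tens g h) := by
  obtain ⟨_, _, f, rfl⟩ := exists_term f
  obtain ⟨_, _, g, rfl⟩ := exists_term g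
  obtain ⟨_, _, h, rfl⟩ := exists_term h
  exact any_eq (.tensor_assoc f g h)

theorem one_tens (f : AnyHom (Diag T)) : tens (id Diag.one) f = f := by
  obtain ⟨_, _, f, rfl⟩ := exists_term f
  exact any_eq (.idZero_tensor f)

theorem tens_one (f : AnyHom (Diag T)) : tens f (id Diag.one) = f := by
  obtain ⟨_, _, f, rfl⟩ := exists_term f
  exact any_eq (.tensor_idZero f)

theorem id_tens_id (U V : Diag T) : tens (id U) (id V) = id (Diag.mul U V) := by
  simp only [tens, id, Diag.tensor_id]

theorem tens_comp {f f' g g' : AnyHom (Diag T)} (hf : f.tgt = f'.src) (hg : g.tgt = g'.src) :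
    comp (tens f g) (tens f' g') = tens (comp f f') (comp g g') := by
  obtain ⟨A, B, f⟩ := f
  obtain ⟨B', D, f'⟩ := f'
  obtain ⟨A₁, B₁, g⟩ := g
  obtain ⟨B₁', D₁, g'⟩ := g'
  obtain rfl : B = B' := hf
  obtain rfl : B₁ = B₁' := hg
  rw [comp_mk f f', comp_mk g g']
  refine (comp_mk (Diag.tensor f g) (Diag.tensor f' g')).trans ?_
  exact congrArg (AnyHom.mk _ _) (Diag.tensor_comp f f' g g').symm

/-- The symmetry of string diagrams. -/
def symm (U V : Diag T) : AnyHom (Diag T) := ⟨Diag.mul U V, Diag.mul V U, Diag.symm U V⟩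

theorem symm_symm (U V : Diag T) : comp (symm U V) (symm V U) = id (Diag.mul U V) := by
  refine (comp_mk (Diag.symm U V) (Diag.symm V U)).trans ?_
  exact any_eq (T := T) (.symm_symm U V)

theorem symm_nat {f g : AnyHom (Diag T)} :
    comp (tens f g) (symm f.tgt g.tgt) = comp (symm f.src g.src) (tens g f) := by
  obtain ⟨A, B, f⟩ := f
  obtain ⟨A', B', g⟩ := g
  refine (comp_mk (Diag.tensor f g) (Diag.symm B B')).trans (Eq.trans ?_
    (comp_mk (Diag.symm A A') (Diag.tensor g f)).symm)
  exact congrArg (AnyHom.mk _ _) (FreeHom.symm_nat f g)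

theorem any_comp_castT {U V V' W : List T.Sorts} (f : Term T.TypedGen U V)
    (g : Term T.TypedGen V' W) (h : V' = V) :
    (⟨U, W, Diag.ofTerm (f.comp (Term.castT h rfl g))⟩ : AnyHom (Diag T)) =
      comp (C := Diag T) ⟨U, V, Diag.ofTerm f⟩ ⟨V', W, Diag.ofTerm g⟩ := by
  subst h
  exact (comp_mk (Diag.ofTerm f) (Diag.ofTerm g)).symm

theorem symm_mul_right (U V W : Diag T) :
    symm U (Diag.mul V W) =
      comp (tens (symm U V) (id W)) (tens (id V) (symm U W)) :=
  (any_eq (T := T) (Term.symmW_append_right U V W)).trans (any_comp_castT _ _ _)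

end AnyHom

end TapeDiagrams

namespace TapeDiagrams

/-! ### The Kronecker product of vectors -/

open RigPoly

variable {T : MonoidalTheory.{u, v}}

/-- The bilinear product of vectors, where the second factor has positions below `n`. -/
noncomputable def tens (n : ℕ) : Vec (Diag T) →ₗ[ℝ] Vec (Diag T) →ₗ[ℝ] Vec (Diag T) :=
  Finsupp.linearCombination ℝ fun x =>
    Finsupp.linearCombination ℝ fun y => ket (y.1 + n * x.1, x.2.tens y.2)

@[simp] theorem tens_ket (n : ℕ) (x y : ℕ × AnyHom (Diag T)) :
    tens n (ket x) (ket y) = ket (y.1 + n * x.1, x.2.tens y.2) := by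
  simp [tens]

theorem bilin_ext {C : Type u} [Category.{v} C] {W : Type*} [AddCommMonoid W] [Module ℝ W]
    {f g : Vec C →ₗ[ℝ] Vec C →ₗ[ℝ] W} (h : ∀ x y, f (ket x) (ket y) = g (ket x) (ket y)) :
    f = g :=
  linearMap_ext fun x => linearMap_ext fun y => h x y

theorem bilin_eqOn_VSpace {C : Type u} [Category.{v} C] {W : Type*} [AddCommMonoid W] [Module ℝ W]
    {A B : C} {P Q : List C} (f g : Vec C →ₗ[ℝ] Vec C →ₗ[ℝ] W)
    (h : ∀ x y, Valid A P x → Valid B Q y → f (ket x) (ket y) = g (ket x) (ket y)) {u w : Vec C}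
    (hu : u ∈ VSpace A P) (hw : w ∈ VSpace B Q) : f u w = g u w := by
  refine eqOn_VSpace (f := f.flip w) (g := g.flip w) (fun x hx => ?_) hu
  exact eqOn_VSpace (f := f (ket x)) (g := g (ket x)) (fun y hy => h x y hx hy) hw

theorem bilin_eqOn_WSpace {C : Type u} [Category.{v} C] {W : Type*} [AddCommMonoid W] [Module ℝ W]
    {P Q : List C} (f g : Vec C →ₗ[ℝ] Vec C →ₗ[ℝ] W)
    (h : ∀ A B, ∀ u ∈ VSpace A P, ∀ w ∈ VSpace B Q, f u w = g u w) {u w : Vec C}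
    (hu : u ∈ WSpace P) (hw : w ∈ WSpace Q) : f u w = g u w :=
  eqOn_WSpace (f.flip w) (g.flip w) (fun A u hu =>
    eqOn_WSpace (f u) (g u) (fun B w hw => h A B u hu w hw) hw) hu

/-- On positions this says `z + n (y + m x) = (z + n y) + (m n) x`. It expresses that the
lexicographic order of monomials is associative. -/
theorem tens_tens (m n : ℕ) (a b c : Vec (Diag T)) :
    tens n (tens m a b) c = tens (m * n) a (tens n b c) := by
  refine LinearMap.congr_fun (f := (tens n).flip c ∘ₗ (tens m).flip b)
    (g := (tens (m * n)).flip (tens n b c)) (linearMap_ext fun x => ?_) a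
  refine LinearMap.congr_fun (f := (tens n).flip c ∘ₗ tens m (ket x))
    (g := tens (m * n) (ket x) ∘ₗ (tens n).flip c) (linearMap_ext fun y => ?_) b
  refine LinearMap.congr_fun (f := tens n (tens m (ket x) (ket y)))
    (g := tens (m * n) (ket x) ∘ₗ tens n (ket y)) (linearMap_ext fun z => ?_) c
  simp only [tens_ket, LinearMap.comp_apply, AnyHom.tens_assoc]
  congr 2
  ring

theorem tens_shift_left (n m : ℕ) (a b : Vec (Diag T)) :
    tens n (shift m a) b = shift (m * n) (tens n a b) := by
  refine LinearMap.congr_fun₂ (f := tens n ∘ₗ shift m) (g := (tens n).compr₂ (shift (m * n)))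
    (bilin_ext fun x y => ?_) a b
  simp only [LinearMap.comp_apply, LinearMap.compr₂_apply, shift_ket, tens_ket]
  congr 2
  ring

/-- The vector of the identity of the monoidal unit. -/
noncomputable def oneVec : Vec (Diag T) := ket (0, AnyHom.id Diag.one)

@[simp] theorem tens_one_left (n : ℕ) (v : Vec (Diag T)) : tens n oneVec v = v := by
  refine LinearMap.congr_fun (g := LinearMap.id) (linearMap_ext fun x => ?_) v
  simp only [oneVec, tens_ket, AnyHom.one_tens, LinearMap.id_apply]
  simp

@[simp] theorem tens_one_right (v : Vec (Diag T)) : tens 1 v oneVec = v := by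
  refine LinearMap.congr_fun (f := (tens 1).flip oneVec) (g := LinearMap.id)
    (linearMap_ext fun x => ?_) v
  simp only [oneVec, LinearMap.flip_apply, tens_ket, AnyHom.tens_one, LinearMap.id_apply]
  simp

theorem units_one {v : Vec (Diag T)} (h : v ∈ units [(Diag.one : Diag T)]) : v = oneVec := by
  obtain ⟨i, U, h, rfl⟩ := h
  obtain ⟨hi, h⟩ := List.getElem?_eq_some_iff.1 h
  obtain rfl : i = 0 := by simpa using hi
  obtain rfl : Diag.one = U := h
  rfl

namespace StMat

theorem splitMul_pairIdx (P Q : List (Diag T)) (k : Fin P.length) (l : Fin Q.length) :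
    splitMul P Q (pairIdx P Q k l).1 = ⟨(k, l), (pairIdx P Q k l).2.symm⟩ := by
  refine Subtype.ext ?_
  refine (Equiv.symm_apply_eq _).2 (Fin.ext ?_)
  simp [pairIdx]

theorem sum_mul {Z : Type*} [AddCommMonoid Z] (P Q : List (Diag T))
    (F : Fin (mul P Q).length → Z) : ∑ j, F j = ∑ k, ∑ l, F (pairIdx P Q k l).1 := by
  rw [← Fintype.sum_prod_type', ← Equiv.sum_comp
    (finProdFinEquiv.trans (finCongr (length_mul P Q)).symm)]
  rfl

theorem ket_pairIdx {P Q : List (Diag T)} (k : Fin P.length) (l : Fin Q.length) {A B : Diag T}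
    (f : A ⟶ P.get k) (g : B ⟶ Q.get l) :
    tens Q.length (ket ((k : ℕ), ⟨A, P.get k, f⟩)) (ket ((l : ℕ), ⟨B, Q.get l, g⟩)) =
      ket ((((pairIdx P Q k l).1 : ℕ)), ⟨Diag.mul A B, (mul P Q).get (pairIdx P Q k l).1,
        Diag.tensor f g ≫ eqToHom (pairIdx P Q k l).2.symm⟩) := by
  rw [AnyHom.mk_comp_eqToHom, tens_ket]
  rfl

end StMat

open StMat

theorem tens_mem {A B : Diag T} {P Q : List (Diag T)} {u w : Vec (Diag T)} (hu : u ∈ VSpace A P)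
    (hw : w ∈ VSpace B Q) : tens Q.length u w ∈ VSpace (Diag.mul A B) (mul P Q) := by
  refine map_VSpace (f := (tens Q.length).flip w) (fun x hx => ?_) hu
  refine map_VSpace (f := tens Q.length (ket x)) (fun y hy => ?_) hw
  obtain ⟨k, f, rfl⟩ := exists_of_valid hx
  obtain ⟨l, g, rfl⟩ := exists_of_valid hy
  rw [ket_pairIdx]
  exact ket_mem (valid_mk _ _)

@[simp] theorem tens_mem_WSpace {P Q : List (Diag T)} {u w : Vec (Diag T)} (hu : u ∈ WSpace P)
    (hw : w ∈ WSpace Q) : tens Q.length u w ∈ WSpace (mul P Q) := by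
  refine map_WSpace ((tens Q.length).flip w) (fun A u hu => ?_) hu
  exact map_WSpace (tens Q.length u) (fun B w hw => VSpace_le_WSpace _ _ (tens_mem hu hw)) hw

theorem tens_shift_length (P R : List (Diag T)) (a b : Vec (Diag T)) :
    tens R.length (shift P.length a) b = shift (mul P R).length (tens R.length a b) := by
  rw [tens_shift_left, length_mul]

theorem tens_tens_length (Q R : List (Diag T)) (a b c : Vec (Diag T)) :
    tens R.length (tens Q.length a b) c = tens (mul Q R).length a (tens R.length b c) := by
  rw [tens_tens, length_mul]

/-- The identity of `U_k V_l` is a product of identities, so matrices out of a product need only be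
compared on pure tensors. -/
theorem units_mul {P Q : List (Diag T)} {v : Vec (Diag T)} (h : v ∈ units (mul P Q)) :
    ∃ u ∈ units P, ∃ w ∈ units Q, v = tens Q.length u w := by
  obtain ⟨i, U, h, rfl⟩ := h
  obtain ⟨hi, h⟩ := List.getElem?_eq_some_iff.1 h
  obtain ⟨⟨k, l⟩, hkl⟩ : ∃ kl : Fin P.length × Fin Q.length, (⟨i, hi⟩ : Fin _) =
      (pairIdx P Q kl.1 kl.2).1 := by
    refine ⟨(splitMul P Q ⟨i, hi⟩).1, Fin.ext ?_⟩
    exact (congrArg Fin.val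
      (finProdFinEquiv.apply_symm_apply (Fin.cast (length_mul P Q) ⟨i, hi⟩))).symm
  refine ⟨_, ⟨k, P[k], by simp, rfl⟩, _, ⟨l, Q[l], by simp, rfl⟩, ?_⟩
  rw [tens_ket, AnyHom.id_tens_id]
  have hU : U = Diag.mul P[k] Q[l] := by
    rw [← h]
    refine Eq.trans (congrArg (mul P Q).get hkl) (pairIdx P Q k l).2
  rw [hU]
  congr 2
  exact congrArg Fin.val hkl

namespace StMat

/-- The decompositions of the two positions are variables, so that known values can be substituted
although the types depend on them. -/
theorem prod_entry {P Q R S : List (Diag T)} (M : Arr P Q) (N : Arr R S)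
    {i : Fin (mul P R).length} {j : Fin (mul Q S).length}
    {a : {k : Fin P.length × Fin R.length // Diag.mul (P.get k.1) (R.get k.2) = (mul P R).get i}}
    {b : {k : Fin Q.length × Fin S.length // Diag.mul (Q.get k.1) (S.get k.2) = (mul Q S).get j}}
    (ha : splitMul P R i = a) (hb : splitMul Q S j = b) :
    Hom.entry (prod M N) i j = SubDist.cast (by rw [a.2, b.2])
      (tensorPlus (Hom.entry M a.1.1 b.1.1) (Hom.entry N a.1.2 b.1.2)) := by
  subst ha hb
  rfl

theorem tensorPlus_sum {U₁ V₁ U₂ V₂ : Diag T} (d : SubDist (U₁ ⟶ V₁)) (e : SubDist (U₂ ⟶ V₂))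
    {Z : Type*} [AddCommMonoid Z] (F : (Diag.mul U₁ U₂ ⟶ Diag.mul V₁ V₂) → ℝ → Z)
    (h₀ : ∀ x, F x 0 = 0) (h₁ : ∀ x a b, F x (a + b) = F x a + F x b) :
    (tensorPlus d e).val.sum F = d.val.sum fun x a => e.val.sum fun y b =>
      F (Diag.tensor x y) (a * b) := by
  rw [tensorPlus, SubDist.map₂, Finsupp.sum_sum_index h₀ h₁]
  refine Finsupp.sum_congr fun x _ => ?_
  rw [Finsupp.sum_sum_index h₀ h₁]
  refine Finsupp.sum_congr fun y _ => ?_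
  exact Finsupp.sum_single_index (h₀ _)

/-- Entry by entry this is the interchange law `(f ⊗ g) ; (x ⊗ y) = (f ; x) ⊗ (g ; y)` of string
diagrams, summed with weights. -/
theorem act_prod_ket {P Q R S : List (Diag T)} (M : Arr P Q) (N : Arr R S)
    (k : Fin P.length) (l : Fin R.length) {A B : Diag T} (f : A ⟶ P.get k) (g : B ⟶ R.get l) :
    act (prod M N) (tens R.length (ket ((k : ℕ), ⟨A, P.get k, f⟩))
      (ket ((l : ℕ), ⟨B, R.get l, g⟩))) = tens S.length (act M (ket ((k : ℕ), ⟨A, P.get k, f⟩)))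
        (act N (ket ((l : ℕ), ⟨B, R.get l, g⟩))) := by
  rw [ket_pairIdx, act_ket, act_ket', act_ket', sum_mul]
  simp only [map_sum, LinearMap.sum_apply]
  refine Finset.sum_comm.trans (Finset.sum_congr rfl fun l' _ =>
    Finset.sum_congr rfl fun k' _ => ?_)
  rw [prod_entry M N (splitMul_pairIdx P R k l) (splitMul_pairIdx Q S k' l'), cast_val_sum,
    tensorPlus_sum _ _ _ (fun _ => Finsupp.single_zero _) (fun _ _ _ => Finsupp.single_add _ _ _)]
  simp only [Finsupp.sum, map_sum, LinearMap.sum_apply, map_smul, LinearMap.smul_apply]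
  refine Finset.sum_comm.trans (Finset.sum_congr rfl fun y _ =>
    (Finset.sum_congr rfl fun x _ => ?_).trans Finset.smul_sum.symm)
  rw [mk_cast_hom _ (pairIdx P R k l).2.symm (pairIdx Q S k' l').2.symm _ _ _ rfl, tens_ket,
    Finsupp.smul_single, Finsupp.smul_single, smul_eq_mul, smul_eq_mul, _root_.mul_one,
    _root_.mul_comm, ← Diag.tensor_comp]
  rfl

@[simp] theorem act_prod {P Q R S : List (Diag T)} (M : Arr P Q) (N : Arr R S)
    {u w : Vec (Diag T)} (hu : u ∈ WSpace P) (hw : w ∈ WSpace R) :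
    act (prod M N) (tens R.length u w) = tens S.length (act M u) (act N w) := by
  have key : (tens R.length).compr₂ (act (prod M N)) u w =
      (tens S.length).compl₁₂ (act M) (act N) u w := by
    refine bilin_eqOn_WSpace _ _ (fun A B u hu w hw => ?_) hu hw
    refine bilin_eqOn_VSpace _ _ (fun x y hx hy => ?_) hu hw
    obtain ⟨k, f, rfl⟩ := exists_of_valid hx
    obtain ⟨l, g, rfl⟩ := exists_of_valid hy
    rw [LinearMap.compr₂_apply, LinearMap.compl₁₂_apply]
    exact act_prod_ket M N k l f g
  rwa [LinearMap.compr₂_apply, LinearMap.compl₁₂_apply] at key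

end StMat

end TapeDiagrams

/-! ### The symmetry of the product and the left distributor on vectors -/

namespace TapeDiagrams

open RigPoly

section pre

variable {C : Type u} [Category.{v} C]

theorem pre_mem_src {P : List C} {v : Vec C} (h : AnyHom C) (hv : v ∈ VSpace h.tgt P) :
    pre h v ∈ VSpace h.src P := pre_mem h.hom hv

theorem pre_comp {P : List C} {v : Vec C} (h k : AnyHom C) (hk : h.tgt = k.src)
    (hv : v ∈ VSpace k.tgt P) : pre h (pre k v) = pre (h.comp k) v := by
  obtain ⟨A, B, h⟩ := h
  obtain ⟨B', D, k⟩ := k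
  obtain rfl : B = B' := hk
  rw [AnyHom.comp_mk]
  exact pre_pre h k hv

theorem StMat.act_pre_tgt {P Q : List C} (M : StMat.Arr P Q) (h : AnyHom C) {v : Vec C}
    (hv : v ∈ VSpace h.tgt P) : StMat.act M (pre h v) = pre h (StMat.act M v) :=
  StMat.act_pre M h.hom hv

end pre

variable {T : MonoidalTheory.{u, v}}

theorem tens_pre {P Q : List (Diag T)} (n : ℕ) {u w : Vec (Diag T)} (h k : AnyHom (Diag T))
    (hu : u ∈ VSpace h.tgt P) (hw : w ∈ VSpace k.tgt Q) :
    tens n (pre h u) (pre k w) = pre (h.tens k) (tens n u w) := by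
  have key : (tens n).compl₁₂ (pre h) (pre k) u w =
      (tens n).compr₂ (pre (h.tens k)) u w := by
    refine bilin_eqOn_VSpace _ _ (fun x y hx hy => ?_) hu hw
    rw [LinearMap.compr₂_apply, LinearMap.compl₁₂_apply]
    simp only [pre_ket, tens_ket, AnyHom.tens_comp hx.1.symm hy.1.symm]
  rwa [LinearMap.compr₂_apply, LinearMap.compl₁₂_apply] at key

theorem tens_pre_left {P Q : List (Diag T)} (n : ℕ) {B : Diag T} {u w : Vec (Diag T)}
    (h : AnyHom (Diag T)) (hu : u ∈ VSpace h.tgt P) (hw : w ∈ VSpace B Q) :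
    tens n (pre h u) w = pre (h.tens (AnyHom.id B)) (tens n u w) := by
  conv_lhs => rw [← pre_id hw]
  exact tens_pre n h (AnyHom.id B) hu hw

theorem tens_pre_right {P Q : List (Diag T)} (n : ℕ) {A : Diag T} {u w : Vec (Diag T)}
    (h : AnyHom (Diag T)) (hu : u ∈ VSpace A P) (hw : w ∈ VSpace h.tgt Q) :
    tens n u (pre h w) = pre ((AnyHom.id A).tens h) (tens n u w) := by
  conv_lhs => rw [← pre_id hu]
  exact tens_pre n (AnyHom.id A) h hu hw

namespace StMat

theorem act_mulSymm_ket {P Q : List (Diag T)} {i : Fin (mul P Q).length}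
    {a : {k : Fin P.length × Fin Q.length // Diag.mul (P.get k.1) (Q.get k.2) = (mul P Q).get i}}
    (ha : splitMul P Q i = a) {A : Diag T} (f : A ⟶ (mul P Q).get i) :
    act (mulSymm P Q) (ket ((i : ℕ), ⟨A, (mul P Q).get i, f⟩)) =
      ket (((pairIdx Q P a.1.2 a.1.1).1 : ℕ),
        AnyHom.comp ⟨A, (mul P Q).get i, f⟩ (AnyHom.symm (P.get a.1.1) (Q.get a.1.2))) := by
  subst ha
  rw [mulSymm, act_monomial]
  congr 2
  rw [← Category.assoc, ← Category.assoc, AnyHom.mk_comp_eqToHom, ← AnyHom.comp_mk,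
    AnyHom.mk_comp_eqToHom]
  rfl

/-- The matrix postcomposes with symmetries that vary with the position. Naturality moves them to
the source, where a single precomposition does for all positions. This is why fixed sources and
`pre` are needed. -/
theorem act_mulSymm {A B : Diag T} {P Q : List (Diag T)} {u w : Vec (Diag T)}
    (hu : u ∈ VSpace A P) (hw : w ∈ VSpace B Q) :
    act (mulSymm P Q) (tens Q.length u w) = pre (AnyHom.symm A B) (tens P.length w u) := by
  have key : (tens Q.length).compr₂ (act (mulSymm P Q)) u w =
      (tens P.length).flip.compr₂ (pre (AnyHom.symm A B)) u w := by
    refine bilin_eqOn_VSpace _ _ (fun x y hx hy => ?_) hu hw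
    obtain ⟨k, f, rfl⟩ := exists_of_valid hx
    obtain ⟨l, g, rfl⟩ := exists_of_valid hy
    rw [LinearMap.compr₂_apply, LinearMap.compr₂_apply, LinearMap.flip_apply, ket_pairIdx,
      act_mulSymm_ket (splitMul_pairIdx P Q k l), tens_ket, pre_ket, AnyHom.mk_comp_eqToHom]
    exact congrArg (fun a => ket (_, a))
      (AnyHom.symm_nat (f := ⟨A, P.get k, f⟩) (g := ⟨B, Q.get l, g⟩))
  rwa [LinearMap.compr₂_apply, LinearMap.compr₂_apply, LinearMap.flip_apply] at key

theorem act_dl_ket {P Q R : List (Diag T)} {i : Fin (mul P (Q ++ R)).length}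
    {a : {k : Fin P.length × Fin (Q ++ R).length //
      Diag.mul (P.get k.1) ((Q ++ R).get k.2) = (mul P (Q ++ R)).get i}}
    (ha : splitMul P (Q ++ R) i = a) {A : Diag T} (f : A ⟶ (mul P (Q ++ R)).get i) :
    act (dl P Q R) (ket ((i : ℕ), ⟨A, (mul P (Q ++ R)).get i, f⟩)) =
      ket (Sum.elim (fun l => ((pairIdx P Q a.1.1 l.1).1 : ℕ))
        (fun l => (mul P Q).length + ((pairIdx P R a.1.1 l.1).1 : ℕ)) (splitAdd Q R a.1.2),
        ⟨A, (mul P (Q ++ R)).get i, f⟩) := by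
  subst ha
  rw [dl, act_permMat]
  congr 2
  rcases splitAdd Q R (splitMul P (Q ++ R) i).1.2 with ⟨l, hl⟩ | ⟨l, hl⟩ <;> rfl

-- Distributing leaves arrows alone and changes only the stride of positions, from the length of `Q
-- ++ R` to that of `Q`.
@[simp] theorem act_dl_inl {P Q : List (Diag T)} (R : List (Diag T)) {u w : Vec (Diag T)}
    (hu : u ∈ WSpace P) (hw : w ∈ WSpace Q) :
    act (dl P Q R) (tens (Q ++ R).length u w) = tens Q.length u w := by
  have key : (tens (Q ++ R).length).compr₂ (act (dl P Q R)) u w = tens Q.length u w := by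
    refine bilin_eqOn_WSpace _ _ (fun A B u hu w hw => ?_) hu hw
    refine bilin_eqOn_VSpace _ _ (fun x y hx hy => ?_) hu hw
    obtain ⟨k, f, rfl⟩ := exists_of_valid hx
    obtain ⟨l, g, rfl⟩ := exists_of_valid hy
    have e : (((l : ℕ), ⟨B, Q.get l, g⟩) : ℕ × AnyHom (Diag T)) = (((inlIdx Q R l).1 : ℕ),
        ⟨B, (Q ++ R).get (inlIdx Q R l).1, g ≫ eqToHom (inlIdx Q R l).2.symm⟩) := by
      rw [AnyHom.mk_comp_eqToHom]; rfl
    rw [LinearMap.compr₂_apply, e, ket_pairIdx, act_dl_ket (splitMul_pairIdx P (Q ++ R) k _), ← e,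
      splitAdd_inl, AnyHom.mk_comp_eqToHom, tens_ket, Sum.elim_inl]
    congr 2
    exact congrArg (AnyHom.tens ⟨A, P.get k, f⟩) (congrArg Prod.snd e).symm
  rwa [LinearMap.compr₂_apply] at key

@[simp] theorem act_dl_inr {P R : List (Diag T)} (Q : List (Diag T)) {u w : Vec (Diag T)}
    (hu : u ∈ WSpace P) (hw : w ∈ WSpace R) :
    act (dl P Q R) (tens (Q ++ R).length u (shift Q.length w)) =
      shift (mul P Q).length (tens R.length u w) := by
  have key : ((tens (Q ++ R).length).compl₁₂ LinearMap.id (shift Q.length)).compr₂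
      (act (dl P Q R)) u w = (tens R.length).compr₂ (shift (mul P Q).length) u w := by
    refine bilin_eqOn_WSpace _ _ (fun A B u hu w hw => ?_) hu hw
    refine bilin_eqOn_VSpace _ _ (fun x y hx hy => ?_) hu hw
    obtain ⟨k, f, rfl⟩ := exists_of_valid hx
    obtain ⟨l, g, rfl⟩ := exists_of_valid hy
    have e : ((Q.length + (l : ℕ), ⟨B, R.get l, g⟩) : ℕ × AnyHom (Diag T)) =
        (((inrIdx Q R l).1 : ℕ),
        ⟨B, (Q ++ R).get (inrIdx Q R l).1, g ≫ eqToHom (inrIdx Q R l).2.symm⟩) := by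
      rw [AnyHom.mk_comp_eqToHom]; rfl
    rw [LinearMap.compr₂_apply, LinearMap.compr₂_apply, LinearMap.compl₁₂_apply,
      LinearMap.id_apply, shift_ket, e, ket_pairIdx,
      act_dl_ket (splitMul_pairIdx P (Q ++ R) k _), splitAdd_inr, AnyHom.mk_comp_eqToHom, tens_ket,
      shift_ket, Sum.elim_inr]
    congr 2
    exact congrArg (AnyHom.tens ⟨A, P.get k, f⟩) (congrArg Prod.snd e).symm
  rwa [LinearMap.compr₂_apply, LinearMap.compr₂_apply, LinearMap.compl₁₂_apply] at key

end StMat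

end TapeDiagrams

/-! ### Symmetric monoidal laws for matrices -/

namespace TapeDiagrams

open RigPoly

section shift

variable {C : Type u} [Category.{v} C]

theorem shift_length_append (P Q : List C) (v : Vec C) :
    shift (P ++ Q).length v = shift P.length (shift Q.length v) := by
  rw [shift_shift, List.length_append]

@[simp] theorem shift_length_nil (v : Vec C) : shift ([] : List C).length v = v := shift_zero v

end shift

namespace StMat

section general

variable {C : Type u} [Category.{v} C]

/-- Turns a strictness law into the naturality square of the corresponding structural isomorphism.
-/
theorem hom_eq_of_heq {P Q P' Q' : List C} (hP : P = P') (hQ : Q = Q') {M : Arr P Q}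
    {N : Arr P' Q'} (h : M ≍ N) :
    (M ≫ eqToHom (C := StMat C) hQ : Arr P Q') = (eqToHom (C := StMat C) hP ≫ N : Arr P Q') := by
  subst hP hQ
  rw [eq_of_heq h]
  exact (Category.comp_id (obj := StMat C) N).trans (Category.id_comp (obj := StMat C) N).symm

theorem sum_symm_nat {P Q P' Q' : List C} (M : Arr P P') (N : Arr Q Q') :
    (sum M N ≫ sumSymm P' Q' : Arr _ _) = (sumSymm P Q ≫ sum N M : Arr _ _) :=
  hom_ext_append (fun v _ hv => by
    simp [hv, inl_mem_WSpace, -List.length_append]) fun v _ hv => by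
    simp [hv, inl_mem_WSpace, shift_mem_WSpace, -List.length_append]

theorem sumSymm_sumSymm (P Q : List C) :
    (sumSymm P Q ≫ sumSymm Q P : Arr _ _) = ident (P ++ Q) :=
  hom_ext_append (fun v _ hv => by
    simp [hv, inl_mem_WSpace, shift_mem_WSpace, -List.length_append]) fun v _ hv => by
    simp [hv, inl_mem_WSpace, shift_mem_WSpace, -List.length_append]

end general

variable {T : MonoidalTheory.{u, v}}

theorem hom_ext_mul {P Q R : List (Diag T)} {M N : Arr (mul P Q) R}
    (h : ∀ u ∈ units P, u ∈ WSpace P → ∀ w ∈ units Q, w ∈ WSpace Q →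
      act M (tens Q.length u w) = act N (tens Q.length u w)) : M = N := by
  refine hom_ext_act fun v hv => ?_
  obtain ⟨a, ha, b, hb, rfl⟩ := units_mul hv
  exact h a ha (units_mem_WSpace ha) b hb (units_mem_WSpace hb)

theorem prod_ident (P Q : List (Diag T)) : prod (ident P) (ident Q) = ident (mul P Q) :=
  hom_ext_mul fun a _ ha b _ hb => by simp [ha, hb]

theorem prod_comp {P₁ Q₁ R₁ P₂ Q₂ R₂ : List (Diag T)} (M₁ : Arr P₁ Q₁) (N₁ : Arr Q₁ R₁)
    (M₂ : Arr P₂ Q₂) (N₂ : Arr Q₂ R₂) :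
    prod (M₁ ≫ N₁ : Arr P₁ R₁) (M₂ ≫ N₂ : Arr P₂ R₂) = (prod M₁ M₂ ≫ prod N₁ N₂ : Arr _ _) :=
  hom_ext_mul fun a _ ha b _ hb => by simp [ha, hb]

theorem prod_assoc {P₁ Q₁ P₂ Q₂ P₃ Q₃ : List (Diag T)} (M₁ : Arr P₁ Q₁) (M₂ : Arr P₂ Q₂)
    (M₃ : Arr P₃ Q₃) : prod (prod M₁ M₂) M₃ ≍ prod M₁ (prod M₂ M₃) := by
  refine heq_of_act (mul_assoc _ _ _) (mul_assoc _ _ _) fun v hv => ?_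
  obtain ⟨x, hx, c, hc, rfl⟩ := units_mul hv
  obtain ⟨a, ha, b, hb, rfl⟩ := units_mul hx
  replace ha := units_mem_WSpace ha
  replace hb := units_mem_WSpace hb
  replace hc := units_mem_WSpace hc
  rw [act_prod _ _ (tens_mem_WSpace ha hb) hc, act_prod _ _ ha hb, tens_tens_length,
    tens_tens_length, act_prod _ _ ha (tens_mem_WSpace hb hc), act_prod _ _ hb hc]

theorem oneVec_mem : oneVec ∈ WSpace [(Diag.one : Diag T)] :=
  units_mem_WSpace ⟨0, Diag.one, rfl, rfl⟩

theorem ident_one_prod {P Q : List (Diag T)} (M : Arr P Q) :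
    prod (ident [Diag.one]) M ≍ M := by
  refine heq_of_act (one_mul P) (one_mul Q) fun v hv => ?_
  obtain ⟨a, ha, b, hb, rfl⟩ := units_mul hv
  obtain rfl := units_one ha
  replace hb := units_mem_WSpace hb
  rw [act_prod _ _ oneVec_mem hb, act_ident oneVec_mem, tens_one_left, tens_one_left]

theorem prod_ident_one {P Q : List (Diag T)} (M : Arr P Q) :
    prod M (ident [Diag.one]) ≍ M := by
  refine heq_of_act (mul_one P) (mul_one Q) fun v hv => ?_
  obtain ⟨a, ha, b, hb, rfl⟩ := units_mul hv
  obtain rfl := units_one hb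
  replace ha := units_mem_WSpace ha
  rw [act_prod _ _ ha oneVec_mem, act_ident oneVec_mem]
  exact (tens_one_right _).trans (congrArg (act M) (tens_one_right a).symm)

theorem mul_symm_nat {P Q P' Q' : List (Diag T)} (M : Arr P P') (N : Arr Q Q') :
    (prod M N ≫ mulSymm P' Q' : Arr _ _) = (mulSymm P Q ≫ prod N M : Arr _ _) :=
  hom_ext_mul fun a ha ha' b hb hb' => by
    obtain ⟨A, ha⟩ := units_mem ha
    obtain ⟨B, hb⟩ := units_mem hb
    rw [act_comp_of_mem _ _ (tens_mem_WSpace ha' hb'), act_comp_of_mem _ _ (tens_mem_WSpace ha' hb'),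
      act_prod _ _ ha' hb', act_mulSymm ha hb, act_mulSymm (act_mem M ha) (act_mem N hb),
      act_pre_tgt _ (AnyHom.symm A B) (tens_mem hb ha), act_prod _ _ hb' ha']

theorem mulSymm_mulSymm (P Q : List (Diag T)) :
    (mulSymm P Q ≫ mulSymm Q P : Arr _ _) = ident (mul P Q) :=
  hom_ext_mul fun a ha ha' b hb hb' => by
    obtain ⟨A, ha⟩ := units_mem ha
    obtain ⟨B, hb⟩ := units_mem hb
    rw [act_comp_of_mem _ _ (tens_mem_WSpace ha' hb'), act_ident (tens_mem_WSpace ha' hb'),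
      act_mulSymm ha hb, act_pre_tgt _ (AnyHom.symm A B) (tens_mem hb ha), act_mulSymm hb ha,
      pre_comp (AnyHom.symm A B) (AnyHom.symm B A) rfl (tens_mem ha hb), AnyHom.symm_symm, pre_id (tens_mem ha hb)]

/-- On a pure tensor both sides give `b ⊗ (c ⊗ a)` precomposed with an arrow built from symmetries.
The two arrows agree by the hexagon `AnyHom.symm_mul_right` of string diagrams. -/
theorem mul_hexagon (P Q R : List (Diag T)) :
    (eqToHom (C := StMat (Diag T)) (mul_assoc P Q R) ≫ mulSymm P (mul Q R) ≫
      eqToHom (C := StMat (Diag T)) (mul_assoc Q R P) : Arr (mul (mul P Q) R) (mul Q (mul R P))) =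
    (prod (mulSymm P Q) (ident R) ≫ eqToHom (C := StMat (Diag T)) (mul_assoc Q P R) ≫
      prod (ident Q) (mulSymm P R) : Arr (mul (mul P Q) R) (mul Q (mul R P))) := by
  refine hom_ext_act fun v hv => ?_
  obtain ⟨x, hx, c, hc, rfl⟩ := units_mul hv
  obtain ⟨a, ha, b, hb, rfl⟩ := units_mul hx
  have ha' := units_mem_WSpace ha
  have hb' := units_mem_WSpace hb
  have hc' := units_mem_WSpace hc
  obtain ⟨A, ha⟩ := units_mem ha
  obtain ⟨B, hb⟩ := units_mem hb
  obtain ⟨D, hc⟩ := units_mem hc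
  have hv' := units_mem_WSpace hv
  have l : act (mulSymm P (mul Q R)) (tens (mul Q R).length a (tens R.length b c)) =
      pre (AnyHom.symm A (Diag.mul B D)) (tens (mul R P).length b (tens P.length c a)) := by
    rw [act_mulSymm ha (tens_mem hb hc), tens_tens_length]
  have r1 : act (prod (mulSymm P Q) (ident R)) (tens R.length (tens Q.length a b) c) =
      pre ((AnyHom.symm A B).tens (AnyHom.id D)) (tens (mul P R).length b (tens R.length a c)) := by
    rw [act_prod _ _ (tens_mem_WSpace ha' hb') hc', act_ident hc', act_mulSymm ha hb,
      tens_pre_left _ (AnyHom.symm A B) (tens_mem hb ha) hc, tens_tens_length]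
  have r2 : act (prod (ident Q) (mulSymm P R)) (tens (mul P R).length b (tens R.length a c)) =
      pre ((AnyHom.id B).tens (AnyHom.symm A D)) (tens (mul R P).length b (tens P.length c a)) := by
    rw [act_prod _ _ hb' (tens_mem_WSpace ha' hc'), act_ident hb', act_mulSymm ha hc,
      tens_pre_right _ (AnyHom.symm A D) hb (tens_mem hc ha)]
  have hm : tens (mul P R).length b (tens R.length a c) ∈
      VSpace (Diag.mul B (Diag.mul A D)) (mul Q (mul P R)) := tens_mem hb (tens_mem ha hc)
  have hm' : tens (mul R P).length b (tens P.length c a) ∈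
      VSpace (Diag.mul B (Diag.mul D A)) (mul Q (mul R P)) := tens_mem hb (tens_mem hc ha)
  have hv₁ : tens (mul Q R).length a (tens R.length b c) ∈ WSpace (mul P (mul Q R)) :=
    tens_mem_WSpace ha' (tens_mem_WSpace hb' hc')
  have hv₂ : pre (AnyHom.symm A (Diag.mul B D)) (tens (mul R P).length b (tens P.length c a)) ∈
      WSpace (mul (mul Q R) P) := by
    rw [← tens_tens_length]
    exact VSpace_le_WSpace _ _ (pre_mem_src (AnyHom.symm A (Diag.mul B D))
      (tens_mem (tens_mem hb hc) ha))
  have hv₃ : pre ((AnyHom.symm A B).tens (AnyHom.id D))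
      (tens (mul P R).length b (tens R.length a c)) ∈ WSpace (mul (mul Q P) R) := by
    rw [← tens_tens_length]
    exact VSpace_le_WSpace _ _ (pre_mem_src ((AnyHom.symm A B).tens (AnyHom.id D))
      (tens_mem (tens_mem hb ha) hc))
  refine (act_comp_of_mem _ _ hv').trans (Eq.trans ?_ (act_comp_of_mem _ _ hv').symm)
  rw [act_eqToHom_of_mem _ hv', r1, tens_tens_length,
    act_comp_of_mem _ _ hv₁, l, act_eqToHom_of_mem _ hv₂, act_comp_of_mem _ _ hv₃, act_eqToHom_of_mem _ hv₃]
  have e : act (prod (ident Q) (mulSymm P R)) (pre ((AnyHom.symm A B).tens (AnyHom.id D))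
      (tens (mul P R).length b (tens R.length a c))) =
      pre ((AnyHom.symm A B).tens (AnyHom.id D)) (act (prod (ident Q) (mulSymm P R))
        (tens (mul P R).length b (tens R.length a c))) := by
    -- The target of the precomposed arrow is bracketed the other way, so membership is transported
    -- along associativity of words.
    have hm₁ : tens (mul P R).length b (tens R.length a c) ∈
        VSpace (Diag.mul (Diag.mul B A) D) (mul Q (mul P R)) := by
      rw [Diag.mul_assoc]; exact hm
    exact act_pre_tgt _ ((AnyHom.symm A B).tens (AnyHom.id D)) hm₁
  rw [e, r2, pre_comp ((AnyHom.symm A B).tens (AnyHom.id D))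
    ((AnyHom.id B).tens (AnyHom.symm A D)) (Diag.mul_assoc B A D) hm', ← AnyHom.symm_mul_right]

end StMat

end TapeDiagrams

/-! ### Naturality, symmetry and associativity of the distributors -/

namespace TapeDiagrams

open RigPoly

namespace StMat

section general

variable {C : Type u} [Category.{v} C]

theorem hom_ext_of_eq_nil {P Q : List C} (h : P = []) (M N : Arr P Q) : M = N := by
  subst h
  exact hom_ext_nil M N

/-- The identity, read along an equality of words. -/
noncomputable abbrev castHom {P Q : List C} (h : P = Q) : Arr P Q := eqToHom (C := StMat C) h

theorem castHom_comp {P Q R : List C} (h : P = Q) (h' : Q = R) :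
    (castHom h ≫ castHom h' : Arr P R) = castHom (h.trans h') :=
  eqToHom_trans (C := StMat C) h h'

theorem sum_castHom {P Q P' Q' : List C} (h : P = Q) (h' : P' = Q') :
    sum (castHom h) (castHom h') = castHom (by rw [h, h']) := by
  subst h h'
  exact sum_ident P P'

theorem add_hexagon (P Q R : List C) :
    (castHom (List.append_assoc P Q R) ≫ sumSymm P (Q ++ R) ≫
      castHom (List.append_assoc Q R P) : Arr ((P ++ Q) ++ R) (Q ++ (R ++ P))) =
    (sum (sumSymm P Q) (ident R) ≫ castHom (List.append_assoc Q P R) ≫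
      sum (ident Q) (sumSymm P R) : Arr ((P ++ Q) ++ R) (Q ++ (R ++ P))) :=
  hom_ext_append (fun v hv _ => by
    rcases units_append hv with hv | ⟨w, hw, rfl⟩
    · have hv := units_mem_WSpace hv
      -- Lengths of sums and iterated shifts are kept unmerged, so that each shift still names the
      -- block it passes over.
      simp (maxDischargeDepth := 8) [hv, inl_mem_WSpace, shift_mem_WSpace, -List.length_append, -shift_shift, -List.append_assoc]
      rw [shift_length_append]
    · have hv := units_mem_WSpace hw
      simp (maxDischargeDepth := 8) [hv, inl_mem_WSpace, shift_mem_WSpace, -List.length_append, -shift_shift, -List.append_assoc]) fun v _ hv => by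
    simp (maxDischargeDepth := 8) [hv, inl_mem_WSpace, shift_mem_WSpace, -List.length_append, -shift_shift, -List.append_assoc]
    rw [shift_length_append, shift_length_append]
    simp (maxDischargeDepth := 8) [hv, inl_mem_WSpace, shift_mem_WSpace, -List.length_append, -shift_shift, -List.append_assoc]

end general

variable {T : MonoidalTheory.{u, v}}

theorem prod_castHom {P Q P' Q' : List (Diag T)} (h : P = Q) (h' : P' = Q') :
    prod (castHom h) (castHom h') = castHom (by rw [h, h']) := by
  subst h h'
  exact prod_ident P P'

theorem dl_nat {P P' Q Q' R R' : List (Diag T)} (f : Arr P P') (g : Arr Q Q') (h : Arr R R') :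
    (prod f (sum g h) ≫ dl P' Q' R' : Arr _ _) = (dl P Q R ≫ sum (prod f g) (prod f h) : Arr _ _) :=
  hom_ext_mul fun a _ ha b hb _ => by
    rcases units_append hb with hb | ⟨w, hw, rfl⟩
    · have hb := units_mem_WSpace hb
      simp (maxDischargeDepth := 8) [ha, hb, inl_mem_WSpace, shift_mem_WSpace, -List.length_append, -shift_shift, -List.append_assoc]
    · have hb := units_mem_WSpace hw
      simp (maxDischargeDepth := 8) [ha, hb, inl_mem_WSpace, shift_mem_WSpace, -List.length_append, -shift_shift, -List.append_assoc]

theorem dr_nat {P P' Q Q' R R' : List (Diag T)} (f : Arr P P') (g : Arr Q Q') (h : Arr R R') :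
    (prod (sum f g) h ≫ castHom (add_mul P' Q' R') : Arr _ _) =
      (castHom (add_mul P Q R) ≫ sum (prod f h) (prod g h) : Arr _ _) :=
  hom_ext_mul fun a ha _ b _ hb => by
    rcases units_append ha with ha | ⟨w, hw, rfl⟩
    · have ha := units_mem_WSpace ha
      simp (maxDischargeDepth := 8) [ha, hb, inl_mem_WSpace, shift_mem_WSpace, -List.length_append, -shift_shift, -List.append_assoc]
    · have ha := units_mem_WSpace hw
      simp (maxDischargeDepth := 8) [ha, hb, inl_mem_WSpace, shift_mem_WSpace, -List.length_append, -shift_shift, -List.append_assoc]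
      rw [tens_shift_length, tens_shift_length]
      simp (maxDischargeDepth := 8) [ha, hb, inl_mem_WSpace, shift_mem_WSpace, -List.length_append, -shift_shift, -List.append_assoc]

theorem dl_symm (P Q R : List (Diag T)) :
    (dl P Q R ≫ sumSymm (mul P Q) (mul P R) : Arr _ _) =
      (prod (ident P) (sumSymm Q R) ≫ dl P R Q : Arr _ _) :=
  hom_ext_mul fun a _ ha b hb _ => by
    rcases units_append hb with hb | ⟨w, hw, rfl⟩
    · have hb := units_mem_WSpace hb
      simp (maxDischargeDepth := 8) [ha, hb, inl_mem_WSpace, shift_mem_WSpace, -List.length_append, -shift_shift, -List.append_assoc]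
    · have hb := units_mem_WSpace hw
      simp (maxDischargeDepth := 8) [ha, hb, inl_mem_WSpace, shift_mem_WSpace, -List.length_append, -shift_shift, -List.append_assoc]

theorem dr_symm (P Q R : List (Diag T)) :
    (castHom (add_mul P Q R) ≫ sumSymm (mul P R) (mul Q R) : Arr _ _) =
      (prod (sumSymm P Q) (ident R) ≫ castHom (add_mul Q P R) : Arr _ _) :=
  hom_ext_mul fun a ha _ b _ hb => by
    rcases units_append ha with ha | ⟨w, hw, rfl⟩
    · have ha := units_mem_WSpace ha
      simp (maxDischargeDepth := 8) [ha, hb, inl_mem_WSpace, shift_mem_WSpace, -List.length_append, -shift_shift, -List.append_assoc]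
      rw [tens_shift_length]
    · have ha := units_mem_WSpace hw
      simp (maxDischargeDepth := 8) [ha, hb, inl_mem_WSpace, shift_mem_WSpace, -List.length_append, -shift_shift, -List.append_assoc]
      rw [tens_shift_length]
      simp (maxDischargeDepth := 8) [ha, hb, inl_mem_WSpace, shift_mem_WSpace, -List.length_append, -shift_shift, -List.append_assoc]

theorem dl_add_assoc (P Q R S : List (Diag T)) :
    (dl P (Q ++ R) S ≫ sum (dl P Q R) (ident (mul P S)) ≫
      castHom (List.append_assoc (mul P Q) (mul P R) (mul P S)) : Arr _ _) =
    (prod (ident P) (castHom (List.append_assoc Q R S)) ≫ dl P Q (R ++ S) ≫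
      sum (ident (mul P Q)) (dl P R S) : Arr _ _) :=
  hom_ext_mul fun a _ ha b hb hb' => by
    rcases units_append hb with hb | ⟨w, hw, rfl⟩
    · rcases units_append hb with hb | ⟨w, hw, rfl⟩
      · have hb := units_mem_WSpace hb
        simp (maxDischargeDepth := 8) [ha, hb, inl_mem_WSpace, shift_mem_WSpace, -List.length_append, -shift_shift, -List.append_assoc]
      · have hb := units_mem_WSpace hw
        simp (maxDischargeDepth := 8) [ha, hb, inl_mem_WSpace, shift_mem_WSpace, -List.length_append, -shift_shift, -List.append_assoc]
    · have hb := units_mem_WSpace hw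
      simp (maxDischargeDepth := 8) [ha, hb, inl_mem_WSpace, shift_mem_WSpace, -List.length_append, -shift_shift, -List.append_assoc]
      rw [shift_length_append, shift_length_append]
      simp (maxDischargeDepth := 8) [ha, hb, inl_mem_WSpace, shift_mem_WSpace, -List.length_append, -shift_shift, -List.append_assoc]

theorem dl_mul_assoc (P Q R S : List (Diag T)) :
    (castHom (mul_assoc P Q (R ++ S)) ≫ prod (ident P) (dl Q R S) ≫
      dl P (mul Q R) (mul Q S) : Arr _ _) =
    (dl (mul P Q) R S ≫ sum (castHom (mul_assoc P Q R)) (castHom (mul_assoc P Q S)) : Arr _ _) :=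
  hom_ext_mul fun x hx hx' c hc _ => by
    obtain ⟨a, ha, b, hb, rfl⟩ := units_mul hx
    replace ha := units_mem_WSpace ha
    replace hb := units_mem_WSpace hb
    rcases units_append hc with hc | ⟨w, hw, rfl⟩
    · have hc := units_mem_WSpace hc
      simp (maxDischargeDepth := 8) [ha, hb, hc, inl_mem_WSpace, shift_mem_WSpace, -List.length_append, -shift_shift, -List.append_assoc]
      simp only [tens_tens_length]
      simp (maxDischargeDepth := 8) [ha, hb, hc, inl_mem_WSpace, shift_mem_WSpace, -List.length_append, -shift_shift, -List.append_assoc]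
    · have hc := units_mem_WSpace hw
      simp (maxDischargeDepth := 8) [ha, hb, hc, inl_mem_WSpace, shift_mem_WSpace, -List.length_append, -shift_shift, -List.append_assoc]
      simp only [tens_tens_length]
      simp (maxDischargeDepth := 8) [ha, hb, hc, inl_mem_WSpace, shift_mem_WSpace, -List.length_append, -shift_shift, -List.append_assoc]

theorem dl_dr_mul_assoc (P Q R S : List (Diag T)) :
    (prod (dl P Q R) (ident S) ≫ castHom (add_mul (mul P Q) (mul P R) S) ≫
      sum (castHom (mul_assoc P Q S)) (castHom (mul_assoc P R S)) : Arr _ _) =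
    (castHom (mul_assoc P (Q ++ R) S) ≫ prod (ident P) (castHom (add_mul Q R S)) ≫
      dl P (mul Q S) (mul R S) : Arr _ _) :=
  hom_ext_mul fun x hx hx' c _ hc => by
    obtain ⟨a, ha, b, hb, rfl⟩ := units_mul hx
    replace ha := units_mem_WSpace ha
    rcases units_append hb with hb | ⟨w, hw, rfl⟩
    · have hb := units_mem_WSpace hb
      simp (maxDischargeDepth := 8) [ha, hb, hc, inl_mem_WSpace, shift_mem_WSpace, -List.length_append, -shift_shift, -List.append_assoc]
      simp only [tens_tens_length]
      simp (maxDischargeDepth := 8) [ha, hb, hc, inl_mem_WSpace, shift_mem_WSpace, -List.length_append, -shift_shift, -List.append_assoc]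
    · have hb := units_mem_WSpace hw
      simp (maxDischargeDepth := 8) [ha, hb, hc, inl_mem_WSpace, shift_mem_WSpace, -List.length_append, -shift_shift, -List.append_assoc]
      rw [tens_shift_length, tens_tens_length (Q ++ R)]
      simp (maxDischargeDepth := 8) [ha, hb, hc, inl_mem_WSpace, shift_mem_WSpace, -List.length_append, -shift_shift, -List.append_assoc]
      rw [tens_shift_length]
      simp (maxDischargeDepth := 8) [ha, hb, hc, inl_mem_WSpace, shift_mem_WSpace, -List.length_append, -shift_shift, -List.append_assoc]
      rw [tens_tens_length]

end StMat

end TapeDiagrams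

/-! ### Interplay of the distributors, the symmetry and the units -/

namespace TapeDiagrams

open RigPoly

namespace StMat

section general

variable {C : Type u} [Category.{v} C]

/-- The interchange of the middle summands. -/
noncomputable def mid (P Q R S : List C) : Arr ((P ++ Q) ++ (R ++ S)) ((P ++ R) ++ (Q ++ S)) :=
  castHom (List.append_assoc P Q (R ++ S)) ≫
    sum (ident P) (castHom (List.append_assoc Q R S).symm ≫ sum (sumSymm Q R) (ident S) ≫
      castHom (List.append_assoc R Q S) : Arr (Q ++ (R ++ S)) (R ++ (Q ++ S))) ≫
    castHom (List.append_assoc P R (Q ++ S)).symm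

variable (P Q R S : List C) {v : Vec C}

theorem act_mid₁ (hv : v ∈ WSpace P) : act (mid P Q R S) v = v := by
  refine (act_comp_of_mem _ _ (inl_mem_WSpace _ (inl_mem_WSpace _ hv))).trans ?_
  simp (maxDischargeDepth := 8) [hv, inl_mem_WSpace, -List.append_assoc]

theorem act_mid₂ (hv : v ∈ WSpace Q) :
    act (mid P Q R S) (shift P.length v) = shift (P ++ R).length v := by
  refine (act_comp_of_mem _ _ (inl_mem_WSpace _ (shift_mem_WSpace _ hv))).trans ?_
  simp (maxDischargeDepth := 8) [hv, inl_mem_WSpace, shift_mem_WSpace, -List.length_append,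
    -shift_shift, -List.append_assoc]
  rw [shift_length_append]

theorem act_mid₃ (hv : v ∈ WSpace R) :
    act (mid P Q R S) (shift (P ++ Q).length v) = shift P.length v := by
  refine (act_comp_of_mem _ _ (shift_mem_WSpace _ (inl_mem_WSpace _ hv))).trans ?_
  rw [act_eqToHom_of_mem _ (shift_mem_WSpace _ (inl_mem_WSpace _ hv)), shift_length_append]
  simp (maxDischargeDepth := 8) [hv, inl_mem_WSpace, shift_mem_WSpace, -List.length_append,
    -shift_shift, -List.append_assoc]

theorem act_mid₄ (hv : v ∈ WSpace S) : act (mid P Q R S) (shift (P ++ Q).length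
    (shift R.length v)) = shift (P ++ R).length (shift Q.length v) := by
  have h : shift (P ++ Q).length (shift R.length v) ∈ WSpace ((P ++ Q) ++ (R ++ S)) :=
    shift_mem_WSpace _ (shift_mem_WSpace _ hv)
  refine (act_comp_of_mem _ _ h).trans ?_
  rw [act_eqToHom_of_mem _ h, shift_length_append]
  simp (maxDischargeDepth := 8) [hv, inl_mem_WSpace, shift_mem_WSpace, -List.length_append,
    -shift_shift, -List.append_assoc]
  rw [← shift_length_append]
  simp (maxDischargeDepth := 8) [hv, inl_mem_WSpace, shift_mem_WSpace, -List.length_append,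
    -shift_shift, -List.append_assoc]
  simp only [shift_length_append]
  simp (maxDischargeDepth := 8) [hv, inl_mem_WSpace, shift_mem_WSpace, -List.length_append,
    -shift_shift, -List.append_assoc]

end general

variable {T : MonoidalTheory.{u, v}}

/-- There are four blocks. The left side first groups them by `Y` and `Z`, the right side by `W` and
`X`, and `mid` exchanges the middle two. -/
theorem dl_dr (W X Y Z : List (Diag T)) :
    (dl (W ++ X) Y Z ≫ sum (castHom (add_mul W X Y)) (castHom (add_mul W X Z)) ≫
      mid (mul W Y) (mul X Y) (mul W Z) (mul X Z) : Arr _ _) =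
    (castHom (add_mul W X (Y ++ Z)) ≫ sum (dl W Y Z) (dl X Y Z) : Arr _ _) :=
  hom_ext_mul fun a ha ha' b hb hb' => by
    refine (act_comp_of_mem _ _ (tens_mem_WSpace ha' hb')).trans
      (Eq.trans ?_ (act_comp_of_mem _ _ (tens_mem_WSpace ha' hb')).symm)
    rw [act_eqToHom_of_mem _ (tens_mem_WSpace ha' hb')]
    rcases units_append hb with hb | ⟨w, hw, rfl⟩
    · have hb := units_mem_WSpace hb
      rw [act_dl_inl _ ha' hb, act_comp_of_mem _ _ (inl_mem_WSpace _ (tens_mem_WSpace ha' hb)),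
        act_sum_inl_of_mem _ _ (tens_mem_WSpace ha' hb),
        act_eqToHom_of_mem _ (tens_mem_WSpace ha' hb)]
      rcases units_append ha with ha | ⟨w, hw, rfl⟩
      · have ha := units_mem_WSpace ha
        rw [act_mid₁ _ _ _ _ (tens_mem_WSpace ha hb)]
        simp (maxDischargeDepth := 8) [ha, hb, inl_mem_WSpace, -List.length_append]
      · have ha := units_mem_WSpace hw
        rw [tens_shift_length, act_mid₂ _ _ _ _ (tens_mem_WSpace ha hb), tens_shift_length]
        simp (maxDischargeDepth := 8) [ha, hb, inl_mem_WSpace, -List.length_append]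
    · have hb := units_mem_WSpace hw
      rw [act_dl_inr _ ha' hb, act_comp_of_mem _ _ (shift_mem_WSpace _ (tens_mem_WSpace ha' hb)),
        act_sum_inr_of_mem _ _ (tens_mem_WSpace ha' hb),
        act_eqToHom_of_mem _ (tens_mem_WSpace ha' hb)]
      rcases units_append ha with ha | ⟨w, hw, rfl⟩
      · have ha := units_mem_WSpace ha
        rw [act_mid₃ _ _ _ _ (tens_mem_WSpace ha hb)]
        simp (maxDischargeDepth := 8) [ha, hb, shift_mem_WSpace, -List.length_append]
      · have ha := units_mem_WSpace hw
        rw [tens_shift_length, act_mid₄ _ _ _ _ (tens_mem_WSpace ha hb), tens_shift_length]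
        simp (maxDischargeDepth := 8) [ha, hb, shift_mem_WSpace, -List.length_append, -shift_shift]

theorem symm_dr (P Q R : List (Diag T)) :
    (mulSymm P (Q ++ R) ≫ castHom (add_mul Q R P) : Arr _ _) =
      (dl P Q R ≫ sum (mulSymm P Q) (mulSymm P R) : Arr _ _) :=
  hom_ext_mul fun a ha ha' b hb hb' => by
    obtain ⟨A, ha⟩ := units_mem ha
    have hab := tens_mem_WSpace ha' hb'
    refine (act_comp_of_mem _ _ hab).trans (Eq.trans ?_ (act_comp_of_mem _ _ hab).symm)
    rw [act_eqToHom_of_mem _ (act_mem_WSpace _ hab)]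
    rcases units_append hb with hb | ⟨w, hw, rfl⟩
    · have hb' := units_mem_WSpace hb
      obtain ⟨B, hb⟩ := units_mem hb
      rw [act_dl_inl _ ha' hb', act_sum_inl_of_mem _ _ (tens_mem_WSpace ha' hb'),
        act_mulSymm ha hb, act_mulSymm ha (inl_mem _ hb)]
    · have hb' := units_mem_WSpace hw
      obtain ⟨B, hb⟩ := units_mem hw
      rw [act_dl_inr _ ha' hb', act_sum_inr_of_mem _ _ (tens_mem_WSpace ha' hb'),
        act_mulSymm ha hb, act_mulSymm ha (shift_mem _ hb), tens_shift_length, pre_shift]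

theorem dl_zero_left (P Q : List (Diag T)) :
    (dl P [] Q ≫ sum (castHom (mul_zero P)) (ident (mul P Q)) ≫ castHom rfl :
      Arr (mul P Q) (mul P Q)) = prod (ident P) (castHom rfl) :=
  hom_ext_mul fun a _ ha b _ hb => by
    refine (act_comp_of_mem _ _ (tens_mem_WSpace ha hb)).trans ?_
    -- Every vector over the second factor lies in the second block of `[] ++ Q`, with shift zero.
    have e := act_dl_inr [] ha hb
    rw [shift_length_nil] at e
    refine (congrArg _ e).trans ?_
    simp (maxDischargeDepth := 8) [ha, hb, shift_mem_WSpace]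

theorem dl_zero_right (P Q : List (Diag T)) :
    (dl P Q [] ≫ sum (ident (mul P Q)) (castHom (mul_zero P)) ≫
      castHom (List.append_nil (mul P Q)) : Arr (mul P (Q ++ [])) (mul P Q)) =
        prod (ident P) (castHom (List.append_nil Q)) :=
  hom_ext_mul fun a _ ha b hb hb' => by
    refine (act_comp_of_mem _ _ (tens_mem_WSpace ha hb')).trans ?_
    rcases units_append hb with hb | ⟨w, hw, rfl⟩
    · replace hb := units_mem_WSpace hb
      rw [act_dl_inl _ ha hb, act_prod _ _ ha hb', act_ident ha, act_eqToHom_of_mem _ hb']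
      simp (maxDischargeDepth := 8) [ha, hb, inl_mem_WSpace, -List.append_nil]
    · exact absurd hw units_nil

theorem dl_one (P Q : List (Diag T)) :
    (dl [Diag.one] P Q ≫ sum (castHom (one_mul P)) (castHom (one_mul Q)) : Arr _ _) =
      castHom (one_mul (P ++ Q)) :=
  hom_ext_mul fun a ha _ b hb hb' => by
    obtain rfl := units_one ha
    refine (act_comp_of_mem _ _ (tens_mem_WSpace oneVec_mem hb')).trans ?_
    rw [act_eqToHom_of_mem _ (tens_mem_WSpace oneVec_mem hb')]
    rcases units_append hb with hb | ⟨w, hw, rfl⟩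
    · replace hb := units_mem_WSpace hb
      have h := tens_mem_WSpace oneVec_mem hb
      rw [act_dl_inl _ oneVec_mem hb, act_sum_inl_of_mem _ _ h, act_eqToHom_of_mem _ h,
        tens_one_left, tens_one_left]
    · replace hb := units_mem_WSpace hw
      have h := tens_mem_WSpace oneVec_mem hb
      rw [act_dl_inr _ oneVec_mem hb, act_sum_inr_of_mem _ _ h, act_eqToHom_of_mem _ h,
        tens_one_left, tens_one_left]

end StMat

end TapeDiagrams

namespace TapeDiagrams

open RigPoly

/-! ### The interpretation preserves the rig structure -/

section general

variable {C : Type u} [Category.{v} C]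

/-- The matrix of an arrow of tapes. -/
noncomputable def toMat {P Q : List C} (t : TapeCat.Arr P Q) : StMat.Arr P Q :=
  (interpFunctor C).map t

theorem toMat_ident (P : List C) : toMat (TapeCat.ident P) = StMat.ident P :=
  (interpFunctor C).map_id P

theorem toMat_comp {P Q R : List C} (t : TapeCat.Arr P Q) (s : TapeCat.Arr Q R) :
    toMat (t ≫ s : TapeCat.Arr P R) = (toMat t ≫ toMat s : StMat.Arr P R) :=
  (interpFunctor C).map_comp t s

theorem act_toMat_comp {P Q R : List C} (t : TapeCat.Arr P Q) (s : TapeCat.Arr Q R) {v : Vec C}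
    (hv : v ∈ WSpace P) : StMat.act (toMat (t ≫ s : TapeCat.Arr P R)) v =
      StMat.act (toMat s) (StMat.act (toMat t) v) := by
  rw [toMat_comp, StMat.act_comp_of_mem _ _ hv]

theorem toMat_castHom {P Q : List C} (h : P = Q) :
    toMat (TapeCat.castHom h) = StMat.castHom h := by
  subst h
  exact toMat_ident P

theorem toMat_sum {P₁ Q₁ P₂ Q₂ : List C} (t : TapeCat.Arr P₁ Q₁) (s : TapeCat.Arr P₂ Q₂) :
    toMat (TapeCat.sum t s) = StMat.sum (toMat t) (toMat s) := by
  induction t using Quot.ind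
  induction s using Quot.ind
  rfl

theorem toMat_sumSymm (P Q : List C) : toMat (TapeCat.sumSymm P Q) = StMat.sumSymm P Q :=
  TapeTerm.interp_symmW P Q

/-- `f` and `g` are mutually inverse. -/
def TapeCat.IsInverse {P Q : List C} (f : TapeCat.Arr P Q) (g : TapeCat.Arr Q P) : Prop :=
  (f ≫ g : TapeCat.Arr P P) = TapeCat.ident P ∧ (g ≫ f : TapeCat.Arr Q Q) = TapeCat.ident Q

namespace TapeCat.IsInverse

theorem comp {P Q R : List C} {f : Arr P Q} {g : Arr Q P} {f' : Arr Q R} {g' : Arr R Q}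
    (h : IsInverse f g) (h' : IsInverse f' g') :
    IsInverse (f ≫ f' : Arr P R) (g' ≫ g : Arr R P) := by
  constructor
  · rw [comp_assoc, ← comp_assoc f', h'.1, TapeCat.id_comp, h.1]
  · rw [comp_assoc, ← comp_assoc g, h.2, TapeCat.id_comp, h'.2]

theorem sum {P Q P' Q' : List C} {f : Arr P Q} {g : Arr Q P} {f' : Arr P' Q'} {g' : Arr Q' P'}
    (h : IsInverse f g) (h' : IsInverse f' g') :
    IsInverse (TapeCat.sum f f') (TapeCat.sum g g') := by
  have e (P P' : List C) : TapeCat.sum (ident P) (ident P') = ident (P ++ P') :=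
    FreeHom.idW_tensor_idW P P'
  constructor
  · rw [← sum_comp, h.1, h'.1, e]
  · rw [← sum_comp, h.2, h'.2, e]

theorem castHom {P Q : List C} (h : P = Q) (h' : Q = P) :
    IsInverse (TapeCat.castHom h) (TapeCat.castHom h') := by
  subst h
  exact ⟨TapeCat.id_comp _, TapeCat.id_comp _⟩

theorem sumSymm (P Q : List C) : IsInverse (TapeCat.sumSymm P Q) (TapeCat.sumSymm Q P) :=
  ⟨FreeHom.sound (.symm_symm P Q), FreeHom.sound (.symm_symm Q P)⟩

end TapeCat.IsInverse

end general

variable {T : MonoidalTheory.{u, v}}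

theorem TapeCat.dl_isInverse (P Q R : List (Diag T)) :
    TapeCat.IsInverse (TapeCat.dl P Q R) (TapeCat.dlInv P Q R) := by
  induction P with
  | nil => exact .castHom _ _
  | cons U P ih =>
    have h := ((IsInverse.castHom (lmul_append U Q R) (lmul_append U Q R).symm).sum ih).comp
      ((IsInverse.castHom (P := (lmul U Q ++ lmul U R) ++ (mul P Q ++ mul P R))
        (Q := lmul U Q ++ ((lmul U R ++ mul P Q) ++ mul P R)) (by simp) (by simp)).comp
      (((IsInverse.castHom (rfl : lmul U Q = _) rfl).sum
        ((IsInverse.sumSymm (lmul U R) (mul P Q)).sum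
          (IsInverse.castHom (rfl : mul P R = _) rfl))).comp
        (IsInverse.castHom (Q := mul (U :: P) Q ++ mul (U :: P) R) (by simp [mul])
          (by simp [mul]))))
    rw [TapeCat.comp_assoc, TapeCat.comp_assoc] at h
    exact h

theorem tens_shift_right (n m : ℕ) (a b : Vec (Diag T)) :
    tens n a (shift m b) = shift m (tens n a b) := by
  refine LinearMap.congr_fun₂ (f := (tens n).compl₁₂ LinearMap.id (shift m))
    (g := (tens n).compr₂ (shift m)) (bilin_ext fun x y => ?_) a b
  simp only [LinearMap.compl₁₂_apply, LinearMap.compr₂_apply, LinearMap.id_apply, shift_ket,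
    tens_ket, Nat.add_assoc]

/-- Over a single monomial every position is zero, so the stride is irrelevant. -/
theorem tens_single (n m : ℕ) {U : Diag T} {a : Vec (Diag T)} (ha : a ∈ WSpace [U])
    (b : Vec (Diag T)) : tens n a b = tens m a b := by
  refine TapeTerm.eqOn_single ((tens n).flip b) ((tens m).flip b) (fun {A} c => ?_) ha
  rw [LinearMap.flip_apply, LinearMap.flip_apply]
  refine LinearMap.congr_fun (linearMap_ext fun y => ?_) b
  rw [tens_ket, tens_ket, Nat.mul_zero, Nat.mul_zero]

theorem mul_singleton (U : Diag T) (Q : List (Diag T)) : mul [U] Q = lmul U Q :=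
  List.append_nil _

theorem tens_mem_lmul (n : ℕ) {U : Diag T} {Q : List (Diag T)} {a b : Vec (Diag T)}
    (ha : a ∈ WSpace [U]) (hb : b ∈ WSpace Q) : tens n a b ∈ WSpace (lmul U Q) := by
  rw [tens_single n Q.length ha, ← mul_singleton]
  exact tens_mem_WSpace ha hb

theorem tens_mem_rmul {U : Diag T} {P : List (Diag T)} {a b : Vec (Diag T)}
    (ha : a ∈ WSpace P) (hb : b ∈ WSpace [U]) : tens 1 a b ∈ WSpace (rmul P U) := by
  rw [← mul_single]
  exact tens_mem_WSpace ha hb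

open StMat in
theorem act_toMat_dl_cons (U : Diag T) (P Q R : List (Diag T)) {v : Vec (Diag T)}
    (hv : v ∈ WSpace (lmul U (Q ++ R) ++ mul P (Q ++ R))) :
    act (toMat (TapeCat.dl (U :: P) Q R)) v =
      act (sum (ident (lmul U Q)) (sum (sumSymm (lmul U R) (mul P Q)) (ident (mul P R))))
        (act (sum (castHom (lmul_append U Q R)) (toMat (TapeCat.dl P Q R))) v) := by
  refine (act_toMat_comp (P := lmul U (Q ++ R) ++ mul P (Q ++ R)) _ _ hv).trans ?_
  rw [toMat_sum, toMat_castHom]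
  have h₁ := act_mem_WSpace (sum (castHom (lmul_append U Q R)) (toMat (TapeCat.dl P Q R))) hv
  refine (act_toMat_comp _ _ h₁).trans ?_
  rw [toMat_castHom, act_eqToHom_of_mem _ h₁]
  have h₂ : act (sum (castHom (lmul_append U Q R)) (toMat (TapeCat.dl P Q R))) v ∈
      WSpace (lmul U Q ++ ((lmul U R ++ mul P Q) ++ mul P R)) := by
    simpa [List.append_assoc] using h₁
  refine (act_toMat_comp _ _ h₂).trans ?_
  rw [toMat_sum, toMat_sum, toMat_sumSymm, toMat_castHom, toMat_castHom, toMat_castHom]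
  exact act_eqToHom_of_mem _ (act_mem_WSpace (sum (ident (lmul U Q))
    (sum (sumSymm (lmul U R) (mul P Q)) (ident (mul P R)))) h₂)

-- Induction on the first factor, following the recursion for tapes, which exchanges the blocks `U ⊗
-- R` and `P ⊗ Q`. It is tested on the four kinds of pure tensors.
open StMat in
theorem toMat_dl (P Q R : List (Diag T)) : toMat (TapeCat.dl P Q R) = StMat.dl P Q R := by
  induction P with
  | nil => exact hom_ext_nil _ _
  | cons U P ih =>
    refine hom_ext_mul fun a ha ha' b hb hb' => ?_
    have hv := tens_mem_WSpace ha' hb'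
    refine (act_toMat_dl_cons U P Q R hv).trans ?_
    rw [ih]
    rw [← List.singleton_append] at ha
    have hl (Q) (v : Vec (Diag T)) : shift (mul (U :: P) Q).length v =
      shift (lmul U Q).length (shift (mul P Q).length v) := shift_length_append _ _ v
    have hs (Q : List (Diag T)) (a b : Vec (Diag T)) : tens Q.length (shift [U].length a) b =
        shift (lmul U Q).length (tens Q.length a b) := by
      rw [tens_shift_length, mul_singleton]
    rcases units_append ha with ha | ⟨a, haw, rfl⟩
    · have ha₁ := units_mem_WSpace ha
      rcases units_append hb with hb | ⟨b, hbw, rfl⟩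
      · have hb₁ := units_mem_WSpace hb
        have h := tens_mem_lmul (Q ++ R).length ha₁ hb₁
        have h' := tens_mem_lmul (Q ++ R).length ha₁ hb'
        rw [act_sum_inl_of_mem _ _ h', act_eqToHom_of_mem _ h', act_sum_inl_of_mem _ _ h,
          act_ident h, act_dl_inl _ ha' hb₁]
        exact tens_single _ _ ha₁ b
      · have hb₁ := units_mem_WSpace hbw
        have h := tens_mem_lmul (Q ++ R).length ha₁ hb₁
        have h' := tens_mem_lmul (Q ++ R).length ha₁ hb'
        have e : shift Q.length = (shift (lmul U Q).length : Vec (Diag T) →ₗ[ℝ] _) := by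
          rw [length_lmul]
        rw [act_sum_inl_of_mem _ _ h', act_eqToHom_of_mem _ h', act_dl_inr _ ha' hb₁,
          tens_shift_right, e, act_sum_inr_of_mem _ _ (inl_mem_WSpace _ (inl_mem_WSpace _ h)),
          act_sum_inl_of_mem _ _ (inl_mem_WSpace _ h), act_sumSymm_inl _ _ h, hl,
          tens_single _ R.length ha₁]
    · have ha₁ := units_mem_WSpace haw
      rw [hs, act_sum_inr_of_mem _ _ (tens_mem_WSpace ha₁ hb'), shift_length_append]
      rcases units_append hb with hb | ⟨b, hbw, rfl⟩
      · have hb₁ := units_mem_WSpace hb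
        have h := tens_mem_WSpace ha₁ hb₁
        rw [act_dl_inl _ ha₁ hb₁, act_sum_inr_of_mem _ _
            (inl_mem_WSpace (P := lmul U R ++ mul P Q) _ (shift_mem_WSpace (lmul U R) h)),
          act_sum_inl_of_mem _ _ (shift_mem_WSpace _ h), act_sumSymm_inr _ _ h]
        exact ((congrArg _ (hs (Q ++ R) a b)).symm.trans ((act_dl_inl R ha' hb₁).trans (hs Q a b))).symm
      · have hb₁ := units_mem_WSpace hbw
        have h := tens_mem_WSpace ha₁ hb₁
        rw [act_dl_inr _ ha₁ hb₁, ← shift_length_append (lmul U R),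
          act_sum_inr_of_mem _ _ (shift_mem_WSpace _ h), act_sum_inr_of_mem _ _ h, act_ident h]
        refine Eq.trans ?_ ((act_dl_inr Q ha' hb₁).symm.trans (congrArg _ (hs (Q ++ R) a _)))
        refine Eq.trans ?_ (congrArg _ (hs R a b).symm)
        rw [shift_length_append]
        exact (hl Q _).symm

theorem toMat_dl_comp_dlInv (P Q R : List (Diag T)) :
    (StMat.dl P Q R ≫ toMat (TapeCat.dlInv P Q R) : StMat.Arr _ _) =
      StMat.ident (mul P (Q ++ R)) := by
  rw [← toMat_dl, ← toMat_comp, (TapeCat.dl_isInverse P Q R).1, toMat_ident]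

theorem toMat_dlInv_comp_dl (P Q R : List (Diag T)) :
    (toMat (TapeCat.dlInv P Q R) ≫ StMat.dl P Q R : StMat.Arr _ _) =
      StMat.ident (mul P Q ++ mul P R) := by
  rw [← toMat_dl, ← toMat_comp, (TapeCat.dl_isInverse P Q R).2, toMat_ident]

end TapeDiagrams

/-! ### Whiskerings, products and symmetries of tapes as matrices -/

namespace TapeDiagrams

open RigPoly StMat

section map

variable {C : Type u} [Category.{v} C] {D : Type u'} [Category.{v'} D]

/-- The linear map `θ` intertwines the actions of tapes with those of their images under `F`. -/
structure Intertwines (F : C ⥤ D) (θ : Vec C →ₗ[ℝ] Vec D) : Prop where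
  shift : ∀ n v, θ (shift n v) = TapeDiagrams.shift n (θ v)
  mem : ∀ U, ∀ v ∈ WSpace [U], θ v ∈ WSpace [F.obj U]
  tape : ∀ {U V : C} (c : U ⟶ V), ∀ v ∈ WSpace [U],
    act (StMat.tape (F.map c)) (θ v) = θ (act (StMat.tape c) v)

namespace Intertwines

variable {F : C ⥤ D} {θ : Vec C →ₗ[ℝ] Vec D} (h : Intertwines F θ)

theorem shift_map (h : Intertwines F θ) (P : List C) (v : Vec C) :
    θ (TapeDiagrams.shift P.length v) = TapeDiagrams.shift (P.map F.obj).length (θ v) := by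
  rw [h.shift, List.length_map]

theorem mem_map (h : Intertwines F θ) (P : List C) {v : Vec C} (hv : v ∈ WSpace P) :
    θ v ∈ WSpace (P.map F.obj) := by
  induction P generalizing v with
  | nil => rw [WSpace_nil hv, map_zero]; exact zero_mem _
  | cons U P ih =>
    refine WSpace_append_induction (P := [U]) hv (fun a b ha hb => ?_) (fun v hv => ?_)
      fun v hv => ?_
    · rw [map_add]; exact add_mem ha hb
    · exact inl_mem_WSpace (P := [F.obj U]) (P.map F.obj) (h.mem U v hv)
    · rw [h.shift_map]
      exact shift_mem_WSpace [F.obj U] (ih hv)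

theorem act_gen (h : Intertwines F θ) {P Q : List C} (s : TapeGen C P Q) {v : Vec C}
    (hv : v ∈ WSpace P) :
    act (TapeTerm.interp (TapeTerm.mapGen F s)) (θ v) = θ (act (TapeTerm.interpGen s) v) := by
  cases s with
  | split p U =>
    refine (TapeTerm.act_split _ _ (h.mem U v hv)).trans ?_
    refine Eq.trans ?_ (congrArg θ (TapeTerm.act_split _ _ hv).symm)
    rw [map_add, map_smul, map_smul, h.shift]
  | bang U =>
    refine (TapeTerm.act_bang _ _).trans ?_
    refine Eq.trans ?_ (congrArg θ (TapeTerm.act_bang _ _).symm)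
    rw [map_zero]
  | cobang U => rw [WSpace_nil hv, map_zero, map_zero, map_zero, map_zero]
  | codiag U =>
    refine WSpace_append_induction (P := [U]) (Q := [U]) hv (fun a b ha hb => ?_) (fun v hv => ?_)
      fun v hv => ?_
    · simp only [map_add, ha, hb]
    · refine (TapeTerm.act_codiag_inl _ (h.mem U v hv)).trans ?_
      exact congrArg θ (TapeTerm.act_codiag_inl _ hv).symm
    · refine (congrArg _ (h.shift_map [U] v)).trans
        ((TapeTerm.act_codiag_inr _ (h.mem U v hv)).trans ?_)
      exact congrArg θ (TapeTerm.act_codiag_inr _ hv).symm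
  | tape c => exact h.tape c v hv

/-- All generators other than `tape` act through shifts, scalars and sums. A linear map that
respects shifts and the generators `tape` therefore respects every tape. -/
theorem act_map (h : Intertwines F θ) {P Q : List C} (t : TapeTerm C P Q) {v : Vec C}
    (hv : v ∈ WSpace P) :
    act (TapeTerm.interp (TapeTerm.map F t)) (θ v) = θ (act (TapeTerm.interp t) v) := by
  induction t generalizing v with
  | idZero => rw [WSpace_nil hv, map_zero, map_zero, map_zero, map_zero]
  | id A =>
    refine (act_ident (h.mem A v hv)).trans ?_
    exact congrArg θ (act_ident hv).symm
  | symm A B =>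
    refine WSpace_append_induction hv (fun a b ha hb => ?_) (fun v hv => ?_) fun v hv => ?_
    · simp only [map_add, ha, hb]
    · refine (act_sumSymm_inl _ _ (h.mem A v hv)).trans ?_
      refine Eq.trans ?_ (congrArg θ (act_sumSymm_inl _ _ hv).symm)
      exact (h.shift _ _).symm
    · refine (congrArg _ (h.shift_map [A] v)).trans
        ((act_sumSymm_inr _ _ (h.mem B v hv)).trans ?_)
      exact congrArg θ (act_sumSymm_inr _ _ hv).symm
  | gen s => exact h.act_gen s hv
  | comp f g ihf ihg =>
    refine (TapeTerm.act_interp_comp _ _ (h.mem_map _ hv)).trans ?_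
    rw [TapeTerm.act_interp_comp _ _ hv, ← ihg (act_mem_WSpace _ hv), ← ihf hv]
    rfl
  | @tensor P₁ Q₁ P₂ Q₂ f g ihf ihg =>
    have e : act (TapeTerm.interp (TapeTerm.map F (f.tensor g))) =
        act (TapeTerm.interp (Term.tensor (TapeTerm.map F f) (TapeTerm.map F g))) :=
      TapeTerm.act_interp_castT _ _ _
    rw [e]
    refine WSpace_append_induction hv (fun a b ha hb => ?_) (fun v hv => ?_) fun v hv => ?_
    · simp only [map_add, ha, hb]
    · rw [TapeTerm.act_interp_tensor_inl _ _ (h.mem_map _ hv),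
        TapeTerm.act_interp_tensor_inl _ _ hv, ihf hv]
    · rw [h.shift_map, TapeTerm.act_interp_tensor_inr _ _ (h.mem_map _ hv),
        TapeTerm.act_interp_tensor_inr _ _ hv, ihg hv, h.shift_map]

theorem act_toMat_map (h : Intertwines F θ) {P Q : List C} (t : TapeCat.Arr P Q) {v : Vec C}
    (hv : v ∈ WSpace P) :
    act (toMat (TapeCat.map F t)) (θ v) = θ (act (toMat t) v) := by
  induction t using Quot.ind with
  | _ t => exact h.act_map t hv

end Intertwines

end map

variable {T : MonoidalTheory.{u, v}}

theorem act_tape_ket {U V : Diag T} (c : U ⟶ V) {A : Diag T} (f : A ⟶ U) :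
    act (StMat.tape c) (ket (0, ⟨A, U, f⟩)) = ket (0, AnyHom.comp ⟨A, U, f⟩ ⟨U, V, c⟩) := by
  rw [TapeTerm.act_tape, AnyHom.comp_mk]

theorem bilin_eqOn_single {C : Type u} [Category.{v} C] {W : Type*} [AddCommMonoid W] [Module ℝ W]
    {U V : C} (f g : Vec C →ₗ[ℝ] Vec C →ₗ[ℝ] W)
    (h : ∀ {A B : C} (c : A ⟶ U) (d : B ⟶ V), f (ket (0, ⟨A, U, c⟩)) (ket (0, ⟨B, V, d⟩)) =
      g (ket (0, ⟨A, U, c⟩)) (ket (0, ⟨B, V, d⟩))) {a b : Vec C}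
    (ha : a ∈ WSpace [U]) (hb : b ∈ WSpace [V]) : f a b = g a b :=
  TapeTerm.eqOn_single (f.flip b) (g.flip b) (fun c =>
    TapeTerm.eqOn_single (f _) (g _) (fun d => h c d) hb) ha

theorem act_tape_tens (n m : ℕ) {U V U' V' : Diag T} (c : U ⟶ V) (d : U' ⟶ V') {a b : Vec (Diag T)}
    (ha : a ∈ WSpace [U]) (hb : b ∈ WSpace [U']) :
    act (StMat.tape (Diag.tensor c d)) (tens n a b) =
      tens m (act (StMat.tape c) a) (act (StMat.tape d) b) := by
  have key : (tens n).compr₂ (act (StMat.tape (Diag.tensor c d))) a b =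
      (tens m).compl₁₂ (act (StMat.tape c)) (act (StMat.tape d)) a b := by
    refine bilin_eqOn_single _ _ (fun {A B} f g => ?_) ha hb
    rw [LinearMap.compr₂_apply, LinearMap.compl₁₂_apply, act_tape_ket, act_tape_ket, tens_ket,
      tens_ket, ← AnyHom.tens_comp rfl rfl]
    exact act_tape_ket (Diag.tensor c d) (Diag.tensor f g)
  rwa [LinearMap.compr₂_apply, LinearMap.compl₁₂_apply] at key

theorem act_tape_id {U : Diag T} {a : Vec (Diag T)} (ha : a ∈ WSpace [U]) :
    act (StMat.tape (𝟙 U)) a = a := by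
  refine TapeTerm.eqOn_single _ LinearMap.id (fun {A} f => ?_) ha
  rw [TapeTerm.act_tape, Category.comp_id, LinearMap.id_apply]

theorem act_tape_left {U : Diag T} {a : Vec (Diag T)} (ha : a ∈ WSpace [U]) {V W : Diag T}
    (c : V ⟶ W) {v : Vec (Diag T)} (hv : v ∈ WSpace [V]) :
    act (StMat.tape (Diag.tensor (𝟙 U) c)) (tens 0 a v) = tens 0 a (act (StMat.tape c) v) := by
  rw [act_tape_tens 0 0 (𝟙 U) c ha hv, act_tape_id ha]

theorem act_tape_right {U : Diag T} {b : Vec (Diag T)} (hb : b ∈ WSpace [U]) {V W : Diag T}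
    (c : V ⟶ W) {v : Vec (Diag T)} (hv : v ∈ WSpace [V]) :
    act (StMat.tape (Diag.tensor c (𝟙 U))) (tens 1 v b) = tens 1 (act (StMat.tape c) v) b := by
  rw [act_tape_tens 1 1 c (𝟙 U) hv hb, act_tape_id hb]

theorem tens_flip_shift (b : Vec (Diag T)) (n : ℕ) (v : Vec (Diag T)) :
    (tens 1).flip b (shift n v) = shift n ((tens 1).flip b v) := by
  rw [LinearMap.flip_apply, LinearMap.flip_apply, tens_shift_left, Nat.mul_one]

theorem tens_mem_single (n : ℕ) {U V : Diag T} {a b : Vec (Diag T)}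
    (ha : a ∈ WSpace [U]) (hb : b ∈ WSpace [V]) : tens n a b ∈ WSpace [Diag.mul U V] := by
  have e : [Diag.mul U V] = lmul U [V] := rfl
  rw [e]
  exact tens_mem_lmul n ha hb

/-- Tensoring with a fixed vector over `U` realises whiskering by `U`. The stride `0` serves every
second factor, since the positions in `a` are all zero. On the right the stride is `1`, the length
of the one-letter factor. -/
theorem intertwines_left {U : Diag T} {a : Vec (Diag T)} (ha : a ∈ WSpace [U]) :
    Intertwines (Diag.leftFunctor U) (tens 0 a) :=
  ⟨fun n v => tens_shift_right 0 n a v, fun _ _ hv => tens_mem_single 0 ha hv,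
    fun c _ hv => act_tape_left ha c hv⟩

theorem intertwines_right {U : Diag T} {b : Vec (Diag T)} (hb : b ∈ WSpace [U]) :
    Intertwines (Diag.rightFunctor U) ((tens 1).flip b) where
  shift := tens_flip_shift b
  mem V v hv := by
    rw [LinearMap.flip_apply]
    exact tens_mem_single 1 hv hb
  tape c v hv := by
    rw [LinearMap.flip_apply, LinearMap.flip_apply]
    exact act_tape_right hb c hv

theorem act_toMat_leftMono (n : ℕ) {U : Diag T} {P Q : List (Diag T)} (t : TapeCat.Arr P Q)
    {a v : Vec (Diag T)} (ha : a ∈ WSpace [U]) (hv : v ∈ WSpace P) :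
    act (toMat (TapeCat.leftMono U t)) (tens n a v) = tens n a (act (toMat t) v) := by
  rw [tens_single n 0 ha, tens_single n 0 ha]
  exact (intertwines_left ha).act_toMat_map t hv

theorem act_toMat_rightMono {U : Diag T} {P Q : List (Diag T)} (t : TapeCat.Arr P Q)
    {b v : Vec (Diag T)} (hb : b ∈ WSpace [U]) (hv : v ∈ WSpace P) :
    act (toMat (TapeCat.rightMono U t)) (tens 1 v b) = tens 1 (act (toMat t) v) b :=
  (intertwines_right hb).act_toMat_map t hv

theorem tens_shift_cons (U : Diag T) (Q : List (Diag T)) (a b : Vec (Diag T)) :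
    tens Q.length (shift [U].length a) b = shift (lmul U Q).length (tens Q.length a b) := by
  rw [tens_shift_length, mul_singleton]

theorem toMat_leftWhisker (S : List (Diag T)) {P Q : List (Diag T)} (t : TapeCat.Arr P Q) :
    toMat (TapeCat.leftWhisker S t) = prod (StMat.ident S) (toMat t) := by
  induction S with
  | nil => exact hom_ext_nil _ _
  | cons W S ih =>
    refine hom_ext_mul fun a ha ha' b _ hb => ?_
    refine Eq.trans ?_ (act_prod _ _ ha' hb).symm
    rw [act_ident ha']
    refine (congrArg (fun M => act M _)
      ((toMat_sum _ _).trans (congrArg₂ StMat.sum rfl ih))).trans ?_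
    rw [← List.singleton_append] at ha
    rcases units_append ha with ha | ⟨a, haw, rfl⟩
    · have ha₁ := units_mem_WSpace ha
      refine (act_sum_inl_of_mem _ _ (tens_mem_lmul _ ha₁ hb)).trans ?_
      rw [act_toMat_leftMono _ t ha₁ hb, tens_single _ _ ha₁]
    · have ha₁ := units_mem_WSpace haw
      rw [tens_shift_cons, tens_shift_cons]
      refine (act_sum_inr_of_mem _ _ (tens_mem_WSpace ha₁ hb)).trans ?_
      rw [act_prod _ _ ha₁ hb, act_ident ha₁]

theorem toMat_rightMono (W : Diag T) {P Q : List (Diag T)} (t : TapeCat.Arr P Q) :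
    toMat (TapeCat.castHom (mul_single P W) ≫ TapeCat.rightMono W t ≫
      TapeCat.castHom (mul_single Q W).symm : TapeCat.Arr (mul P [W]) (mul Q [W])) =
      prod (toMat t) (StMat.ident [W]) := by
  refine hom_ext_mul fun a _ ha b _ hb => ?_
  have h : tens [W].length a b ∈ WSpace (mul P [W]) := tens_mem_WSpace ha hb
  have h' : tens 1 (act (toMat t) a) b ∈ WSpace (rmul Q W) :=
    tens_mem_rmul (act_mem_WSpace (toMat t) ha) hb
  refine (act_toMat_comp _ _ h).trans ?_
  rw [toMat_castHom, act_eqToHom_of_mem _ h]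
  refine (act_toMat_comp _ _ (tens_mem_rmul ha hb)).trans ?_
  rw [toMat_castHom, act_prod _ _ ha hb, act_ident hb]
  exact (congrArg _ (act_toMat_rightMono t hb ha)).trans (act_eqToHom_of_mem _ h')

/-- The whiskering by `W ⊕ S` is a block sum conjugated by distributors. Naturality of the matrix
distributor moves it past the block sum, where it cancels against its inverse. -/
theorem toMat_rightWhisker (S : List (Diag T)) {P Q : List (Diag T)} (t : TapeCat.Arr P Q) :
    toMat (TapeCat.rightWhisker S t) = prod (toMat t) (StMat.ident S) := by
  induction S with
  | nil => exact hom_ext_of_eq_nil (mul_zero P) _ _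
  | cons W S ih =>
    refine (toMat_comp _ _).trans ?_
    refine (congrArg₂ StMat.comp (toMat_dl P [W] S)
      ((toMat_comp _ _).trans (congrArg₂ StMat.comp (toMat_sum _ _) rfl))).trans ?_
    rw [toMat_rightMono, ih]
    have h := dl_nat (toMat t) (StMat.ident [W]) (StMat.ident S)
    refine (StMat.assoc _ _ _).symm.trans
      ((congrArg (fun M => StMat.comp M _) h.symm).trans ((StMat.assoc _ _ _).trans ?_))
    refine (congrArg (StMat.comp _) (toMat_dl_comp_dlInv Q [W] S)).trans ((StMat.comp_id _).trans ?_)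
    rw [sum_ident]
    rfl

/-- The product of tapes whiskers first on the left and then on the right. Functoriality of the
Kronecker product fuses the two factors. -/
theorem toMat_prod {P Q R S : List (Diag T)} (t : TapeCat.Arr P Q) (s : TapeCat.Arr R S) :
    toMat (TapeCat.prod t s) = prod (toMat t) (toMat s) := by
  rw [TapeCat.prod, toMat_comp, toMat_leftWhisker, toMat_rightWhisker, ← prod_comp]
  exact congrArg₂ prod (StMat.id_comp _) (StMat.comp_id _)

/-- A version with fixed source, since the precomposed symmetry depends on the source of the vector.
-/
theorem eqOn_VSpace_cons {C : Type u} [Category.{v} C] {W : Type*} [AddCommMonoid W] [Module ℝ W]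
    {A U : C} {P : List C} (f g : Vec C →ₗ[ℝ] W) (h₁ : ∀ v ∈ VSpace A [U], f v = g v)
    (h₂ : ∀ v ∈ VSpace A P, f (shift 1 v) = g (shift 1 v)) {v : Vec C}
    (hv : v ∈ VSpace A (U :: P)) : f v = g v := by
  refine eqOn_VSpace (fun x hx => ?_) hv
  rcases valid_append_iff (P := [U]).1 hx with hx | ⟨hl, hx⟩
  · exact h₁ _ (ket_mem hx)
  · have := h₂ _ (ket_mem hx)
    rwa [shift_ket, show 1 + (x.1 - [U].length) = x.1 from Nat.add_sub_cancel' hl] at this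

theorem act_tape_symm (n m : ℕ) {A B U V : Diag T} {a b : Vec (Diag T)}
    (ha : a ∈ VSpace A [U]) (hb : b ∈ VSpace B [V]) :
    act (StMat.tape (Diag.symm U V)) (tens n a b) = pre (AnyHom.symm A B) (tens m b a) := by
  have key : (tens n).compr₂ (act (StMat.tape (Diag.symm U V))) a b =
      (tens m).flip.compr₂ (pre (AnyHom.symm A B)) a b := by
    refine bilin_eqOn_VSpace _ _ (fun x y hx hy => ?_) ha hb
    obtain ⟨k, f, rfl⟩ := exists_of_valid hx
    obtain ⟨l, g, rfl⟩ := exists_of_valid hy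
    obtain rfl : k = ⟨0, Nat.one_pos⟩ := Subsingleton.elim (α := Fin 1) _ _
    obtain rfl : l = ⟨0, Nat.one_pos⟩ := Subsingleton.elim (α := Fin 1) _ _
    rw [LinearMap.compr₂_apply, LinearMap.compr₂_apply, LinearMap.flip_apply, tens_ket, tens_ket,
      pre_ket]
    refine (act_tape_ket (Diag.symm U V) (Diag.tensor f g)).trans ?_
    exact congrArg (fun x => ket (0, x))
      (AnyHom.symm_nat (f := ⟨A, U, f⟩) (g := ⟨B, V, g⟩))
  rwa [LinearMap.compr₂_apply, LinearMap.compr₂_apply, LinearMap.flip_apply] at key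

theorem act_toMat_symmMono {A B : Diag T} (P : List (Diag T)) (V : Diag T) {a b : Vec (Diag T)}
    (ha : a ∈ VSpace A P) (hb : b ∈ VSpace B [V]) :
    act (toMat (TapeCat.symmMono P V)) (tens 1 a b) = pre (AnyHom.symm A B) (tens P.length b a) := by
  induction P generalizing a with
  | nil => rw [WSpace_nil (VSpace_le_WSpace _ _ ha)]; simp
  | cons U P ih =>
    have hb' := VSpace_le_WSpace _ _ hb
    refine (congrArg (fun M => act M _) (toMat_sum _ _)).trans ?_
    refine eqOn_VSpace_cons (act (StMat.sum (toMat (TapeCat.tape (Diag.symm U V)))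
      (toMat (TapeCat.symmMono P V))) ∘ₗ (tens 1).flip b)
      (pre (AnyHom.symm A B) ∘ₗ tens (U :: P).length b) (fun a ha => ?_) (fun a ha => ?_) ha
    · have ha' := VSpace_le_WSpace _ _ ha
      rw [LinearMap.comp_apply, LinearMap.comp_apply, LinearMap.flip_apply,
        act_sum_inl_of_mem _ _ (tens_mem_single 1 ha' hb')]
      exact act_tape_symm _ _ ha hb
    · have ha' := VSpace_le_WSpace _ _ ha
      have h : tens 1 a b ∈ WSpace (mul P [V]) := tens_mem_WSpace (Q := [V]) ha' hb'
      rw [LinearMap.comp_apply, LinearMap.comp_apply, LinearMap.flip_apply, tens_shift_left,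
        tens_shift_right, pre_shift, tens_single (U :: P).length P.length hb', ← ih ha, Nat.mul_one]
      exact act_sum_inr_of_mem (P₁ := [Diag.mul U V]) (Q₁ := [Diag.mul V U]) _ _ h

theorem toMat_mulSymm (P Q : List (Diag T)) :
    toMat (TapeCat.mulSymm P Q) = StMat.mulSymm P Q := by
  induction Q with
  | nil => exact hom_ext_of_eq_nil (mul_zero P) _ _
  | cons V Q ih =>
    refine hom_ext_mul fun a ha ha' b hb hb' => ?_
    obtain ⟨A, ha⟩ := units_mem ha
    refine (act_toMat_comp _ _ (tens_mem_WSpace ha' hb')).trans ?_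
    refine (congrArg (fun M => act M _)
      ((toMat_sum _ _).trans (congrArg₂ StMat.sum rfl ih))).trans ?_
    rw [← List.singleton_append] at hb
    rcases units_append hb with hb | ⟨b, hbw, rfl⟩
    · have hb₁ := units_mem_WSpace hb
      obtain ⟨B, hb⟩ := units_mem hb
      refine Eq.trans ?_ (act_mulSymm ha (inl_mem (P := [V]) Q hb)).symm
      have e : act (toMat (TapeCat.dl P [V] Q)) (tens (V :: Q).length a b) = tens 1 a b := by
        rw [toMat_dl]
        exact act_dl_inl Q ha' hb₁
      have h : tens 1 a b ∈ WSpace (mul P [V]) := tens_mem_WSpace (Q := [V]) ha' hb₁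
      rw [e, act_sum_inl_of_mem _ _ h,
        act_toMat_symmMono P V ha hb]
    · have hb₁ := units_mem_WSpace hbw
      obtain ⟨B, hb⟩ := units_mem hbw
      refine Eq.trans ?_ (act_mulSymm ha (shift_mem [V] hb)).symm
      have e : act (toMat (TapeCat.dl P [V] Q)) (tens (V :: Q).length a (shift [V].length b)) =
          shift (mul P [V]).length (tens Q.length a b) := by
        rw [toMat_dl]
        exact act_dl_inr [V] ha' hb₁
      rw [e, act_sum_inr_of_mem _ _ (tens_mem_WSpace ha' hb₁), act_mulSymm ha hb,
        tens_shift_cons, pre_shift]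

end TapeDiagrams

/-! ### The rig category of matrices -/

namespace TapeDiagrams

open RigPoly

namespace StMat

variable {T : MonoidalTheory.{u, v}}

theorem isIso_castHom {P Q : List (Diag T)} (h : P = Q) :
    @IsIso (StMat (Diag T)) _ P Q (castHom h) :=
  ⟨castHom h.symm, castHom_comp h h.symm, castHom_comp h.symm h⟩

/-- The matrix is the identity, read along an equality of words. -/
def IsCast {P Q : List (Diag T)} (M : Arr P Q) : Prop := ∃ h : P = Q, M = castHom h

namespace IsCast

variable {P Q R P' Q' : List (Diag T)}

/-- Coherence axioms that involve only strict structure compare two such casts between the same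
words, and proofs of equality are unique. -/
theorem eq {M N : Arr P Q} (h : IsCast M) (h' : IsCast N) : M = N := by
  obtain ⟨e, rfl⟩ := h
  obtain ⟨_, rfl⟩ := h'
  rfl

theorem cast (h : P = Q) : IsCast (castHom h) := ⟨h, rfl⟩

theorem id : IsCast (ident P) := ⟨rfl, rfl⟩

theorem comp {M : Arr P Q} {N : Arr Q R} (h : IsCast M) (h' : IsCast N) :
    IsCast (M ≫ N : Arr P R) := by
  obtain ⟨e, rfl⟩ := h
  obtain ⟨e', rfl⟩ := h'
  exact ⟨e.trans e', castHom_comp e e'⟩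

theorem sum {M : Arr P Q} {N : Arr P' Q'} (h : IsCast M) (h' : IsCast N) :
    IsCast (StMat.sum M N) := by
  obtain ⟨e, rfl⟩ := h
  obtain ⟨e', rfl⟩ := h'
  exact ⟨_, sum_castHom e e'⟩

theorem prod {M : Arr P Q} {N : Arr P' Q'} (h : IsCast M) (h' : IsCast N) :
    IsCast (StMat.prod M N) := by
  obtain ⟨e, rfl⟩ := h
  obtain ⟨e', rfl⟩ := h'
  exact ⟨_, prod_castHom e e'⟩

end IsCast

end StMat

open StMat

variable (T : MonoidalTheory.{u, v})

theorem stMatRig_add_isSymmetricMonoidal : (stMatRig T).add.IsSymmetricMonoidal where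
  hom_id P Q := sum_ident P Q
  hom_comp f g f' g' := StMat.sum_comp f g f' g'
  assoc_nat f g h := hom_eq_of_heq (List.append_assoc _ _ _) (List.append_assoc _ _ _)
    (StMat.sum_assoc f g h)
  lunit_nat f := hom_eq_of_heq (List.nil_append _) (List.nil_append _)
    (heq_of_eq (StMat.ident_nil_sum f))
  runit_nat f := hom_eq_of_heq (List.append_nil _) (List.append_nil _) (StMat.sum_ident_nil f)
  symm_nat f g := sum_symm_nat f g
  pentagon (P Q R S : List (Diag T)) := IsCast.eq
    (.comp (.sum (.cast (List.append_assoc P Q R)) .id)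
      (.comp (.cast (List.append_assoc P (Q ++ R) S)) (.sum .id (.cast (List.append_assoc Q R S)))))
    (.comp (.cast (List.append_assoc (P ++ Q) R S)) (.cast (List.append_assoc P Q (R ++ S))))
  triangle P Q := IsCast.eq
    (.comp (.cast (List.append_assoc P [] Q)) (.sum .id (.cast (List.nil_append Q))))
    (.sum (.cast (List.append_nil P)) .id)
  symm_symm P Q := sumSymm_sumSymm P Q
  hexagon P Q R := add_hexagon P Q R

theorem stMatRig_mul_isSymmetricMonoidal : (stMatRig T).mul.IsSymmetricMonoidal where
  hom_id P Q := prod_ident P Q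
  hom_comp f g f' g' := prod_comp f g f' g'
  assoc_nat f g h := hom_eq_of_heq (RigPoly.mul_assoc _ _ _) (RigPoly.mul_assoc _ _ _)
    (prod_assoc f g h)
  lunit_nat f := hom_eq_of_heq (RigPoly.one_mul _) (RigPoly.one_mul _) (ident_one_prod f)
  runit_nat f := hom_eq_of_heq (RigPoly.mul_one _) (RigPoly.mul_one _) (prod_ident_one f)
  symm_nat f g := mul_symm_nat f g
  pentagon (P Q R S : List (Diag T)) := IsCast.eq
    (.comp (.prod (.cast (RigPoly.mul_assoc P Q R)) .id)
      (.comp (.cast (RigPoly.mul_assoc P (mul Q R) S))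
        (.prod .id (.cast (RigPoly.mul_assoc Q R S)))))
    (.comp (.cast (RigPoly.mul_assoc (mul P Q) R S)) (.cast (RigPoly.mul_assoc P Q (mul R S))))
  triangle P Q := IsCast.eq
    (.comp (.cast (RigPoly.mul_assoc P [Diag.one] Q)) (.prod .id (.cast (RigPoly.one_mul Q))))
    (.prod (.cast (RigPoly.mul_one P)) .id)
  symm_symm P Q := mulSymm_mulSymm P Q
  hexagon P Q R := mul_hexagon P Q R

/-- Most axioms for annihilators concern arrows out of the empty word, which is initial. Most axioms
without symmetries and left distributors compare casts. The others were tested on vectors. -/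
theorem stMatRig_isRig : (stMatRig T).IsRig where
  add_symmetricMonoidal := stMatRig_add_isSymmetricMonoidal T
  mul_symmetricMonoidal := stMatRig_mul_isSymmetricMonoidal T
  dl_iso P Q R := ⟨toMat (TapeCat.dlInv P Q R), toMat_dl_comp_dlInv P Q R, toMat_dlInv_comp_dl P Q R⟩
  dr_iso P Q R := isIso_castHom (RigPoly.add_mul P Q R)
  lz_iso P := isIso_castHom (RigPoly.zero_mul P)
  rz_iso P := isIso_castHom (RigPoly.mul_zero P)
  dl_nat f g h := StMat.dl_nat f g h
  dr_nat f g h := StMat.dr_nat f g h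
  lz_nat _ := hom_ext_of_eq_nil rfl _ _
  rz_nat _ := hom_ext_of_eq_nil (RigPoly.mul_zero _) _ _
  dl_symm P Q R := StMat.dl_symm P Q R
  dr_symm P Q R := StMat.dr_symm P Q R
  symm_dr P Q R := StMat.symm_dr P Q R
  dr_add_assoc (P Q R S : List (Diag T)) := IsCast.eq
    (.comp (.cast (RigPoly.add_mul (P ++ Q) R S)) (.comp (.sum (.cast (RigPoly.add_mul P Q S)) .id)
      (.cast (List.append_assoc (mul P S) (mul Q S) (mul R S)))))
    (.comp (.prod (.cast (List.append_assoc P Q R)) .id)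
      (.comp (.cast (RigPoly.add_mul P (Q ++ R) S)) (.sum .id (.cast (RigPoly.add_mul Q R S)))))
  dl_add_assoc P Q R S := StMat.dl_add_assoc P Q R S
  dl_mul_assoc P Q R S := StMat.dl_mul_assoc P Q R S
  dr_mul_assoc (P Q R S : List (Diag T)) := IsCast.eq
    (.comp (.prod (.cast (RigPoly.add_mul P Q R)) .id)
      (.comp (.cast (RigPoly.add_mul (mul P R) (mul Q R) S))
        (.sum (.cast (RigPoly.mul_assoc P R S)) (.cast (RigPoly.mul_assoc Q R S)))))
    (.comp (.cast (RigPoly.mul_assoc (P ++ Q) R S)) (.cast (RigPoly.add_mul P Q (mul R S))))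
  dl_dr_mul_assoc P Q R S := StMat.dl_dr_mul_assoc P Q R S
  dl_dr P Q R S := StMat.dl_dr P Q R S
  lz_zero := rfl
  dl_lz _ _ := hom_ext_of_eq_nil rfl _ _
  dr_rz _ _ := hom_ext_of_eq_nil (RigPoly.mul_zero _) _ _
  rz_one := hom_ext_of_eq_nil (RigPoly.mul_zero _) _ _
  lz_one := hom_ext_of_eq_nil rfl _ _
  symm_lz _ := hom_ext_of_eq_nil (RigPoly.mul_zero _) _ _
  lz_mul _ _ := hom_ext_of_eq_nil rfl _ _
  rz_lz_mul P Q := hom_ext_of_eq_nil (congrArg (RigPoly.mul · Q) (RigPoly.mul_zero P)) _ _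
  rz_mul _ _ := hom_ext_of_eq_nil (RigPoly.mul_zero _) _ _
  dl_zero_left P Q := StMat.dl_zero_left P Q
  dl_zero_right P Q := StMat.dl_zero_right P Q
  dr_zero_left P Q := IsCast.eq
    (.comp (.cast (RigPoly.add_mul [] P Q)) (.comp (.sum (.cast (RigPoly.zero_mul Q)) .id)
      (.cast (List.nil_append (mul P Q)))))
    (.prod (.cast (List.nil_append P)) .id)
  dr_zero_right P Q := IsCast.eq
    (.comp (.cast (RigPoly.add_mul P [] Q)) (.comp (.sum .id (.cast (RigPoly.zero_mul Q)))
      (.cast (List.append_nil (mul P Q)))))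
    (.prod (.cast (List.append_nil P)) .id)
  dl_one P Q := StMat.dl_one P Q
  dr_one (P Q : List (Diag T)) := IsCast.eq
    (.comp (.cast (RigPoly.add_mul P Q [Diag.one]))
      (.sum (.cast (RigPoly.mul_one P)) (.cast (RigPoly.mul_one Q))))
    (.cast (RigPoly.mul_one (P ++ Q)))

theorem stMatRig_isRightStrictRig : (stMatRig T).IsRightStrictRig where
  toIsRig := stMatRig_isRig T
  add_strict := ⟨fun P Q R => ⟨List.append_assoc P Q R, rfl⟩, fun P => ⟨List.nil_append P, rfl⟩,
    fun P => ⟨List.append_nil P, rfl⟩⟩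
  mul_strict := ⟨fun P Q R => ⟨RigPoly.mul_assoc P Q R, rfl⟩, fun P => ⟨RigPoly.one_mul P, rfl⟩,
    fun P => ⟨RigPoly.mul_one P, rfl⟩⟩
  dr_strict P Q R := ⟨RigPoly.add_mul P Q R, rfl⟩
  lz_strict P := ⟨RigPoly.zero_mul P, rfl⟩
  rz_strict P := ⟨RigPoly.mul_zero P, rfl⟩

end TapeDiagrams

/-! ### Transfer of the rig laws to tapes -/

namespace TapeDiagrams

open RigPoly

section interp

variable (T : MonoidalTheory.{u, v})

/-- The interpretation of tapes as matrices. -/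
noncomputable abbrev interpDiag : TapeCat (Diag T) ⥤ StMat (Diag T) := interpFunctor (Diag T)

theorem interpDiag_add_hom {P P' Q Q' : TapeCat (Diag T)} (f : P ⟶ P') (g : Q ⟶ Q') :
    (interpDiag T).map ((tapeRig T).add.hom f g) =
      (stMatRig T).add.hom ((interpDiag T).map f) ((interpDiag T).map g) :=
  toMat_sum f g

theorem interpDiag_mul_hom {P P' Q Q' : TapeCat (Diag T)} (f : P ⟶ P') (g : Q ⟶ Q') :
    (interpDiag T).map ((tapeRig T).mul.hom f g) =
      (stMatRig T).mul.hom ((interpDiag T).map f) ((interpDiag T).map g) :=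
  toMat_prod f g

theorem interpDiag_add_assoc (P Q R : TapeCat (Diag T)) :
    (interpDiag T).map ((tapeRig T).add.assoc P Q R).hom = ((stMatRig T).add.assoc P Q R).hom :=
  toMat_castHom (List.append_assoc (α := Diag T) P Q R)

theorem interpDiag_add_assoc_inv (P Q R : TapeCat (Diag T)) :
    (interpDiag T).map ((tapeRig T).add.assoc P Q R).inv = ((stMatRig T).add.assoc P Q R).inv :=
  toMat_castHom (List.append_assoc (α := Diag T) P Q R).symm

theorem interpDiag_add_lunit (P : TapeCat (Diag T)) :
    (interpDiag T).map ((tapeRig T).add.lunit P).hom = ((stMatRig T).add.lunit P).hom :=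
  toMat_castHom (List.nil_append (α := Diag T) P)

theorem interpDiag_add_runit (P : TapeCat (Diag T)) :
    (interpDiag T).map ((tapeRig T).add.runit P).hom = ((stMatRig T).add.runit P).hom :=
  toMat_castHom (List.append_nil (α := Diag T) P)

theorem interpDiag_add_symm (P Q : TapeCat (Diag T)) :
    (interpDiag T).map ((tapeRig T).add.symm P Q) = (stMatRig T).add.symm P Q :=
  toMat_sumSymm P Q

theorem interpDiag_mul_assoc (P Q R : TapeCat (Diag T)) :
    (interpDiag T).map ((tapeRig T).mul.assoc P Q R).hom = ((stMatRig T).mul.assoc P Q R).hom :=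
  toMat_castHom (RigPoly.mul_assoc P Q R)

theorem interpDiag_mul_lunit (P : TapeCat (Diag T)) :
    (interpDiag T).map ((tapeRig T).mul.lunit P).hom = ((stMatRig T).mul.lunit P).hom :=
  toMat_castHom (RigPoly.one_mul P)

theorem interpDiag_mul_runit (P : TapeCat (Diag T)) :
    (interpDiag T).map ((tapeRig T).mul.runit P).hom = ((stMatRig T).mul.runit P).hom :=
  toMat_castHom (RigPoly.mul_one P)

theorem interpDiag_mul_symm (P Q : TapeCat (Diag T)) :
    (interpDiag T).map ((tapeRig T).mul.symm P Q) = (stMatRig T).mul.symm P Q :=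
  toMat_mulSymm P Q

theorem interpDiag_dl (P Q R : TapeCat (Diag T)) :
    (interpDiag T).map ((tapeRig T).dl P Q R) = (stMatRig T).dl P Q R :=
  toMat_dl P Q R

theorem interpDiag_dr (P Q R : TapeCat (Diag T)) :
    (interpDiag T).map ((tapeRig T).dr P Q R) = (stMatRig T).dr P Q R :=
  toMat_castHom (RigPoly.add_mul P Q R)

theorem interpDiag_lz (P : TapeCat (Diag T)) :
    (interpDiag T).map ((tapeRig T).lz P) = (stMatRig T).lz P :=
  toMat_castHom (RigPoly.zero_mul P)

theorem interpDiag_rz (P : TapeCat (Diag T)) :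
    (interpDiag T).map ((tapeRig T).rz P) = (stMatRig T).rz P :=
  toMat_castHom (RigPoly.mul_zero P)

theorem interpDiag_isRigIso : (tapeRig T).IsRigIso (stMatRig T) (interpDiag T) where
  iso := ⟨interpInvFunctor (Diag T), interpFunctor_comp_inv, interpInvFunctor_comp⟩
  add :=
    { obj _ _ := rfl
      unit := rfl
      hom f g := heq_of_eq (interpDiag_add_hom T f g)
      assoc P Q R := heq_of_eq (interpDiag_add_assoc T P Q R)
      lunit P := heq_of_eq (interpDiag_add_lunit T P)
      runit P := heq_of_eq (interpDiag_add_runit T P)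
      symm P Q := heq_of_eq (interpDiag_add_symm T P Q) }
  mul :=
    { obj _ _ := rfl
      unit := rfl
      hom f g := heq_of_eq (interpDiag_mul_hom T f g)
      assoc P Q R := heq_of_eq (interpDiag_mul_assoc T P Q R)
      lunit P := heq_of_eq (interpDiag_mul_lunit T P)
      runit P := heq_of_eq (interpDiag_mul_runit T P)
      symm P Q := heq_of_eq (interpDiag_mul_symm T P Q) }
  dl P Q R := heq_of_eq (interpDiag_dl T P Q R)
  dr P Q R := heq_of_eq (interpDiag_dr T P Q R)
  lz P := heq_of_eq (interpDiag_lz T P)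
  rz P := heq_of_eq (interpDiag_rz T P)

end interp

variable {T : MonoidalTheory.{u, v}}

theorem TapeCat.isIso_of_isInverse {P Q : List (Diag T)} {f : TapeCat.Arr P Q} {g : TapeCat.Arr Q P}
    (h : TapeCat.IsInverse f g) : @IsIso (TapeCat (Diag T)) _ P Q f := ⟨g, h.1, h.2⟩

/-- The interpretation is faithful and preserves all structure on the nose, so it reflects every
equational law. -/
theorem tapeRig_add_isSymmetricMonoidal : (tapeRig T).add.IsSymmetricMonoidal where
  hom_id P Q := by
    refine interpFunctor_map_injective ?_
    simp only [CategoryTheory.Functor.map_id, interpDiag_add_hom]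
    exact (stMatRig_add_isSymmetricMonoidal T).hom_id P Q
  hom_comp f g f' g' := by
    refine interpFunctor_map_injective ?_
    simp only [Functor.map_comp, interpDiag_add_hom]
    exact (stMatRig_add_isSymmetricMonoidal T).hom_comp ((interpDiag T).map f) ((interpDiag T).map
      g) ((interpDiag T).map f') ((interpDiag T).map g')
  assoc_nat f g h := by
    refine interpFunctor_map_injective ?_
    simp only [Functor.map_comp, interpDiag_add_hom, interpDiag_add_assoc]
    exact (stMatRig_add_isSymmetricMonoidal T).assoc_nat ((interpDiag T).map f) ((interpDiag
      T).map g) ((interpDiag T).map h)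
  lunit_nat f := by
    refine interpFunctor_map_injective ?_
    simp only [Functor.map_comp, CategoryTheory.Functor.map_id, interpDiag_add_hom,
      interpDiag_add_lunit]
    exact (stMatRig_add_isSymmetricMonoidal T).lunit_nat ((interpDiag T).map f)
  runit_nat f := by
    refine interpFunctor_map_injective ?_
    simp only [Functor.map_comp, CategoryTheory.Functor.map_id, interpDiag_add_hom,
      interpDiag_add_runit]
    exact (stMatRig_add_isSymmetricMonoidal T).runit_nat ((interpDiag T).map f)
  symm_nat f g := by
    refine interpFunctor_map_injective ?_
    simp only [Functor.map_comp, interpDiag_add_hom, interpDiag_add_symm]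
    exact (stMatRig_add_isSymmetricMonoidal T).symm_nat ((interpDiag T).map f) ((interpDiag T).map
      g)
  pentagon P Q R S := by
    refine interpFunctor_map_injective ?_
    simp only [Functor.map_comp, CategoryTheory.Functor.map_id, interpDiag_add_hom,
      interpDiag_add_assoc]
    exact (stMatRig_add_isSymmetricMonoidal T).pentagon P Q R S
  triangle P Q := by
    refine interpFunctor_map_injective ?_
    simp only [Functor.map_comp, CategoryTheory.Functor.map_id, interpDiag_add_hom,
      interpDiag_add_assoc, interpDiag_add_lunit, interpDiag_add_runit]
    exact (stMatRig_add_isSymmetricMonoidal T).triangle P Q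
  symm_symm P Q := by
    refine interpFunctor_map_injective ?_
    simp only [Functor.map_comp, CategoryTheory.Functor.map_id, interpDiag_add_symm]
    exact (stMatRig_add_isSymmetricMonoidal T).symm_symm P Q
  hexagon P Q R := by
    refine interpFunctor_map_injective ?_
    simp only [Functor.map_comp, CategoryTheory.Functor.map_id, interpDiag_add_hom,
      interpDiag_add_assoc, interpDiag_add_symm]
    exact (stMatRig_add_isSymmetricMonoidal T).hexagon P Q R

theorem tapeRig_mul_isSymmetricMonoidal : (tapeRig T).mul.IsSymmetricMonoidal where
  hom_id P Q := by
    refine interpFunctor_map_injective ?_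
    simp only [CategoryTheory.Functor.map_id, interpDiag_mul_hom]
    exact (stMatRig_mul_isSymmetricMonoidal T).hom_id P Q
  hom_comp f g f' g' := by
    refine interpFunctor_map_injective ?_
    simp only [Functor.map_comp, interpDiag_mul_hom]
    exact (stMatRig_mul_isSymmetricMonoidal T).hom_comp ((interpDiag T).map f) ((interpDiag T).map
      g) ((interpDiag T).map f') ((interpDiag T).map g')
  assoc_nat f g h := by
    refine interpFunctor_map_injective ?_
    simp only [Functor.map_comp, interpDiag_mul_hom, interpDiag_mul_assoc]
    exact (stMatRig_mul_isSymmetricMonoidal T).assoc_nat ((interpDiag T).map f) ((interpDiag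
      T).map g) ((interpDiag T).map h)
  lunit_nat f := by
    refine interpFunctor_map_injective ?_
    simp only [Functor.map_comp, CategoryTheory.Functor.map_id, interpDiag_mul_hom,
      interpDiag_mul_lunit]
    exact (stMatRig_mul_isSymmetricMonoidal T).lunit_nat ((interpDiag T).map f)
  runit_nat f := by
    refine interpFunctor_map_injective ?_
    simp only [Functor.map_comp, CategoryTheory.Functor.map_id, interpDiag_mul_hom,
      interpDiag_mul_runit]
    exact (stMatRig_mul_isSymmetricMonoidal T).runit_nat ((interpDiag T).map f)
  symm_nat f g := by
    refine interpFunctor_map_injective ?_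
    simp only [Functor.map_comp, interpDiag_mul_hom, interpDiag_mul_symm]
    exact (stMatRig_mul_isSymmetricMonoidal T).symm_nat ((interpDiag T).map f) ((interpDiag T).map
      g)
  pentagon P Q R S := by
    refine interpFunctor_map_injective ?_
    simp only [Functor.map_comp, CategoryTheory.Functor.map_id, interpDiag_mul_hom,
      interpDiag_mul_assoc]
    exact (stMatRig_mul_isSymmetricMonoidal T).pentagon P Q R S
  triangle P Q := by
    refine interpFunctor_map_injective ?_
    simp only [Functor.map_comp, CategoryTheory.Functor.map_id, interpDiag_mul_hom,
      interpDiag_mul_assoc, interpDiag_mul_lunit, interpDiag_mul_runit]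
    exact (stMatRig_mul_isSymmetricMonoidal T).triangle P Q
  symm_symm P Q := by
    refine interpFunctor_map_injective ?_
    simp only [Functor.map_comp, CategoryTheory.Functor.map_id, interpDiag_mul_symm]
    exact (stMatRig_mul_isSymmetricMonoidal T).symm_symm P Q
  hexagon P Q R := by
    refine interpFunctor_map_injective ?_
    simp only [Functor.map_comp, CategoryTheory.Functor.map_id, interpDiag_mul_hom,
      interpDiag_mul_assoc, interpDiag_mul_symm]
    exact (stMatRig_mul_isSymmetricMonoidal T).hexagon P Q R

/-- Equations are reflected by the interpretation. Invertibility of the distributors and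
annihilators is shown by explicit inverse tapes. -/
theorem tapeRig_isRig : (tapeRig T).IsRig where
  add_symmetricMonoidal := tapeRig_add_isSymmetricMonoidal
  mul_symmetricMonoidal := tapeRig_mul_isSymmetricMonoidal
  dl_iso P Q R := TapeCat.isIso_of_isInverse (TapeCat.dl_isInverse P Q R)
  dr_iso P Q R := TapeCat.isIso_of_isInverse (.castHom (RigPoly.add_mul P Q R) (RigPoly.add_mul
    P Q R).symm)
  lz_iso P := TapeCat.isIso_of_isInverse (.castHom (RigPoly.zero_mul P) (RigPoly.zero_mul P).symm)
  rz_iso P := TapeCat.isIso_of_isInverse (.castHom (RigPoly.mul_zero P) (RigPoly.mul_zero P).symm)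
  dl_nat f g h := by
    refine interpFunctor_map_injective ?_
    simp only [Functor.map_comp, interpDiag_add_hom, interpDiag_mul_hom, interpDiag_dl]
    exact (stMatRig_isRig T).dl_nat ((interpDiag T).map f) ((interpDiag T).map g) ((interpDiag
      T).map h)
  dr_nat f g h := by
    refine interpFunctor_map_injective ?_
    simp only [Functor.map_comp, interpDiag_add_hom, interpDiag_mul_hom, interpDiag_dr]
    exact (stMatRig_isRig T).dr_nat ((interpDiag T).map f) ((interpDiag T).map g) ((interpDiag
      T).map h)
  lz_nat f := by
    refine interpFunctor_map_injective ?_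
    simp only [Functor.map_comp, CategoryTheory.Functor.map_id, interpDiag_mul_hom, interpDiag_lz]
    exact (stMatRig_isRig T).lz_nat ((interpDiag T).map f)
  rz_nat f := by
    refine interpFunctor_map_injective ?_
    simp only [Functor.map_comp, CategoryTheory.Functor.map_id, interpDiag_mul_hom, interpDiag_rz]
    exact (stMatRig_isRig T).rz_nat ((interpDiag T).map f)
  dl_symm P Q R := by
    refine interpFunctor_map_injective ?_
    simp only [Functor.map_comp, CategoryTheory.Functor.map_id, interpDiag_mul_hom,
      interpDiag_add_symm, interpDiag_dl]
    exact (stMatRig_isRig T).dl_symm P Q R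
  dr_symm P Q R := by
    refine interpFunctor_map_injective ?_
    simp only [Functor.map_comp, CategoryTheory.Functor.map_id, interpDiag_mul_hom,
      interpDiag_add_symm, interpDiag_dr]
    exact (stMatRig_isRig T).dr_symm P Q R
  symm_dr P Q R := by
    refine interpFunctor_map_injective ?_
    simp only [Functor.map_comp, interpDiag_add_hom, interpDiag_mul_symm, interpDiag_dl,
      interpDiag_dr]
    exact (stMatRig_isRig T).symm_dr P Q R
  dr_add_assoc P Q R S := by
    refine interpFunctor_map_injective ?_
    simp only [Functor.map_comp, CategoryTheory.Functor.map_id, interpDiag_add_hom,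
      interpDiag_mul_hom, interpDiag_add_assoc, interpDiag_dr]
    exact (stMatRig_isRig T).dr_add_assoc P Q R S
  dl_add_assoc P Q R S := by
    refine interpFunctor_map_injective ?_
    simp only [Functor.map_comp, CategoryTheory.Functor.map_id, interpDiag_add_hom,
      interpDiag_mul_hom, interpDiag_add_assoc, interpDiag_dl]
    exact (stMatRig_isRig T).dl_add_assoc P Q R S
  dl_mul_assoc P Q R S := by
    refine interpFunctor_map_injective ?_
    simp only [Functor.map_comp, CategoryTheory.Functor.map_id, interpDiag_add_hom,
      interpDiag_mul_hom, interpDiag_mul_assoc, interpDiag_dl]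
    exact (stMatRig_isRig T).dl_mul_assoc P Q R S
  dr_mul_assoc P Q R S := by
    refine interpFunctor_map_injective ?_
    simp only [Functor.map_comp, CategoryTheory.Functor.map_id, interpDiag_add_hom,
      interpDiag_mul_hom, interpDiag_mul_assoc, interpDiag_dr]
    exact (stMatRig_isRig T).dr_mul_assoc P Q R S
  dl_dr_mul_assoc P Q R S := by
    refine interpFunctor_map_injective ?_
    simp only [Functor.map_comp, CategoryTheory.Functor.map_id, interpDiag_add_hom,
      interpDiag_mul_hom, interpDiag_mul_assoc, interpDiag_dl, interpDiag_dr]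
    exact (stMatRig_isRig T).dl_dr_mul_assoc P Q R S
  dl_dr P Q R S := by
    refine interpFunctor_map_injective ?_
    simp only [RigData.mid, Functor.map_comp, CategoryTheory.Functor.map_id, interpDiag_add_hom,
      interpDiag_add_assoc, interpDiag_add_assoc_inv, interpDiag_add_symm, interpDiag_dl,
      interpDiag_dr]
    exact (stMatRig_isRig T).dl_dr P Q R S
  lz_zero := rfl
  dl_lz P Q := by
    refine interpFunctor_map_injective ?_
    simp only [Functor.map_comp, interpDiag_add_hom, interpDiag_add_lunit, interpDiag_dl,
      interpDiag_lz]
    exact (stMatRig_isRig T).dl_lz P Q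
  dr_rz P Q := by
    refine interpFunctor_map_injective ?_
    simp only [Functor.map_comp, interpDiag_add_hom, interpDiag_add_lunit, interpDiag_dr,
      interpDiag_rz]
    exact (stMatRig_isRig T).dr_rz P Q
  rz_one := by
    refine interpFunctor_map_injective ?_
    simp only [interpDiag_mul_lunit, interpDiag_rz]
    exact (stMatRig_isRig T).rz_one
  lz_one := by
    refine interpFunctor_map_injective ?_
    simp only [interpDiag_mul_runit, interpDiag_lz]
    exact (stMatRig_isRig T).lz_one
  symm_lz P := by
    refine interpFunctor_map_injective ?_
    simp only [Functor.map_comp, interpDiag_mul_symm, interpDiag_lz, interpDiag_rz]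
    exact (stMatRig_isRig T).symm_lz P
  lz_mul P Q := by
    refine interpFunctor_map_injective ?_
    simp only [Functor.map_comp, CategoryTheory.Functor.map_id, interpDiag_mul_hom,
      interpDiag_mul_assoc, interpDiag_lz]
    exact (stMatRig_isRig T).lz_mul P Q
  rz_lz_mul P Q := by
    refine interpFunctor_map_injective ?_
    simp only [Functor.map_comp, CategoryTheory.Functor.map_id, interpDiag_mul_hom,
      interpDiag_mul_assoc, interpDiag_lz, interpDiag_rz]
    exact (stMatRig_isRig T).rz_lz_mul P Q
  rz_mul P Q := by
    refine interpFunctor_map_injective ?_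
    simp only [Functor.map_comp, CategoryTheory.Functor.map_id, interpDiag_mul_hom,
      interpDiag_mul_assoc, interpDiag_rz]
    exact (stMatRig_isRig T).rz_mul P Q
  dl_zero_left P Q := by
    refine interpFunctor_map_injective ?_
    simp only [Functor.map_comp, CategoryTheory.Functor.map_id, interpDiag_add_hom,
      interpDiag_mul_hom, interpDiag_add_lunit, interpDiag_dl, interpDiag_rz]
    exact (stMatRig_isRig T).dl_zero_left P Q
  dl_zero_right P Q := by
    refine interpFunctor_map_injective ?_
    simp only [Functor.map_comp, CategoryTheory.Functor.map_id, interpDiag_add_hom,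
      interpDiag_mul_hom, interpDiag_add_runit, interpDiag_dl, interpDiag_rz]
    exact (stMatRig_isRig T).dl_zero_right P Q
  dr_zero_left P Q := by
    refine interpFunctor_map_injective ?_
    simp only [Functor.map_comp, CategoryTheory.Functor.map_id, interpDiag_add_hom,
      interpDiag_mul_hom, interpDiag_add_lunit, interpDiag_dr, interpDiag_lz]
    exact (stMatRig_isRig T).dr_zero_left P Q
  dr_zero_right P Q := by
    refine interpFunctor_map_injective ?_
    simp only [Functor.map_comp, CategoryTheory.Functor.map_id, interpDiag_add_hom,
      interpDiag_mul_hom, interpDiag_add_runit, interpDiag_dr, interpDiag_lz]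
    exact (stMatRig_isRig T).dr_zero_right P Q
  dl_one P Q := by
    refine interpFunctor_map_injective ?_
    simp only [Functor.map_comp, interpDiag_add_hom, interpDiag_mul_lunit, interpDiag_dl]
    exact (stMatRig_isRig T).dl_one P Q
  dr_one P Q := by
    refine interpFunctor_map_injective ?_
    simp only [Functor.map_comp, interpDiag_add_hom, interpDiag_mul_runit, interpDiag_dr]
    exact (stMatRig_isRig T).dr_one P Q

theorem tapeRig_isRightStrictRig : (tapeRig T).IsRightStrictRig where
  toIsRig := tapeRig_isRig
  add_strict := ⟨fun P Q R => ⟨List.append_assoc P Q R, rfl⟩, fun P => ⟨List.nil_append P, rfl⟩,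
    fun P => ⟨List.append_nil P, rfl⟩⟩
  mul_strict := ⟨fun P Q R => ⟨RigPoly.mul_assoc P Q R, rfl⟩, fun P => ⟨RigPoly.one_mul P, rfl⟩,
    fun P => ⟨RigPoly.mul_one P, rfl⟩⟩
  dr_strict P Q R := ⟨RigPoly.add_mul P Q R, rfl⟩
  lz_strict P := ⟨RigPoly.zero_mul P, rfl⟩
  rz_strict P := ⟨RigPoly.mul_zero P, rfl⟩

end TapeDiagrams

theorem mainTheorem7 (T : TapeDiagrams.MonoidalTheory.{u, v}) :
    (TapeDiagrams.tapeRig T).IsRightStrictRig ∧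
    (TapeDiagrams.stMatRig T).IsRightStrictRig ∧
    ∃ F : CategoryTheory.Functor (TapeDiagrams.TapeCat (TapeDiagrams.Diag T))
        (TapeDiagrams.StMat (TapeDiagrams.Diag T)),
      (TapeDiagrams.tapeRig T).IsRigIso (TapeDiagrams.stMatRig T) F ∧
      TapeDiagrams.IsInterpretation F :=
  ⟨TapeDiagrams.tapeRig_isRightStrictRig, TapeDiagrams.stMatRig_isRightStrictRig T,
    TapeDiagrams.interpDiag T, TapeDiagrams.interpDiag_isRigIso T,
    TapeDiagrams.interpFunctor_isInterpretation⟩
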